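/- Let $\mu>0$ and $a\in\mathbb R$ with $4a^2<\mu$. Put $G=1-\frac{\mu}{r^2}+\frac{\mu a^2}{r^4}$, $D=\frac12\sqrt{\mu(\mu-4a^2)}$, $r_\pm^2=\frac{\mu}{2}\pm D$. On the exterior region $r>r_+$ of $\mathbb R_t\times(0,\infty)_r\times S^3$ consider the five-dimensional Myers–Perry metric with equal angular momenta $$g=-dt^2+\frac{dr^2}{G}+r^2\big\{2\bar\sigma^+\bar\sigma^-+(\bar\sigma^3)^2\big\}+\frac{\mu}{r^2}(dt-a\bar\sigma^3)^2,$$ where, in Euler angles $(\theta,\phi,\psi)$, $\bar\sigma^1=\frac12(-\sin\phi\,d\theta+\cos\phi\sin\theta\,d\psi)$, $\bar\sigma^2=\frac12(-\cos\phi\,d\theta-\sin\phi\sin\theta\,d\psi)$, $\bar\sigma^3=\frac12(d\phi+\cos\theta\,d\psi)$ and $\bar\sigma^\pm=\frac1{\sqrt2}(\bar\sigma^1\pm i\bar\sigma^2)$; let $\bar\sigma_i$ be the dual vector fields. Let $f=-ar\,dt\wedge dr\wedge\bar\sigma^3-i r^2\,\bar\sigma^+\wedge\bar\sigma^-\wedge(-a\,dt+r^2\bar\sigma^3)$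 be its Killing–Yano 3-form, and for a symmetric tensor $h$ let $(\mathcal Sh)_{\lambda\rho}=2f_{(\lambda}{}^{\kappa\tau}\nabla_{|\kappa|}h_{\rho)\tau}$, with $\nabla$ the Levi-Civita connection of $g$. A *stationary $(0,0,0)$ perturbation* is a tensor $h=h_{AB}(r)\bar\sigma^A\bar\sigma^B+2h_{+-}(r)\bar\sigma^+\bar\sigma^-$ on $r>r_+$ with $A,B\in\{t,r,3\}$, $\bar\sigma^t=dt$, $\bar\sigma^r=dr$, and smooth coefficients. It is a *solution* if its linearized Einstein tensor vanishes, and it is *gauge-fixed* if $h_{tr}=h_{r3}=h_{+-}=0$. Gauge fields are $\xi=\xi_A(t,r)\bar\sigma^A$ with smooth $\xi_A$, and they act by $(\delta_\xi g)_{\lambda\rho}=\nabla_\lambda\xi_\rho+\nabla_\rho\xi_\lambda$. Define six gauge-fixed tensors by their non-zero components (put $q=1-\frac{\mu}{2r^2}$, $N=\frac{r^2-r_+^2}{r^2-r_-^2}$): * $h^{\rm g1}$: $h_{tt}=-2(1-\frac{\mu}{r^2})$, $h_{t3}=-\frac{\mu a}{r^2}$; * $h^{\rm g2}$: $h_{tt}=-\frac{2\mu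 a}{r^2}$, $h_{t3}=r^2(1+\frac{\mu a^2}{r^4})$; * $h^{\rm md}$: $h_{tt}=\frac1{r^2}$, $h_{t3}=-\frac a{r^2}$, $h_{33}=\frac{a^2}{r^2}$, $h_{rr}=\frac{r^2-a^2}{r^4G^2}$; * $h^{\rm sd}$: $h_{t3}=-\frac1{r^2}$, $h_{33}=\frac{2a}{r^2}$, $h_{rr}=-\frac{2a}{r^4G^2}$; * $h^{\rm sq}$: $h_{tt}=\mu q$, $h_{t3}=-\mu a q$, $h_{33}=-r^4(1-\frac{\mu a^2}{r^4})q$, $h_{rr}=\frac{r^2}{G^2}\{-2G+(1-\frac{\mu a^2}{r^4})q\}$; * $h^{\rm si}$: $h_{tt}=-3D+\frac{D^2}{\mu}q\ln N$, $h_{t3}=\frac{3aD}{2}+\big(-\frac{3\mu a}{4}+\frac{\mu a(\mu+2a^2)}{8r^2}+\frac{3ar^2}{4}\big)\ln N$, $h_{33}=-\frac32Dr^2+\big(\frac{3\mu a^2}{4}-\frac{\mu a^2(\mu+8a^2)}{8r^2}+\frac{3\mu r^2}{8}-\frac{3r^4}{4}\big)\ln N$, $h_{rr}=-\frac{r^2}{8G^2}\big\{\frac{4D}{r^4}\big(\frac{4D^2}{\mu}+3r^2+3\mu\big)+\big[6-\frac{9\mu}{r^2}+\frac{2\mu}{r^4}(\mu+5a^2)-\frac{\mu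 a^2}{r^6}(\mu+8a^2)\big]\ln N\big\}$. Then the following hold on $r>r_+$. 1. (Gauge.) Every stationary $(0,0,0)$ perturbation becomes gauge-fixed after adding $\delta_\xi g$ for some gauge field $\xi=\xi_A(r)\bar\sigma^A$. If $\delta_\xi g$ is stationary and gauge-fixed for a gauge field $\xi=\xi_A(t,r)\bar\sigma^A$, then it is a linear combination of $h^{\rm g1}$ and $h^{\rm g2}$; these two are $\delta_\xi g$ for the covectors dual to $t\,\partial_t$ and $t\,\bar\sigma_3=2t\,\partial_\phi$. 2. (The other pieces.) $h^{\rm md}$ is the derivative of $g$ with respect to $\mu$ at fixed $a$, and $h^{\rm sd}$ is the derivative of $g$ with respect to $\mu a$ at fixed $\mu$. Up to a gauge transformation by some $\xi_A(r)\bar\sigma^A$, $h^{\rm sq}$ is $\frac12$ times the derivative at $\varepsilon=0$ of the Dobiasch–Maison family $-dt^2+\frac{k_\varepsilon^2dr^2}{G}+r^2\{2k_\varepsilon\bar\sigma^+\bar\sigma^-+(\bar\sigma^3)^2\}+\frac{\mu}{r^2}(dt-a\bar\sigma^3)^2$, where $k_\varepsilon=\frac{(1-\varepsilon(r_+^2-a^2))(1-\varepsilon(r_-^2-a^2))}{(1-\varepsilon(r^2-a^2))^2}$.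 3. (General solution.) The six tensors are a basis of the space of gauge-fixed stationary $(0,0,0)$ solutions. Every stationary $(0,0,0)$ solution is, up to a gauge transformation by some $\xi_A(r)\bar\sigma^A$, a linear combination of them. 4. (Action of $\mathcal S$.) Let $\hat{\mathcal S}h$ be $\mathcal Sh$ brought back to the gauge $h_{+-}=0$, i.e. $\hat{\mathcal S}h=\mathcal Sh+\delta_\xi g$ with $\xi=-\frac{(\mathcal Sh)_{+-}}{2rG}\,dr$. Then $\hat{\mathcal S}$ is linear on the span of the six tensors and $$\hat{\mathcal S}h^{\rm g1}=0,\quad \hat{\mathcal S}h^{\rm g2}=4ah^{\rm g1}+2h^{\rm g2},\quad \hat{\mathcal S}h^{\rm md}=-ah^{\rm sd},\quad \hat{\mathcal S}h^{\rm sd}=2h^{\rm sd},$$ $$\hat{\mathcal S}h^{\rm sq}=6\Big\{h^{\rm sq}+\frac{\mu}{3}h^{\rm g1}+\frac{2a}{3}h^{\rm g2}-\frac{4D^2}{3}h^{\rm md}+\frac{2aD^2}{3}h^{\rm sd}\Big\},$$ $$\hat{\mathcal S}h^{\rm si}=6\Big\{h^{\rm si}-\frac{3D}{2}h^{\rm g1}+\frac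 D2(7\mu-4a^2)h^{\rm md}-\frac{aD^3}{\mu}h^{\rm sd}\Big\}.$$ This space has a basis of six eigentensors of $\hat{\mathcal S}$, with eigenvalues $0,2,0,2,6,6$. 5. (Regularity.) Call a stationary $(0,0,0)$ perturbation $h$ regular on the horizon if there is a gauge field $\xi=\xi_A(t,r)\bar\sigma^A$ on $r>r_+$ such that the components of $h+\delta_\xi g$ in the frame $(\partial_t,\ \partial_r-\alpha(\partial_t+\Omega\bar\sigma_3),\ \bar\sigma_1,\bar\sigma_2,\bar\sigma_3)$, where $\alpha=\frac{\sqrt{g_{33}}}{rG}$ and $\Omega=-\frac{g_{t3}}{g_{33}}$, are functions of $r$ that extend smoothly across $r=r_+$. (The second vector is null and ingoing; this is the frame of ingoing coordinates that are regular across the future horizon.) A linear combination of the six tensors is regular on the horizon if and only if its $h^{\rm si}$-coefficient is zero. If $h$ is any stationary $(0,0,0)$ solution that is regular on the horizon, then so is $\mathcal Sh$. -/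

import Mathlib

open Set
open scoped ContDiff

namespace MyersPerry

noncomputable section

/-! ## The coordinate chart and the invariant frame -/

/-- Points of the chart, with coordinates `(t, r, θ, φ, ψ)`: time, the radial coordinate `r̃`
and the Euler angles `θ̃, φ̃, ψ̃` of the 3-sphere. -/
abbrev Point := Fin 5 → ℝ

/-- A covector field, given by its components in the coframe `(dt, dr, σ̄¹, σ̄², σ̄³)`. -/
abbrev CovectorField := Point → Fin 5 → ℝ

/-- A rank-2 covariant tensor field, given by its components in the coframe
`(dt, dr, σ̄¹, σ̄², σ̄³)`. -/
abbrev TensorField := Point → Matrix (Fin 5) (Fin 5) ℝ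

/-- The frame of vector fields `(∂_t, ∂_r, σ̄₁, σ̄₂, σ̄₃)`, in coordinate components. -/
def frame (i : Fin 5) (x : Point) : Point :=
  ![![1, 0, 0, 0, 0],
    ![0, 1, 0, 0, 0],
    ![0, 0, -2 * Real.sin (x 3),
      -2 * (Real.cos (x 2) / Real.sin (x 2)) * Real.cos (x 3),
      2 * Real.cos (x 3) / Real.sin (x 2)],
    ![0, 0, -2 * Real.cos (x 3),
      2 * (Real.cos (x 2) / Real.sin (x 2)) * Real.sin (x 3),
      -2 * Real.sin (x 3) / Real.sin (x 2)],
    ![0, 0, 0, 2, 0]] i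

/-- The dual coframe `(dt, dr, σ̄¹, σ̄², σ̄³)` at `x`, evaluated on a vector `v` given in
coordinate components. -/
def coframe (i : Fin 5) (x v : Point) : ℝ :=
  ![v 0,
    v 1,
    (-Real.sin (x 3) * v 2 + Real.cos (x 3) * Real.sin (x 2) * v 4) / 2,
    (-Real.cos (x 3) * v 2 - Real.sin (x 3) * Real.sin (x 2) * v 4) / 2,
    (v 3 + Real.cos (x 2) * v 4) / 2] i

/-- The derivative of a function along the `i`-th frame field. -/
def frameDeriv (i : Fin 5) (f : Point → ℝ) (x : Point) : ℝ :=
  fderiv ℝ f x (frame i x)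

/-- The structure functions `c_{ij}^k` of the frame: `[e_i, e_j] = ∑ k, c_{ij}^k e_k`. -/
def structureFn (i j k : Fin 5) (x : Point) : ℝ :=
  coframe k x (VectorField.lieBracket ℝ (frame i) (frame j) x)

/-! ## Levi-Civita connection and linearized Einstein operator of a metric `g` -/

/-- `g(∇_{e_i} e_j, e_k)` by the Koszul formula. -/
def christoffelLow (g : TensorField) (i j k : Fin 5) (x : Point) : ℝ :=
  1 / 2 * (frameDeriv i (fun y => g y j k) x + frameDeriv j (fun y => g y i k) x
    - frameDeriv k (fun y => g y i j) x
    + ∑ l, (structureFn i j l x * g x l k - structureFn i k l x * g x l j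
        - structureFn j k l x * g x l i))

/-- The connection coefficient `Γ^l_{ij} = e^l(∇_{e_i} e_j)`. -/
def christoffel (g : TensorField) (l i j : Fin 5) (x : Point) : ℝ :=
  ∑ k, (g x)⁻¹ l k * christoffelLow g i j k x

/-- `∇_i ξ_j`. -/
def nabla1 (g : TensorField) (ξ : CovectorField) (i j : Fin 5) (x : Point) : ℝ :=
  frameDeriv i (fun y => ξ y j) x - ∑ l, christoffel g l i j x * ξ x l

/-- `∇_i h_{jk}`. -/
def nabla2 (g : TensorField) (h : TensorField) (i j k : Fin 5) (x : Point) : ℝ :=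
  frameDeriv i (fun y => h y j k) x
    - ∑ l, (christoffel g l i j x * h x l k + christoffel g l i k x * h x j l)

/-- `∇_i ∇_j h_{kl}`. -/
def nablaNabla (g : TensorField) (h : TensorField) (i j k l : Fin 5) (x : Point) : ℝ :=
  frameDeriv i (nabla2 g h j k l) x
    - ∑ p, (christoffel g p i j x * nabla2 g h p k l x
        + christoffel g p i k x * nabla2 g h j p l x
        + christoffel g p i l x * nabla2 g h j k p x)

/-- The linearized Ricci tensor
`δR_{ij} = ½ (∇^k ∇_i h_{jk} + ∇^k ∇_j h_{ik} - ∇^k ∇_k h_{ij} - ∇_i ∇_j h^k_k)`. -/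
def linRicci (g : TensorField) (h : TensorField) : TensorField := fun x =>
  Matrix.of fun i j => 1 / 2 * ∑ k, ∑ l, (g x)⁻¹ k l *
    (nablaNabla g h k i j l x + nablaNabla g h k j i l x
      - nablaNabla g h k l i j x - nablaNabla g h i j k l x)

/-- The linearized Einstein tensor `δG_{ij} = δR_{ij} - ½ g_{ij} g^{kl} δR_{kl}` about a
Ricci-flat metric `g`. -/
def linEinstein (g : TensorField) (h : TensorField) : TensorField := fun x =>
  linRicci g h x - (1 / 2 * ∑ k, ∑ l, (g x)⁻¹ k l * linRicci g h x k l) • g x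

/-- The infinitesimal gauge transformation `(δh)_{ij} = ∇_i ξ_j + ∇_j ξ_i`. -/
def gaugeVariation (g : TensorField) (ξ : CovectorField) : TensorField := fun x =>
  Matrix.of fun i j => nabla1 g ξ i j x + nabla1 g ξ j i x

/-! ## The background spacetime -/

/-- The symmetric tensor `tt dt² + 2 tr dt dr + 2 t3 dt σ̄³ + rr dr² + 2 r3 dr σ̄³ + s (σ̄³)²
+ 2 pm σ̄⁺ σ̄⁻`, where `2 σ̄⁺ σ̄⁻ = (σ̄¹)² + (σ̄²)²`. -/
def modeMatrix (tt tr t3 rr r3 s pm : ℝ) : Matrix (Fin 5) (Fin 5) ℝ :=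
  !![tt, tr, 0, 0, t3;
     tr, rr, 0, 0, r3;
     0, 0, pm, 0, 0;
     0, 0, 0, pm, 0;
     t3, r3, 0, 0, s]

/-- `G(r) = 1 - μ / r² + μ a² / r⁴`. -/
def G (μ a r : ℝ) : ℝ := 1 - μ / r ^ 2 + μ * a ^ 2 / r ^ 4

/-- The five-dimensional Myers-Perry metric with equal angular momenta. -/
def metric (μ a : ℝ) : TensorField := fun x =>
  modeMatrix (-1 + μ / x 1 ^ 2) 0 (-(μ * a / x 1 ^ 2)) (1 / G μ a (x 1)) 0
    (x 1 ^ 2 + μ * a ^ 2 / x 1 ^ 2) (x 1 ^ 2)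

/-- `D = ½ √(μ (μ - 4 a²))`. -/
def D (μ a : ℝ) : ℝ := 1 / 2 * √(μ * (μ - 4 * a ^ 2))

/-- The radius of the outer horizon, `r_+² = μ / 2 + D`. -/
def rPlus (μ a : ℝ) : ℝ := √(μ / 2 + D μ a)

/-- The exterior region `r > r_+` (in the chart `0 < θ < π` of the sphere). -/
def exterior (μ a : ℝ) : Set Point :=
  {x | rPlus μ a < x 1 ∧ 0 < x 2 ∧ x 2 < Real.pi}

/-- The components of `e^i ∧ e^j ∧ e^k`, normalized by `(e^i ∧ e^j ∧ e^k)_{ijk} = 1`. -/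
def wedge3 (i j k p q s : Fin 5) : ℝ :=
  Matrix.det (Matrix.of fun m n : Fin 3 =>
    if ![i, j, k] m = ![p, q, s] n then (1 : ℝ) else 0)

/-- The Killing-Yano 3-form
`f = -a r dt ∧ dr ∧ σ̄³ - r² σ̄¹ ∧ σ̄² ∧ (-a dt + r² σ̄³)` (note `i σ̄⁺ ∧ σ̄⁻ = σ̄¹ ∧ σ̄²`). -/
def killingYano (a : ℝ) (p q s : Fin 5) (x : Point) : ℝ :=
  -a * x 1 * wedge3 0 1 4 p q s
    - x 1 ^ 2 * (-a * wedge3 2 3 0 p q s + x 1 ^ 2 * wedge3 2 3 4 p q s)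

/-- `f_l^{kt}`, the Killing-Yano form with its last two indices raised. -/
def killingYanoUp (μ a : ℝ) (l k t : Fin 5) (x : Point) : ℝ :=
  ∑ i, ∑ j, (metric μ a x)⁻¹ k i * (metric μ a x)⁻¹ t j * killingYano a l i j x

/-- The symmetry operator
`(S h)_{lp} = 2 f_{(l}^{kt} ∇_{|k|} h_{p)t} = f_l^{kt} ∇_k h_{pt} + f_p^{kt} ∇_k h_{lt}`. -/
def symOp (μ a : ℝ) (h : TensorField) : TensorField := fun x =>
  Matrix.of fun l p => ∑ k, ∑ t,
    (killingYanoUp μ a l k t x * nabla2 (metric μ a) h k p t x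
      + killingYanoUp μ a p k t x * nabla2 (metric μ a) h k l t x)

/-! ## Stationary `(J, K, M) = (0, 0, 0)` perturbations -/

/-- `h` is a smooth stationary tensor in the `(0,0,0)` mode on the exterior region:
`h = h_{AB}(r) σ̄^A σ̄^B + 2 h_{+-}(r) σ̄⁺ σ̄⁻` with `A, B ∈ {t, r, 3}`. -/
def IsStationaryMode (μ a : ℝ) (h : TensorField) : Prop :=
  ∃ p : Fin 7 → ℝ → ℝ, (∀ i, ContDiffOn ℝ ∞ (p i) (Ioi (rPlus μ a))) ∧
    EqOn h (fun x => modeMatrix (p 0 (x 1)) (p 1 (x 1)) (p 2 (x 1)) (p 3 (x 1)) (p 4 (x 1))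
      (p 5 (x 1)) (p 6 (x 1))) (exterior μ a)

/-- `h` solves the linearized Einstein equation `δG_{ij} = 0` on the exterior region. -/
def IsSolution (μ a : ℝ) (h : TensorField) : Prop :=
  ∀ x ∈ exterior μ a, linEinstein (metric μ a) h x = 0

/-- The gauge condition `h_{tr} = 0`, `h_{r3} = 0`, `h_{+-} = 0`. -/
def IsGaugeFixed (μ a : ℝ) (h : TensorField) : Prop :=
  ∀ x ∈ exterior μ a, h x 0 1 = 0 ∧ h x 1 4 = 0 ∧ h x 2 2 = 0

/-- `ξ = ξ_A(t, r) σ̄^A`, `A ∈ {t, r, 3}`, with smooth components: the gauge fields of the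
`(0,0,0)` mode. -/
def IsGaugeField (μ a : ℝ) (ξ : CovectorField) : Prop :=
  ∃ p : Fin 3 → ℝ × ℝ → ℝ, (∀ i, ContDiffOn ℝ ∞ (p i) (univ ×ˢ Ioi (rPlus μ a))) ∧
    EqOn ξ (fun x => ![p 0 (x 0, x 1), p 1 (x 0, x 1), 0, 0, p 2 (x 0, x 1)]) (exterior μ a)

/-- A gauge field of the `(0,0,0)` mode whose components depend on `r` only. -/
def IsStationaryGaugeField (μ a : ℝ) (ξ : CovectorField) : Prop :=
  ∃ p : Fin 3 → ℝ → ℝ, (∀ i, ContDiffOn ℝ ∞ (p i) (Ioi (rPlus μ a))) ∧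
    EqOn ξ (fun x => ![p 0 (x 1), p 1 (x 1), 0, 0, p 2 (x 1)]) (exterior μ a)

/-- The covector field `g(v, ·)` for a vector field `v` given in frame components. -/
def lower (g : TensorField) (v : Point → Fin 5 → ℝ) : CovectorField := fun x =>
  Matrix.mulVec (g x) (v x)

/-- The symmetry operator followed by the return to the gauge `h_{+-} = 0` by means of the
gauge field `ξ = ξ_r dr`, `ξ_r = -(S h)_{+-} / (2 r G)`. -/
def symOpGauged (μ a : ℝ) (h : TensorField) : TensorField :=
  symOp μ a h + gaugeVariation (metric μ a)
    (fun x => ![0, -(symOp μ a h x 2 2) / (2 * x 1 * G μ a (x 1)), 0, 0, 0])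

/-! ## The six perturbations -/

/-- First residual gauge mode. -/
def hg1 (μ a : ℝ) : TensorField := fun x =>
  modeMatrix (-2 * (1 - μ / x 1 ^ 2)) 0 (-(μ * a / x 1 ^ 2)) 0 0 0 0

/-- Second residual gauge mode. -/
def hg2 (μ a : ℝ) : TensorField := fun x =>
  modeMatrix (-(2 * μ * a / x 1 ^ 2)) 0 (x 1 ^ 2 * (1 + μ * a ^ 2 / x 1 ^ 4)) 0 0 0 0

/-- Shift of the mass parameter. -/
def hmd (μ a : ℝ) : TensorField := fun x =>
  modeMatrix (1 / x 1 ^ 2) 0 (-(a / x 1 ^ 2))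
    (x 1 ^ 4 * (x 1 ^ 2 - a ^ 2) / (x 1 ^ 8 * G μ a (x 1) ^ 2)) 0 (a ^ 2 / x 1 ^ 2) 0

/-- Shift of the spin parameter `μ a`. -/
def hsd (μ a : ℝ) : TensorField := fun x =>
  modeMatrix 0 0 (-(1 / x 1 ^ 2)) (-(2 * a / (x 1 ^ 4 * G μ a (x 1) ^ 2))) 0
    (2 * a / x 1 ^ 2) 0

/-- Squashing along the Dobiasch-Maison family. -/
def hsq (μ a : ℝ) : TensorField := fun x =>
  modeMatrix (μ * (1 - μ / (2 * x 1 ^ 2))) 0 (-(μ * a * (1 - μ / (2 * x 1 ^ 2))))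
    (x 1 ^ 2 / G μ a (x 1) ^ 2 *
      (-2 * G μ a (x 1) + (1 - μ * a ^ 2 / x 1 ^ 4) * (1 - μ / (2 * x 1 ^ 2)))) 0
    (-(x 1 ^ 4 * (1 - μ * a ^ 2 / x 1 ^ 4) * (1 - μ / (2 * x 1 ^ 2)))) 0

/-- `ln N(r)` with `N = (r² - r_+²) / (r² - r_-²)`, `r_±² = μ / 2 ± D`. -/
def logN (μ a r : ℝ) : ℝ :=
  Real.log ((r ^ 2 - μ / 2 - D μ a) / (r ^ 2 - μ / 2 + D μ a))

/-- The perturbation that is singular on the horizon. -/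
def hsi (μ a : ℝ) : TensorField := fun x =>
  modeMatrix
    (-3 * D μ a + D μ a ^ 2 / μ * (1 - μ / (2 * x 1 ^ 2)) * logN μ a (x 1))
    0
    (3 * a * D μ a / 2 + (-(3 * μ * a / 4) + μ * a * (μ + 2 * a ^ 2) / (8 * x 1 ^ 2)
      + 3 * a * x 1 ^ 2 / 4) * logN μ a (x 1))
    (-(x 1 ^ 2 / (8 * G μ a (x 1) ^ 2)) *
      (4 * D μ a / x 1 ^ 4 * (4 * D μ a ^ 2 / μ + 3 * x 1 ^ 2 + 3 * μ)
        + (6 - 9 * μ / x 1 ^ 2 + 2 * μ / x 1 ^ 4 * (μ + 5 * a ^ 2)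
          - μ * a ^ 2 / x 1 ^ 6 * (μ + 8 * a ^ 2)) * logN μ a (x 1)))
    0
    (-(3 / 2 * D μ a * x 1 ^ 2) + (3 * μ * a ^ 2 / 4
      - μ * a ^ 2 * (μ + 8 * a ^ 2) / (8 * x 1 ^ 2) + 3 * μ * x 1 ^ 2 / 8
      - 3 * x 1 ^ 4 / 4) * logN μ a (x 1))
    0

/-- The six perturbations in the order `g1, g2, md, sd, sq, si`. -/
def basisTensor (μ a : ℝ) : Fin 6 → TensorField :=
  ![hg1 μ a, hg2 μ a, hmd μ a, hsd μ a, hsq μ a, hsi μ a]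

/-- The linear combination of the six perturbations with coefficients `c`. -/
def comb (μ a : ℝ) (c : Fin 6 → ℝ) : TensorField := ∑ i, c i • basisTensor μ a i

/-- The Dobiasch-Maison family of squashed Kaluza-Klein black holes with equal angular momenta,
`-dt² + k² dr² / G + r² (2 k σ̄⁺ σ̄⁻ + (σ̄³)²) + (μ / r²) (dt - a σ̄³)²`; the parameter is
`ε = 1 / ρ_∞²`, where `ρ² = r² - a²` and `ρ_∞` is the value of `ρ` at spatial infinity, and
`k = (1 - ε ρ_+²) (1 - ε ρ_-²) / (1 - ε ρ²)²`. -/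
def dobiaschMaison (μ a ε : ℝ) : TensorField := fun x =>
  let k : ℝ := (1 - ε * (rPlus μ a ^ 2 - a ^ 2)) * (1 - ε * (μ / 2 - D μ a - a ^ 2)) /
    (1 - ε * (x 1 ^ 2 - a ^ 2)) ^ 2
  modeMatrix (-1 + μ / x 1 ^ 2) 0 (-(μ * a / x 1 ^ 2)) (k ^ 2 / G μ a (x 1)) 0
    (x 1 ^ 2 + μ * a ^ 2 / x 1 ^ 2) (x 1 ^ 2 * k)

/-! ## Regularity on the future horizon -/

/-- `Ω(r) = -g_{t3} / g_{33}`. -/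
def angularVelocity (μ a r : ℝ) : ℝ := μ * a / (r ^ 4 + μ * a ^ 2)

/-- `α = √g_{33} / (r G)`; the vector field `∂_r - α (∂_t + Ω σ̄₃)` is null and ingoing. -/
def ingoingSlope (μ a r : ℝ) : ℝ :=
  √(r ^ 2 + μ * a ^ 2 / r ^ 2) / (r * G μ a r)

/-- The frame `(∂_t, ∂_r - α (∂_t + Ω σ̄₃), σ̄₁, σ̄₂, σ̄₃)` (as rows). It is the frame
`(∂_v, ∂_r, σ̄₁, σ̄₂, σ̄₃)` of the ingoing coordinates `dv = dt + α dr`,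
`dφ' = dφ + 2 α Ω dr`, which are regular across the future horizon. (The fields `σ̄₁, σ̄₂` agree
with the corresponding fields of the new coordinates up to a rotation, under which the components
of a `(0,0,0)` mode do not change.) -/
def horizonFrame (μ a : ℝ) : TensorField := fun x =>
  !![1, 0, 0, 0, 0;
     -ingoingSlope μ a (x 1), 1, 0, 0,
       -(ingoingSlope μ a (x 1) * angularVelocity μ a (x 1));
     0, 0, 1, 0, 0;
     0, 0, 0, 1, 0;
     0, 0, 0, 0, 1]

/-- The components of `h` in the ingoing frame are functions of `r` that extend smoothly across
the horizon `r = r_+`. -/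
def ExtendsAcrossHorizon (μ a : ℝ) (h : TensorField) : Prop :=
  ∀ i j, ∃ (F : ℝ → ℝ) (ε : ℝ), 0 < ε ∧ ContDiffOn ℝ ∞ F (Ioi (rPlus μ a - ε)) ∧
    ∀ x ∈ exterior μ a,
      (horizonFrame μ a x * h x * (horizonFrame μ a x).transpose) i j = F (x 1)

/-- A stationary `(0,0,0)` perturbation is regular on the horizon if it is gauge equivalent, on the
exterior region, to a perturbation that extends smoothly across the future horizon. -/
def IsHorizonRegular (μ a : ℝ) (h : TensorField) : Prop :=
  ∃ ξ : CovectorField, IsGaugeField μ a ξ ∧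
    ExtendsAcrossHorizon μ a (h + gaugeVariation (metric μ a) ξ)

end

end MyersPerry

open MyersPerry

open Set
open scoped ContDiff

namespace MyersPerry

open scoped Matrix

noncomputable section

set_option linter.unusedSimpArgs false

/-! ## Frame derivatives and structure functions -/

/-! In the invariant frame the structure functions are constants, and a tensor of the mode is given
by seven functions of `r`. The Levi-Civita connection, the linearized Ricci tensor, gauge variations
and the symmetry operator therefore become algebraic expressions in these profiles and their
derivatives (`christoffel_eq`, `ricciOf_eq`, `gaugeVariation_eq`, `symOp_mode`). What remains is a
collection of identities, rational apart from one logarithm, together with some arguments about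
ordinary differential equations.

Gauge. The radial component of `ξ` is used to cancel `h_{+-}`, and its other two components,
obtained by integration, cancel `h_{tr}` and `h_{r3}` (`exists_gauge`). Conversely, if `δ_ξ g` is
stationary and gauge-fixed, then `ξ_r = 0` and `ξ` is affine in `t`. Its slope in `t`, with the
index raised, satisfies a trivial radial equation and hence consists of two constants, the
coefficients of `hg1` and `hg2` (`residual_gauge`).

General solution. In the gauge, the angular field equation determines `h_{rr}'`, and the `tt`, `t3`
and `33` equations then determine second derivatives: a linear first-order system for seven
functions. The `rr` component of the linearized Einstein equation contains no second derivatives and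
determines `h_{rr}` from the other six data. So a solution is fixed by six numbers at one radius
(`HasProfile.eq_zero_of_dataVec`). The six explicit tensors are solutions (`ricciMode_comb`) and
their data are independent at every exterior radius (`initialData_injective`), so they form a basis.

Symmetry operator. On the span, `symOpGauged` acts through the explicit linear map `symCoef` on
coefficients (`symMode_comb`); its eigenvectors are written down with an explicit inverse of their
matrix.

Regularity. A multiple of `h_{+-}` subtracted from `h_{33}` gives a quantity insensitive to gauge.
For a combination of the six tensors it contains `ln N` with a factor that does not vanish at `r_+`
unless the last coefficient is zero, which excludes a smooth extension. Without the last tensor,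
`hg1` and `hg2` are gauged away and a change of `h_{tr}` and `h_{r3}` removes all poles of the
remainder in the ingoing frame. Finally, `symOp` multiplies the last coefficient by 6 up to gauge
and maps the gauge part of a solution to a gauge variation, so it preserves regularity. -/

lemma isOpen_exterior (μ a : ℝ) : IsOpen (exterior μ a) := by
  have h1 : IsOpen {x : Point | rPlus μ a < x 1} := isOpen_lt continuous_const (by fun_prop)
  have h2 : IsOpen {x : Point | 0 < x 2} := isOpen_lt continuous_const (by fun_prop)
  have h3 : IsOpen {x : Point | x 2 < Real.pi} := isOpen_lt (by fun_prop) continuous_const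
  exact h1.inter (h2.inter h3)

lemma sin_pos_of_mem_exterior {μ a : ℝ} {x : Point} (hx : x ∈ exterior μ a) :
    0 < Real.sin (x 2) := Real.sin_pos_of_pos_of_lt_pi hx.2.1 hx.2.2

/-- The point of the chart with given `t` and `r` on the equator of the sphere. -/
def equator (t r : ℝ) : Point := ![t, r, Real.pi / 2, 0, 0]

lemma equator_mem {μ a t r : ℝ} (hr : rPlus μ a < r) : equator t r ∈ exterior μ a := by
  refine ⟨by simpa [equator] using hr, ?_, ?_⟩ <;> simp [equator] <;> linarith [Real.pi_pos]

/-- The structure constants `[σ̄_1, σ̄_2] = 2 σ̄_3` and cyclic. -/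
def structureConst (i : Fin 5) : Matrix (Fin 5) (Fin 5) ℝ :=
  ![0, 0,
    !![0, 0, 0, 0, 0; 0, 0, 0, 0, 0; 0, 0, 0, 0, 0; 0, 0, 0, 0, 2; 0, 0, 0, -2, 0],
    !![0, 0, 0, 0, 0; 0, 0, 0, 0, 0; 0, 0, 0, 0, -2; 0, 0, 0, 0, 0; 0, 0, 2, 0, 0],
    !![0, 0, 0, 0, 0; 0, 0, 0, 0, 0; 0, 0, 0, 2, 0; 0, 0, -2, 0, 0; 0, 0, 0, 0, 0]] i

/-- Only the values of the derivative enter the Lie brackets, so the linear map stays hidden behind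
an existential and just its formula on vectors is recorded. The Pythagorean identity turns the
derivative of the cotangent into `-1 / sin²`. -/
lemma hasFDerivAt_frame (i : Fin 5) (x : Point) (hx : Real.sin (x 2) ≠ 0) :
    ∃ L : Point →L[ℝ] Point, HasFDerivAt (frame i) L x ∧ ∀ v, L v =
      ![![0, 0, 0, 0, 0],
        ![0, 0, 0, 0, 0],
        ![0, 0, -2 * Real.cos (x 3) * v 3,
          2 * Real.cos (x 3) / Real.sin (x 2) ^ 2 * v 2
            + 2 * (Real.cos (x 2) / Real.sin (x 2)) * Real.sin (x 3) * v 3,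
          -2 * Real.sin (x 3) / Real.sin (x 2) * v 3
            - 2 * Real.cos (x 3) * Real.cos (x 2) / Real.sin (x 2) ^ 2 * v 2],
        ![0, 0, 2 * Real.sin (x 3) * v 3,
          -2 * Real.sin (x 3) / Real.sin (x 2) ^ 2 * v 2
            + 2 * (Real.cos (x 2) / Real.sin (x 2)) * Real.cos (x 3) * v 3,
          -2 * Real.cos (x 3) / Real.sin (x 2) * v 3
            + 2 * Real.sin (x 3) * Real.cos (x 2) / Real.sin (x 2) ^ 2 * v 2],
        ![0, 0, 0, 0, 0]] i := by
  have hp (j : Fin 5) : HasFDerivAt (fun y : Point => y j)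
      (ContinuousLinearMap.proj (R := ℝ) (φ := fun _ : Fin 5 => ℝ) j) x :=
    (ContinuousLinearMap.proj (R := ℝ) (φ := fun _ : Fin 5 => ℝ) j).hasFDerivAt
  have s2 := (hp 2).sin
  have c2 := (hp 2).cos
  have s3 := (hp 3).sin
  have c3 := (hp 3).cos
  have i2 := (hasDerivAt_inv hx).comp_hasFDerivAt x s2
  have hsq := Real.sin_sq_add_cos_sq (x 2)
  have hc (c : ℝ) : HasFDerivAt (fun _ : Point => c) (0 : Point →L[ℝ] ℝ) x :=
    hasFDerivAt_const c x
  fin_cases i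
  · exact ⟨0, hasFDerivAt_const (![1, 0, 0, 0, 0] : Point) x, fun v => by
        ext j; fin_cases j <;> simp⟩
  · exact ⟨0, hasFDerivAt_const (![0, 1, 0, 0, 0] : Point) x, fun v => by
        ext j; fin_cases j <;> simp⟩
  · obtain ⟨L₂, h₂, e₂⟩ : ∃ L : Point →L[ℝ] ℝ, HasFDerivAt (fun y => frame 2 y 2) L x ∧
        ∀ v, L v = -2 * Real.cos (x 3) * v 3 :=
      ⟨_, s3.const_mul (-2), fun v => by simp; ring⟩
    obtain ⟨L₃, h₃, e₃⟩ : ∃ L : Point →L[ℝ] ℝ, HasFDerivAt (fun y => frame 2 y 3) L x ∧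
        ∀ v, L v = 2 * Real.cos (x 3) / Real.sin (x 2) ^ 2 * v 2
            + 2 * (Real.cos (x 2) / Real.sin (x 2)) * Real.sin (x 3) * v 3 := by
      refine ⟨_, ((c2.mul i2).const_mul (-2)).mul c3, fun v => ?_⟩
      simp
      field_simp
      linear_combination (Real.cos (x 3) * v 2) * hsq
    obtain ⟨L₄, h₄, e₄⟩ : ∃ L : Point →L[ℝ] ℝ, HasFDerivAt (fun y => frame 2 y 4) L x ∧
        ∀ v, L v = -2 * Real.sin (x 3) / Real.sin (x 2) * v 3
            - 2 * Real.cos (x 3) * Real.cos (x 2) / Real.sin (x 2) ^ 2 * v 2 := by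
      refine ⟨_, (c3.const_mul 2).mul i2, fun v => ?_⟩
      simp
      field_simp
      ring
    refine ⟨ContinuousLinearMap.pi (φ := fun _ : Fin 5 => ℝ) ![0, 0, L₂, L₃, L₄],
      hasFDerivAt_pi.2 fun j => ?_, fun v => ?_⟩
    · fin_cases j
      exacts [hc 0, hc 0, h₂, h₃, h₄]
    · ext j
      fin_cases j <;> simp [e₂, e₃, e₄]
  · obtain ⟨L₂, h₂, e₂⟩ : ∃ L : Point →L[ℝ] ℝ, HasFDerivAt (fun y => frame 3 y 2) L x ∧
        ∀ v, L v = 2 * Real.sin (x 3) * v 3 :=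
      ⟨_, c3.const_mul (-2), fun v => by simp; ring⟩
    obtain ⟨L₃, h₃, e₃⟩ : ∃ L : Point →L[ℝ] ℝ, HasFDerivAt (fun y => frame 3 y 3) L x ∧
        ∀ v, L v = -2 * Real.sin (x 3) / Real.sin (x 2) ^ 2 * v 2
            + 2 * (Real.cos (x 2) / Real.sin (x 2)) * Real.cos (x 3) * v 3 := by
      refine ⟨_, ((c2.mul i2).const_mul 2).mul s3, fun v => ?_⟩
      simp
      field_simp
      linear_combination (-Real.sin (x 3) * v 2) * hsq
    obtain ⟨L₄, h₄, e₄⟩ : ∃ L : Point →L[ℝ] ℝ, HasFDerivAt (fun y => frame 3 y 4) L x ∧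
        ∀ v, L v = -2 * Real.cos (x 3) / Real.sin (x 2) * v 3
            + 2 * Real.sin (x 3) * Real.cos (x 2) / Real.sin (x 2) ^ 2 * v 2 := by
      refine ⟨_, (s3.const_mul (-2)).mul i2, fun v => ?_⟩
      simp
      field_simp
      ring
    refine ⟨ContinuousLinearMap.pi (φ := fun _ : Fin 5 => ℝ) ![0, 0, L₂, L₃, L₄],
      hasFDerivAt_pi.2 fun j => ?_, fun v => ?_⟩
    · fin_cases j
      exacts [hc 0, hc 0, h₂, h₃, h₄]
    · ext j
      fin_cases j <;> simp [e₂, e₃, e₄]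
  · exact ⟨0, hasFDerivAt_const (![0, 0, 0, 2, 0] : Point) x, fun v => by
        ext j; fin_cases j <;> simp⟩

set_option maxHeartbeats 4000000 in
-- The constancy of these functions is what removes the Euler angles from all later computations.
lemma structureFn_eq {μ a : ℝ} {x : Point} (hx : x ∈ exterior μ a) (i j k : Fin 5) :
    structureFn i j k x = structureConst i j k := by
  have hs := (sin_pos_of_mem_exterior hx).ne'
  have h2 := Real.sin_sq_add_cos_sq (x 2)
  have h3 := Real.sin_sq_add_cos_sq (x 3)
  obtain ⟨Li, hLi, ei⟩ := hasFDerivAt_frame i x hs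
  obtain ⟨Lj, hLj, ej⟩ := hasFDerivAt_frame j x hs
  rw [structureFn, VectorField.lieBracket, hLi.fderiv, hLj.fderiv, ei, ej]
  clear hLi hLj ei ej Li Lj
  fin_cases i <;> fin_cases j <;> fin_cases k <;>
    simp [frame, coframe, structureConst]
  all_goals
    generalize Real.sin (x 2) = s at *
    generalize Real.cos (x 2) = c at *
    generalize Real.sin (x 3) = s' at *
    generalize Real.cos (x 3) = c' at *
    field_simp
    grind

/-! ## The exterior region -/

section Exterior

variable {μ a r : ℝ}

lemma D_sq (hμ : 0 < μ) (ha : 4 * a ^ 2 < μ) : D μ a ^ 2 = μ * (μ - 4 * a ^ 2) / 4 := by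
  have : 0 ≤ μ * (μ - 4 * a ^ 2) := by nlinarith
  rw [D, mul_pow, Real.sq_sqrt this]
  ring

lemma D_pos (hμ : 0 < μ) (ha : 4 * a ^ 2 < μ) : 0 < D μ a := by
  have : 0 < μ * (μ - 4 * a ^ 2) := mul_pos hμ (by linarith)
  have := Real.sqrt_pos.2 this
  rw [D]
  linarith

lemma rPlus_sq (hμ : 0 < μ) (ha : 4 * a ^ 2 < μ) : rPlus μ a ^ 2 = μ / 2 + D μ a := by
  rw [rPlus, Real.sq_sqrt]
  linarith [D_pos hμ ha]

lemma rPlus_pos (hμ : 0 < μ) (ha : 4 * a ^ 2 < μ) : 0 < rPlus μ a := by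
  rw [rPlus]
  exact Real.sqrt_pos.2 (by linarith [D_pos hμ ha])

lemma rad_pos (hμ : 0 < μ) (ha : 4 * a ^ 2 < μ) (hr : rPlus μ a < r) : 0 < r :=
  (rPlus_pos hμ ha).trans hr

lemma sq_gt (hμ : 0 < μ) (ha : 4 * a ^ 2 < μ) (hr : rPlus μ a < r) :
    μ / 2 + D μ a < r ^ 2 := by
  rw [← rPlus_sq hμ ha]
  exact pow_lt_pow_left₀ hr (rPlus_pos hμ ha).le two_ne_zero

/-- The horizon polynomial `Δ = r⁴ G`. -/
def Del (μ a r : ℝ) : ℝ := r ^ 4 - μ * r ^ 2 + μ * a ^ 2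

lemma Del_pos (hμ : 0 < μ) (ha : 4 * a ^ 2 < μ) (hr : rPlus μ a < r) : 0 < Del μ a r := by
  have h1 := sq_gt hμ ha hr
  have h2 := D_sq hμ ha
  have h3 := D_pos hμ ha
  have : Del μ a r = (r ^ 2 - μ / 2 - D μ a) * (r ^ 2 - μ / 2 + D μ a) := by
    rw [Del]
    linear_combination h2
  rw [this]
  apply mul_pos <;> linarith

lemma G_eq (hr : 0 < r) : G μ a r = Del μ a r / r ^ 4 := by
  rw [G, Del]
  field_simp

lemma G_pos (hμ : 0 < μ) (ha : 4 * a ^ 2 < μ) (hr : rPlus μ a < r) : 0 < G μ a r := by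
  have := rad_pos hμ ha hr
  rw [G_eq this]
  have := Del_pos hμ ha hr
  positivity

lemma hasDerivAt_inv_pow (n : ℕ) (hr : r ≠ 0) :
    HasDerivAt (fun s : ℝ => 1 / s ^ n) (-(n / r ^ (n + 1))) r := by
  have := (hasDerivAt_pow n r).inv (pow_ne_zero n hr)
  simp only [one_div]
  convert! this using 1
  rcases n with _ | n
  · simp
  · simp only [Nat.add_sub_cancel]
    field_simp
    ring

lemma hasDerivAt_const_div_pow (c : ℝ) (n : ℕ) (hr : r ≠ 0) :
    HasDerivAt (fun s : ℝ => c / s ^ n) (-(n * c / r ^ (n + 1))) r := by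
  have := (hasDerivAt_inv_pow n hr).const_mul c
  simp only [mul_one_div] at this
  convert! this using 1
  ring

lemma hasDerivAt_G (hr : r ≠ 0) :
    HasDerivAt (G μ a) (2 * μ / r ^ 3 - 4 * μ * a ^ 2 / r ^ 5) r := by
  have := ((hasDerivAt_const_div_pow μ 2 hr).const_sub 1).add
    (hasDerivAt_const_div_pow (μ * a ^ 2) 4 hr)
  convert! this using 1
  push_cast
  ring

end Exterior

/-! ## Radial functions and tensors -/

/-- The exterior is open, so derivatives there ignore the values of a field elsewhere. This permits
all hypotheses on tensor fields to be stated as equalities on the exterior only. -/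
lemma frameDeriv_of_eqOn {μ a : ℝ} {x : Point} (hx : x ∈ exterior μ a) {f g : Point → ℝ}
    (h : EqOn f g (exterior μ a)) (i : Fin 5) : frameDeriv i f x = frameDeriv i g x := by
  rw [frameDeriv, frameDeriv,
    (h.eventuallyEq_of_mem ((isOpen_exterior μ a).mem_nhds hx)).fderiv_eq]

lemma frameDeriv_radial {μ a : ℝ} {x : Point} (hx : x ∈ exterior μ a) {f : Point → ℝ}
    {φ : ℝ → ℝ} {φ' : ℝ} (hf : EqOn f (fun y => φ (y 1)) (exterior μ a))
    (hφ : HasDerivAt φ φ' (x 1)) (i : Fin 5) :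
    frameDeriv i f x = if i = 1 then φ' else 0 := by
  have hp : HasFDerivAt (fun y : Point => y 1)
      (ContinuousLinearMap.proj (R := ℝ) (φ := fun _ : Fin 5 => ℝ) 1) x :=
    (ContinuousLinearMap.proj (R := ℝ) (φ := fun _ : Fin 5 => ℝ) 1).hasFDerivAt
  have h : HasFDerivAt (fun y : Point => φ (y 1)) _ x := hφ.comp_hasFDerivAt x hp
  rw [frameDeriv_of_eqOn hx hf, frameDeriv, h.fderiv]
  fin_cases i <;> simp [frame]

/-! ### The background: metric, inverse and connection -/

/-- The metric as a function of the radius. -/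
def radialMetric (μ a r : ℝ) : Matrix (Fin 5) (Fin 5) ℝ :=
  modeMatrix (-1 + μ / r ^ 2) 0 (-(μ * a / r ^ 2)) (1 / G μ a r) 0
    (r ^ 2 + μ * a ^ 2 / r ^ 2) (r ^ 2)

/-- The radial derivative of the metric. -/
def radialMetricDeriv (μ a r : ℝ) : Matrix (Fin 5) (Fin 5) ℝ :=
  modeMatrix (-(2 * μ / r ^ 3)) 0 (2 * μ * a / r ^ 3)
    (-((2 * μ / r ^ 3 - 4 * μ * a ^ 2 / r ^ 5) / G μ a r ^ 2)) 0
    (2 * r - 2 * μ * a ^ 2 / r ^ 3) (2 * r)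

/-- The inverse metric as a function of the radius. -/
def radialMetricInv (μ a r : ℝ) : Matrix (Fin 5) (Fin 5) ℝ :=
  modeMatrix (-((r ^ 4 + μ * a ^ 2) / Del μ a r)) 0 (-(μ * a / Del μ a r)) (G μ a r) 0
    ((r ^ 2 - μ) / Del μ a r) (1 / r ^ 2)

/-- The matrix with `(m i j)` the given value on the components mixing `{t, r, 3}` and
`{1, 2}`. -/
def crossMatrix (x y z u v w : ℝ) : Matrix (Fin 5) (Fin 5) ℝ :=
  !![0, 0, x, u, 0;
     0, 0, y, v, 0;
     x, y, 0, 0, z;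
     u, v, 0, 0, w;
     0, 0, z, w, 0]

lemma modeMatrix_apply (a b c d e f g : ℝ) :
    modeMatrix a b c d e f g 0 0 = a ∧ modeMatrix a b c d e f g 0 1 = b ∧
    modeMatrix a b c d e f g 0 2 = 0 ∧ modeMatrix a b c d e f g 0 3 = 0 ∧
    modeMatrix a b c d e f g 0 4 = c ∧ modeMatrix a b c d e f g 1 0 = b ∧
    modeMatrix a b c d e f g 1 1 = d ∧ modeMatrix a b c d e f g 1 2 = 0 ∧
    modeMatrix a b c d e f g 1 3 = 0 ∧ modeMatrix a b c d e f g 1 4 = e ∧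
    modeMatrix a b c d e f g 2 0 = 0 ∧ modeMatrix a b c d e f g 2 1 = 0 ∧
    modeMatrix a b c d e f g 2 2 = g ∧ modeMatrix a b c d e f g 2 3 = 0 ∧
    modeMatrix a b c d e f g 2 4 = 0 ∧ modeMatrix a b c d e f g 3 0 = 0 ∧
    modeMatrix a b c d e f g 3 1 = 0 ∧ modeMatrix a b c d e f g 3 2 = 0 ∧
    modeMatrix a b c d e f g 3 3 = g ∧ modeMatrix a b c d e f g 3 4 = 0 ∧
    modeMatrix a b c d e f g 4 0 = c ∧ modeMatrix a b c d e f g 4 1 = e ∧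
    modeMatrix a b c d e f g 4 2 = 0 ∧ modeMatrix a b c d e f g 4 3 = 0 ∧
    modeMatrix a b c d e f g 4 4 = f := by
  and_intros <;> rfl

lemma crossMatrix_apply (a b c d e f : ℝ) :
    crossMatrix a b c d e f 0 0 = 0 ∧ crossMatrix a b c d e f 0 1 = 0 ∧
    crossMatrix a b c d e f 0 2 = a ∧ crossMatrix a b c d e f 0 3 = d ∧
    crossMatrix a b c d e f 0 4 = 0 ∧ crossMatrix a b c d e f 1 0 = 0 ∧
    crossMatrix a b c d e f 1 1 = 0 ∧ crossMatrix a b c d e f 1 2 = b ∧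
    crossMatrix a b c d e f 1 3 = e ∧ crossMatrix a b c d e f 1 4 = 0 ∧
    crossMatrix a b c d e f 2 0 = a ∧ crossMatrix a b c d e f 2 1 = b ∧
    crossMatrix a b c d e f 2 2 = 0 ∧ crossMatrix a b c d e f 2 3 = 0 ∧
    crossMatrix a b c d e f 2 4 = c ∧ crossMatrix a b c d e f 3 0 = d ∧
    crossMatrix a b c d e f 3 1 = e ∧ crossMatrix a b c d e f 3 2 = 0 ∧
    crossMatrix a b c d e f 3 3 = 0 ∧ crossMatrix a b c d e f 3 4 = f ∧
    crossMatrix a b c d e f 4 0 = 0 ∧ crossMatrix a b c d e f 4 1 = 0 ∧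
    crossMatrix a b c d e f 4 2 = c ∧ crossMatrix a b c d e f 4 3 = f ∧
    crossMatrix a b c d e f 4 4 = 0 := by
  and_intros <;> rfl

lemma modeMatrix_add (a b c d e f g a' b' c' d' e' f' g' : ℝ) :
    modeMatrix a b c d e f g + modeMatrix a' b' c' d' e' f' g' =
      modeMatrix (a + a') (b + b') (c + c') (d + d') (e + e') (f + f') (g + g') := by
  ext i j
  fin_cases i <;> fin_cases j <;> simp [modeMatrix]

lemma modeMatrix_sub (a b c d e f g a' b' c' d' e' f' g' : ℝ) :
    modeMatrix a b c d e f g - modeMatrix a' b' c' d' e' f' g' =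
      modeMatrix (a - a') (b - b') (c - c') (d - d') (e - e') (f - f') (g - g') := by
  ext i j
  fin_cases i <;> fin_cases j <;> simp [modeMatrix]

lemma smul_modeMatrix (t a b c d e f g : ℝ) :
    t • modeMatrix a b c d e f g =
      modeMatrix (t * a) (t * b) (t * c) (t * d) (t * e) (t * f) (t * g) := by
  ext i j
  fin_cases i <;> fin_cases j <;> simp [modeMatrix]

lemma crossMatrix_add (a b c d e f a' b' c' d' e' f' : ℝ) :
    crossMatrix a b c d e f + crossMatrix a' b' c' d' e' f' =
      crossMatrix (a + a') (b + b') (c + c') (d + d') (e + e') (f + f') := by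
  ext i j
  fin_cases i <;> fin_cases j <;> simp [crossMatrix]

lemma crossMatrix_sub (a b c d e f a' b' c' d' e' f' : ℝ) :
    crossMatrix a b c d e f - crossMatrix a' b' c' d' e' f' =
      crossMatrix (a - a') (b - b') (c - c') (d - d') (e - e') (f - f') := by
  ext i j
  fin_cases i <;> fin_cases j <;> simp [crossMatrix]

lemma hasDerivAt_modeMatrix {tt tr t3 rr r3 s pm : ℝ → ℝ} {tt' tr' t3' rr' r3' s' pm' r : ℝ}
    (h0 : HasDerivAt tt tt' r) (h1 : HasDerivAt tr tr' r) (h2 : HasDerivAt t3 t3' r)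
    (h3 : HasDerivAt rr rr' r) (h4 : HasDerivAt r3 r3' r) (h5 : HasDerivAt s s' r)
    (h6 : HasDerivAt pm pm' r) (i j : Fin 5) :
    HasDerivAt (fun r => modeMatrix (tt r) (tr r) (t3 r) (rr r) (r3 r) (s r) (pm r) i j)
      (modeMatrix tt' tr' t3' rr' r3' s' pm' i j) r := by
  have h0' := hasDerivAt_const r (0 : ℝ)
  fin_cases i <;> fin_cases j <;> assumption

lemma hasDerivAt_crossMatrix {x y z u v w : ℝ → ℝ} {x' y' z' u' v' w' r : ℝ}
    (h0 : HasDerivAt x x' r) (h1 : HasDerivAt y y' r) (h2 : HasDerivAt z z' r)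
    (h3 : HasDerivAt u u' r) (h4 : HasDerivAt v v' r) (h5 : HasDerivAt w w' r)
    (i j : Fin 5) :
    HasDerivAt (fun r => crossMatrix (x r) (y r) (z r) (u r) (v r) (w r) i j)
      (crossMatrix x' y' z' u' v' w' i j) r := by
  have h0' := hasDerivAt_const r (0 : ℝ)
  fin_cases i <;> fin_cases j <;> assumption

lemma hasDerivAt_radialMetric {μ a r : ℝ} (hr : 0 < r) (hG : 0 < G μ a r) (i j : Fin 5) :
    HasDerivAt (fun r => radialMetric μ a r i j) (radialMetricDeriv μ a r i j) r := by
  have hr' := hr.ne'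
  apply hasDerivAt_modeMatrix
  · convert! (hasDerivAt_const_div_pow μ 2 hr').const_add (-1) using 1
  · exact hasDerivAt_const _ _
  · convert! (hasDerivAt_const_div_pow (μ * a) 2 hr').neg using 1
    push_cast; ring
  · simp only [one_div]
    convert! (hasDerivAt_G hr').inv hG.ne' using 1
    ring
  · exact hasDerivAt_const _ _
  · convert! (hasDerivAt_pow 2 r).add (hasDerivAt_const_div_pow (μ * a ^ 2) 2 hr') using 1
    push_cast; ring
  · simpa using hasDerivAt_pow 2 r

set_option maxHeartbeats 1000000 in
lemma metric_inv {μ a : ℝ} (hμ : 0 < μ) (ha : 4 * a ^ 2 < μ) {x : Point}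
    (hx : x ∈ exterior μ a) : (metric μ a x)⁻¹ = radialMetricInv μ a (x 1) := by
  have hr := rad_pos hμ ha hx.1
  have hG := G_pos hμ ha hx.1
  have hD := Del_pos hμ ha hx.1
  apply Matrix.inv_eq_right_inv
  change radialMetric μ a (x 1) * _ = _
  generalize x 1 = r at *
  ext i j
  rw [Matrix.mul_apply, Fin.sum_univ_five]
  fin_cases i <;> fin_cases j <;> simp [radialMetric, radialMetricInv, modeMatrix, hG.ne', hr.ne']
  all_goals field_simp
  all_goals simp only [Del]
  all_goals ring

/-- The connection matrices `Γ^l_{ij}` (first index `i`, row `l`, column `j`) assembled from the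
twelve functions `Γ^r_{tt}, Γ^r_{t3}, Γ^r_{33}, Γ^t_{rt}, Γ^t_{r3}, Γ^3_{rt}, Γ^3_{r3}, Γ^r_{rr},
-Γ^r_{11}, Γ^1_{r1}, Γ^1_{2t}, Γ^1_{23}`. -/
def connectionOf (c : Fin 12 → ℝ) : Fin 5 → Matrix (Fin 5) (Fin 5) ℝ :=
  ![!![0, c 3, 0, 0, 0;
       c 0, 0, 0, 0, c 1;
       0, 0, 0, c 10, 0;
       0, 0, -c 10, 0, 0;
       0, c 5, 0, 0, 0],
    !![c 3, 0, 0, 0, c 4;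
       0, c 7, 0, 0, 0;
       0, 0, c 9, 0, 0;
       0, 0, 0, c 9, 0;
       c 5, 0, 0, 0, c 6],
    !![0, 0, 0, 0, 0;
       0, 0, -c 8, 0, 0;
       0, c 9, 0, 0, 0;
       -c 10, 0, 0, 0, -c 11;
       0, 0, 0, 1, 0],
    !![0, 0, 0, 0, 0;
       0, 0, 0, -c 8, 0;
       c 10, 0, 0, 0, c 11;
       0, c 9, 0, 0, 0;
       0, 0, -1, 0, 0],
    !![0, c 4, 0, 0, 0;
       c 1, 0, 0, 0, c 2;
       0, 0, 0, c 11 - 2, 0;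
       0, 0, 2 - c 11, 0, 0;
       0, c 6, 0, 0, 0]]

/-- The twelve functions that determine the connection. -/
def coef (μ a r : ℝ) : Fin 12 → ℝ :=
  ![μ * Del μ a r / r ^ 7, -(μ * a * Del μ a r / r ^ 7),
    -(Del μ a r * (r ^ 4 - μ * a ^ 2) / r ^ 7),
    μ * r / Del μ a r, -(2 * μ * a * r / Del μ a r), μ * a / (r * Del μ a r),
    (r ^ 4 - μ * r ^ 2 - μ * a ^ 2) / (r * Del μ a r),
    -((μ * r ^ 2 - 2 * μ * a ^ 2) / (r * Del μ a r)),
    Del μ a r / r ^ 3, 1 / r, -(μ * a / r ^ 4), 1 + μ * a ^ 2 / r ^ 4]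

/-- The connection coefficients: `connection μ a r i l j = Γ^l_{ij}`. -/
def connection (μ a r : ℝ) : Fin 5 → Matrix (Fin 5) (Fin 5) ℝ := connectionOf (coef μ a r)

/-- The connection coefficients with the last index lowered. -/
def connectionLow (μ a r : ℝ) (i j k : Fin 5) : ℝ :=
  1 / 2 * ((if i = 1 then radialMetricDeriv μ a r j k else 0)
    + (if j = 1 then radialMetricDeriv μ a r i k else 0)
    - (if k = 1 then radialMetricDeriv μ a r i j else 0)
    + ∑ l, (structureConst i j l * radialMetric μ a r l k
        - structureConst i k l * radialMetric μ a r l j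
        - structureConst j k l * radialMetric μ a r l i))

lemma christoffelLow_eq {μ a : ℝ} (hμ : 0 < μ) (ha : 4 * a ^ 2 < μ) {x : Point}
    (hx : x ∈ exterior μ a) (i j k : Fin 5) :
    christoffelLow (metric μ a) i j k x = connectionLow μ a (x 1) i j k := by
  have h (i j k : Fin 5) : frameDeriv i (fun y => metric μ a y j k) x
      = if i = 1 then radialMetricDeriv μ a (x 1) j k else 0 :=
    frameDeriv_radial hx (fun y _ => rfl)
      (hasDerivAt_radialMetric (rad_pos hμ ha hx.1) (G_pos hμ ha hx.1) j k) i
  simp only [christoffelLow, connectionLow, h, structureFn_eq hx]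
  rfl

set_option maxHeartbeats 4000000 in
-- The claimed connection is checked with its index lowered: comparing with the Koszul formula in
-- this form avoids multiplying by the inverse metric.
lemma radialMetric_mul_connection {μ a r : ℝ} (hr : 0 < r) (hD : 0 < Del μ a r)
    (i j k : Fin 5) :
    ∑ l, radialMetric μ a r k l * connection μ a r i l j = connectionLow μ a r i j k := by
  have hG := G_eq (μ := μ) (a := a) hr
  rw [connectionLow, Fin.sum_univ_five, Fin.sum_univ_five]
  fin_cases i <;> fin_cases j <;> fin_cases k <;>
    simp only [hG, connection, connectionOf, coef, radialMetric,
      radialMetricDeriv, ↓modeMatrix_apply, structureConst, Fin.mk_zero, Fin.mk_one,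
      Fin.reduceFinMk, Fin.isValue, Matrix.of_apply, Matrix.cons_val,
      Matrix.cons_val', Matrix.cons_val_fin_one, Matrix.zero_apply,
      Fin.reduceEq, if_true, if_false, zero_ne_one,
      mul_zero, zero_mul, add_zero, zero_add, sub_zero, zero_sub, sub_self]
  all_goals first
    | (field_simp; done)
    | (field_simp; ring1)
    | (field_simp; simp only [Del]; ring1)

lemma christoffel_eq {μ a : ℝ} (hμ : 0 < μ) (ha : 4 * a ^ 2 < μ) {x : Point}
    (hx : x ∈ exterior μ a) (l i j : Fin 5) :
    christoffel (metric μ a) l i j x = connection μ a (x 1) i l j := by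
  have hr := rad_pos hμ ha hx.1
  have hG := G_pos hμ ha hx.1
  have hD := Del_pos hμ ha hx.1
  have hdet : IsUnit (metric μ a x).det := by
    by_contra h
    -- The matrix inverse of a singular matrix is zero by convention, whereas the `rr` entry of the
    -- known inverse is `G > 0`.
    have h0 := congrFun (congrFun (metric_inv hμ ha hx) 1) 1
    rw [Matrix.nonsing_inv_apply_not_isUnit _ h] at h0
    exact hG.ne h0
  have h1 := Matrix.nonsing_inv_mul _ hdet
  simp only [christoffel, christoffelLow_eq hμ ha hx, ← radialMetric_mul_connection hr hD]
  change ((metric μ a x)⁻¹ *ᵥ ((metric μ a x) *ᵥ fun l => connection μ a (x 1) i l j)) l = _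
  rw [Matrix.mulVec_mulVec, h1, Matrix.one_mulVec]

/-! ## Covariant derivatives of radial tensors -/

/-- The radial tensor with the given seven components. -/
def radialMode (p : Fin 7 → ℝ) : Matrix (Fin 5) (Fin 5) ℝ :=
  modeMatrix (p 0) (p 1) (p 2) (p 3) (p 4) (p 5) (p 6)

/-- The covariant derivative of a radial tensor with components `H` and radial derivative `H'`. -/
def radialNabla (μ a r : ℝ) (H H' : Matrix (Fin 5) (Fin 5) ℝ) (i : Fin 5) :
    Matrix (Fin 5) (Fin 5) ℝ :=
  (if i = 1 then H' else 0) - ((connection μ a r i)ᵀ * H + H * connection μ a r i)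

lemma nabla2_eq {μ a : ℝ} (hμ : 0 < μ) (ha : 4 * a ^ 2 < μ) {x : Point}
    (hx : x ∈ exterior μ a) {h : TensorField} {H : ℝ → Matrix (Fin 5) (Fin 5) ℝ}
    {H' : Matrix (Fin 5) (Fin 5) ℝ} (hh : EqOn h (fun y => H (y 1)) (exterior μ a))
    (hH : ∀ i j, HasDerivAt (fun r => H r i j) (H' i j) (x 1)) (i j k : Fin 5) :
    nabla2 (metric μ a) h i j k x = radialNabla μ a (x 1) (H (x 1)) H' i j k := by
  have h1 : frameDeriv i (fun y => h y j k) x = if i = 1 then H' j k else 0 :=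
    frameDeriv_radial hx (fun y hy => by simp only [hh hy]) (hH j k) i
  simp only [nabla2, h1, christoffel_eq hμ ha hx, hh hx, radialNabla, Matrix.sub_apply,
    Matrix.add_apply, Matrix.mul_apply, Matrix.transpose_apply, ← Finset.sum_add_distrib]
  congr 1
  · split_ifs <;> rfl
  · exact Finset.sum_congr rfl fun l _ => by ring

/-- The covariant derivatives along the frame fields of a mode tensor with components `p` and
radial derivatives `p'`, for the connection assembled from `c`. -/
def modeNabla (c : Fin 12 → ℝ) (p p' : Fin 7 → ℝ) : Fin 5 → Matrix (Fin 5) (Fin 5) ℝ :=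
  ![modeMatrix (-2 * c 0 * p 1) (-(c 0 * p 3 + c 3 * p 0 + c 5 * p 2))
      (-(c 0 * p 4 + c 1 * p 1)) (-2 * (c 3 * p 1 + c 5 * p 4))
      (-(c 3 * p 2 + c 5 * p 5 + c 1 * p 3)) (-2 * c 1 * p 4) 0,
    modeMatrix (p' 0 - 2 * (c 3 * p 0 + c 5 * p 2))
      (p' 1 - c 7 * p 1 - (c 3 * p 1 + c 5 * p 4))
      (p' 2 - c 4 * p 0 - c 6 * p 2 - c 3 * p 2 - c 5 * p 5)
      (p' 3 - 2 * c 7 * p 3) (p' 4 - c 7 * p 4 - c 4 * p 1 - c 6 * p 4)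
      (p' 5 - 2 * (c 4 * p 2 + c 6 * p 5)) (p' 6 - 2 * c 9 * p 6),
    crossMatrix (c 8 * p 1) (c 8 * p 3 - c 9 * p 6) (c 8 * p 4)
      (-p 2 + c 10 * p 6) (-p 4) (-p 5 + c 11 * p 6),
    crossMatrix (p 2 - c 10 * p 6) (p 4) (p 5 - c 11 * p 6)
      (c 8 * p 1) (c 8 * p 3 - c 9 * p 6) (c 8 * p 4),
    modeMatrix (-2 * c 1 * p 1) (-(c 1 * p 3 + c 4 * p 0 + c 6 * p 2))
      (-(c 1 * p 4 + c 2 * p 1)) (-2 * (c 4 * p 1 + c 6 * p 4))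
      (-(c 4 * p 2 + c 6 * p 5 + c 2 * p 3)) (-2 * c 2 * p 4) 0]

lemma modeNabla_apply (c : Fin 12 → ℝ) (p p' : Fin 7 → ℝ) :
    modeNabla c p p' 0 =
      modeMatrix (-2 * c 0 * p 1) (-(c 0 * p 3 + c 3 * p 0 + c 5 * p 2))
      (-(c 0 * p 4 + c 1 * p 1)) (-2 * (c 3 * p 1 + c 5 * p 4))
      (-(c 3 * p 2 + c 5 * p 5 + c 1 * p 3)) (-2 * c 1 * p 4) 0 ∧
    modeNabla c p p' 1 =
      modeMatrix (p' 0 - 2 * (c 3 * p 0 + c 5 * p 2))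
      (p' 1 - c 7 * p 1 - (c 3 * p 1 + c 5 * p 4))
      (p' 2 - c 4 * p 0 - c 6 * p 2 - c 3 * p 2 - c 5 * p 5)
      (p' 3 - 2 * c 7 * p 3) (p' 4 - c 7 * p 4 - c 4 * p 1 - c 6 * p 4)
      (p' 5 - 2 * (c 4 * p 2 + c 6 * p 5)) (p' 6 - 2 * c 9 * p 6) ∧
    modeNabla c p p' 2 =
      crossMatrix (c 8 * p 1) (c 8 * p 3 - c 9 * p 6) (c 8 * p 4)
      (-p 2 + c 10 * p 6) (-p 4) (-p 5 + c 11 * p 6) ∧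
    modeNabla c p p' 3 =
      crossMatrix (p 2 - c 10 * p 6) (p 4) (p 5 - c 11 * p 6)
      (c 8 * p 1) (c 8 * p 3 - c 9 * p 6) (c 8 * p 4) ∧
    modeNabla c p p' 4 =
      modeMatrix (-2 * c 1 * p 1) (-(c 1 * p 3 + c 4 * p 0 + c 6 * p 2))
      (-(c 1 * p 4 + c 2 * p 1)) (-2 * (c 4 * p 1 + c 6 * p 4))
      (-(c 4 * p 2 + c 6 * p 5 + c 2 * p 3)) (-2 * c 2 * p 4) 0 := by
  and_intros <;> rfl

/-- The radial derivative of `modeNabla`. -/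
def modeNablaDeriv (c c' : Fin 12 → ℝ) (p p' p'' : Fin 7 → ℝ) (i : Fin 5) :
    Matrix (Fin 5) (Fin 5) ℝ :=
  modeNabla c p' p'' i + (modeNabla c' p 0 i - modeNabla 0 p 0 i)

set_option maxHeartbeats 4000000 in
lemma radialNabla_mode (μ a r : ℝ) (p p' : Fin 7 → ℝ) (i : Fin 5) :
    radialNabla μ a r (radialMode p) (radialMode p') i = modeNabla (coef μ a r) p p' i := by
  rw [radialNabla, connection]
  generalize coef μ a r = c
  ext j k
  rw [Matrix.sub_apply, Matrix.add_apply, Matrix.mul_apply, Matrix.mul_apply,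
    Fin.sum_univ_five, Fin.sum_univ_five]
  fin_cases i <;> fin_cases j <;> fin_cases k <;>
    simp only [connectionOf, radialMode, modeNabla_apply, ↓modeMatrix_apply, ↓crossMatrix_apply,
      Fin.mk_zero, Fin.mk_one, Fin.reduceFinMk, Fin.isValue, Matrix.of_apply, Matrix.cons_val,
      Matrix.cons_val', Matrix.cons_val_fin_one, Matrix.zero_apply, Matrix.transpose_apply,
      Fin.reduceEq, if_true, if_false, zero_ne_one,
      mul_zero, zero_mul, add_zero, zero_add, sub_zero, zero_sub, sub_self, neg_zero]
  all_goals ring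

/-- Product rule: `modeNabla` is linear in `(p, p')` and affine in the connection `c`. Subtracting
its value at `c = 0` isolates the part bilinear in `c` and `p`, which is the only part that feels
the derivative of `c`. -/
lemma hasDerivAt_modeNabla {c : ℝ → Fin 12 → ℝ} {c' : Fin 12 → ℝ} {p p' : ℝ → Fin 7 → ℝ}
    {q q' : Fin 7 → ℝ} {r : ℝ} (hc : ∀ i, HasDerivAt (fun s => c s i) (c' i) r)
    (hp : ∀ i, HasDerivAt (fun s => p s i) (q i) r)
    (hp' : ∀ i, HasDerivAt (fun s => p' s i) (q' i) r) (hq : p' r = q) (i j k : Fin 5) :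
    HasDerivAt (fun s => modeNabla (c s) (p s) (p' s) i j k)
      (modeNablaDeriv (c r) c' (p r) q q' i j k) r := by
  subst hq
  have h0 := hasDerivAt_const r (0 : ℝ)
  have m (i : Fin 12) (j : Fin 7) := (hc i).fun_mul (hp j)
  fin_cases i
  all_goals
    simp only [modeNablaDeriv, modeNabla, Fin.mk_zero, Fin.mk_one, Fin.reduceFinMk, Fin.isValue,
      Matrix.cons_val]
    apply HasDerivAt.congr_deriv
    · first | apply hasDerivAt_modeMatrix | apply hasDerivAt_crossMatrix
      all_goals
        repeat' first
          | exact h0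
          | exact hc _
          | exact hp _
          | exact hp' _
          | apply HasDerivAt.fun_sub
          | apply HasDerivAt.fun_add
          | apply HasDerivAt.fun_neg
          | apply HasDerivAt.fun_mul
          | exact hasDerivAt_const _ _
    · simp only [modeMatrix_add, modeMatrix_sub, crossMatrix_add, crossMatrix_sub, Pi.zero_apply]
      ring_nf

/-! ### Second covariant derivatives and the linearized Ricci tensor -/

/-- The second covariant derivative from the connection `Γ`, the first covariant derivative `N` and
its radial derivative `N'`. -/
def secondNabla (Γ N N' : Fin 5 → Matrix (Fin 5) (Fin 5) ℝ) (i j k l : Fin 5) : ℝ :=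
  (if i = 1 then N' j k l else 0)
    - ∑ p, (Γ i p j * N p k l + Γ i p k * N j p l + Γ i p l * N j k p)

def coefDeriv (μ a r : ℝ) : Fin 12 → ℝ :=
  ![μ * (4 * r ^ 3 - 2 * μ * r) / r ^ 7 - 7 * μ * Del μ a r / r ^ 8,
    -(μ * a * (4 * r ^ 3 - 2 * μ * r) / r ^ 7 - 7 * μ * a * Del μ a r / r ^ 8),
    -((4 * r ^ 3 - 2 * μ * r) * (r ^ 4 - μ * a ^ 2) / r ^ 7 + 4 * Del μ a r / r ^ 4
      - 7 * Del μ a r * (r ^ 4 - μ * a ^ 2) / r ^ 8),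
    μ / Del μ a r - μ * r * (4 * r ^ 3 - 2 * μ * r) / Del μ a r ^ 2,
    -(2 * μ * a / Del μ a r - 2 * μ * a * r * (4 * r ^ 3 - 2 * μ * r) / Del μ a r ^ 2),
    -(μ * a / (r ^ 2 * Del μ a r)) - μ * a * (4 * r ^ 3 - 2 * μ * r) / (r * Del μ a r ^ 2),
    (4 * r ^ 3 - 2 * μ * r) / (r * Del μ a r)
      - (r ^ 4 - μ * r ^ 2 - μ * a ^ 2) / (r ^ 2 * Del μ a r)
      - (r ^ 4 - μ * r ^ 2 - μ * a ^ 2) * (4 * r ^ 3 - 2 * μ * r) / (r * Del μ a r ^ 2),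
    -(2 * μ * r / (r * Del μ a r) - (μ * r ^ 2 - 2 * μ * a ^ 2) / (r ^ 2 * Del μ a r)
      - (μ * r ^ 2 - 2 * μ * a ^ 2) * (4 * r ^ 3 - 2 * μ * r) / (r * Del μ a r ^ 2)),
    (4 * r ^ 3 - 2 * μ * r) / r ^ 3 - 3 * Del μ a r / r ^ 4,
    -(1 / r ^ 2), 4 * μ * a / r ^ 5, -(4 * μ * a ^ 2 / r ^ 5)]

lemma hasDerivAt_Del (μ a r : ℝ) :
    HasDerivAt (Del μ a) (4 * r ^ 3 - 2 * μ * r) r := by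
  have := ((hasDerivAt_pow 4 r).sub ((hasDerivAt_pow 2 r).const_mul μ)).add_const (μ * a ^ 2)
  convert! this using 1
  push_cast
  ring

lemma hasDerivAt_coef {μ a r : ℝ} (hr : r ≠ 0) (hD : Del μ a r ≠ 0) (i : Fin 12) :
    HasDerivAt (fun s => coef μ a s i) (coefDeriv μ a r i) r := by
  have d := hasDerivAt_Del μ a r
  have p (n : ℕ) := hasDerivAt_pow n r
  have x := hasDerivAt_id r
  have n1 := (p 4).sub_const (μ * a ^ 2)
  have n2 := ((p 4).sub ((p 2).const_mul μ)).sub_const (μ * a ^ 2)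
  have n3 := ((p 2).const_mul μ).sub_const (2 * μ * a ^ 2)
  have h7 : r ^ 7 ≠ 0 := pow_ne_zero 7 hr
  have xd := x.mul d
  have hxd : r * Del μ a r ≠ 0 := mul_ne_zero hr hD
  fin_cases i
  · exact ((d.const_mul μ).div (p 7) h7).congr_deriv (by
      simp [coefDeriv]; field_simp; try ring)
  · exact ((d.const_mul (μ * a)).div (p 7) h7).neg.congr_deriv (by
      simp [coefDeriv]; field_simp; try ring)
  · exact ((d.mul n1).div (p 7) h7).neg.congr_deriv (by
      simp [coefDeriv]; field_simp; try ring)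
  · exact ((x.const_mul μ).div d hD).congr_deriv (by
      simp [coefDeriv]; field_simp; try ring)
  · exact ((x.const_mul (2 * μ * a)).div d hD).neg.congr_deriv (by
      simp [coefDeriv]; field_simp; try ring)
  · exact ((hasDerivAt_const r (μ * a)).div xd hxd).congr_deriv (by
      simp [coefDeriv]; field_simp; try ring)
  · exact (n2.div xd hxd).congr_deriv (by
      simp [coefDeriv]; field_simp; try ring)
  · exact (n3.div xd hxd).neg.congr_deriv (by
      simp [coefDeriv]; field_simp; try ring)
  · exact (d.div (p 3) (pow_ne_zero 3 hr)).congr_deriv (by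
      simp [coefDeriv]; field_simp; try ring)
  · have := hasDerivAt_inv_pow 1 hr
    simp only [pow_one] at this
    exact this.congr_deriv (by simp [coefDeriv])
  · exact (hasDerivAt_const_div_pow (μ * a) 4 hr).neg.congr_deriv (by
      simp [coefDeriv]; try ring)
  · exact ((hasDerivAt_const_div_pow (μ * a ^ 2) 4 hr).const_add 1).congr_deriv (by
      simp [coefDeriv]; try ring)

/-- The linearized Ricci tensor assembled from the inverse metric `P`, the connection `Γ`, the first
covariant derivative `N` and its radial derivative `N'`. -/
def ricciOf (P : Matrix (Fin 5) (Fin 5) ℝ) (Γ N N' : Fin 5 → Matrix (Fin 5) (Fin 5) ℝ)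
    (i j : Fin 5) : ℝ :=
  1 / 2 * ∑ k, ∑ l, P k l * (secondNabla Γ N N' k i j l + secondNabla Γ N N' k j i l
    - secondNabla Γ N N' k l i j - secondNabla Γ N N' i j k l)

lemma nabla2_mode {μ a : ℝ} (hμ : 0 < μ) (ha : 4 * a ^ 2 < μ) {x : Point}
    (hx : x ∈ exterior μ a) {h : TensorField} {p : ℝ → Fin 7 → ℝ} {q : Fin 7 → ℝ}
    (hh : EqOn h (fun y => radialMode (p (y 1))) (exterior μ a))
    (hp : ∀ i, HasDerivAt (fun r => p r i) (q i) (x 1)) (i j k : Fin 5) :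
    nabla2 (metric μ a) h i j k x = modeNabla (coef μ a (x 1)) (p (x 1)) q i j k := by
  rw [← radialNabla_mode]
  exact nabla2_eq hμ ha hx (H := fun r => radialMode (p r)) hh
    (hasDerivAt_modeMatrix (hp 0) (hp 1) (hp 2) (hp 3) (hp 4) (hp 5) (hp 6)) i j k

lemma nablaNabla_mode {μ a : ℝ} (hμ : 0 < μ) (ha : 4 * a ^ 2 < μ) {x : Point}
    (hx : x ∈ exterior μ a) {h : TensorField} {p q : ℝ → Fin 7 → ℝ} {s : Fin 7 → ℝ}
    (hh : EqOn h (fun y => radialMode (p (y 1))) (exterior μ a))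
    (hp : ∀ r, rPlus μ a < r → ∀ i, HasDerivAt (fun r => p r i) (q r i) r)
    (hq : ∀ i, HasDerivAt (fun r => q r i) (s i) (x 1)) (i j k l : Fin 5) :
    nablaNabla (metric μ a) h i j k l x = secondNabla (connection μ a (x 1))
      (modeNabla (coef μ a (x 1)) (p (x 1)) (q (x 1)))
      (modeNablaDeriv (coef μ a (x 1)) (coefDeriv μ a (x 1)) (p (x 1)) (q (x 1)) s) i j k l := by
  have h1 (y : Point) (hy : y ∈ exterior μ a) (i j k : Fin 5) :=
    nabla2_mode hμ ha hy hh (hp _ hy.1) i j k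
  have h2 := frameDeriv_radial hx (fun y hy => h1 y hy j k l)
    (hasDerivAt_modeNabla (hasDerivAt_coef (rad_pos hμ ha hx.1).ne' (Del_pos hμ ha hx.1).ne')
      (hp _ hx.1) hq rfl j k l) i
  simp only [nablaNabla, h2, h1 x hx, christoffel_eq hμ ha hx, secondNabla]

lemma linRicci_mode {μ a : ℝ} (hμ : 0 < μ) (ha : 4 * a ^ 2 < μ) {x : Point}
    (hx : x ∈ exterior μ a) {h : TensorField} {p q : ℝ → Fin 7 → ℝ} {s : Fin 7 → ℝ}
    (hh : EqOn h (fun y => radialMode (p (y 1))) (exterior μ a))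
    (hp : ∀ r, rPlus μ a < r → ∀ i, HasDerivAt (fun r => p r i) (q r i) r)
    (hq : ∀ i, HasDerivAt (fun r => q r i) (s i) (x 1)) (i j : Fin 5) :
    linRicci (metric μ a) h x i j = ricciOf (radialMetricInv μ a (x 1)) (connection μ a (x 1))
      (modeNabla (coef μ a (x 1)) (p (x 1)) (q (x 1)))
      (modeNablaDeriv (coef μ a (x 1)) (coefDeriv μ a (x 1)) (p (x 1)) (q (x 1)) s) i j := by
  simp only [linRicci, Matrix.of_apply, nablaNabla_mode hμ ha hx hh hp hq, metric_inv hμ ha hx,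
    ricciOf]

/-- The linearized Ricci tensor of a mode tensor with components `p` and radial derivatives `q` and
`s`. -/
def ricciMode (μ a r : ℝ) (p q s : Fin 7 → ℝ) : Matrix (Fin 5) (Fin 5) ℝ :=
  let d := Del μ a r
  let d' := 4 * r ^ 3 - 2 * μ * r
  let b := -(μ * a / r ^ 2)
  let k := r ^ 2 + μ * a ^ 2 / r ^ 2
  let m₁ := μ * r / d
  let m₂ := -(2 * μ * a * r / d)
  let m₃ := μ * a / (r * d)
  let m₄ := (r ^ 4 - μ * r ^ 2 - μ * a ^ 2) / (r * d)
  let ρ := d / r ^ 4 * p 3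
  let ρ' := d / r ^ 4 * q 3 + (2 * μ / r ^ 3 - 4 * μ * a ^ 2 / r ^ 5) * p 3
  let g := (μ * r ^ 2 - 2 * μ * a ^ 2) / (r * d)
  let ν := 3 / (2 * r) + g
  let n := -(r ^ 4 + μ * a ^ 2) * p 0 - 2 * μ * a * p 2 + (r ^ 2 - μ) * p 5
  let n' := -(r ^ 4 + μ * a ^ 2) * q 0 - 2 * μ * a * q 2 + (r ^ 2 - μ) * q 5
    - 4 * r ^ 3 * p 0 + 2 * r * p 5
  let n'' := -(r ^ 4 + μ * a ^ 2) * s 0 - 2 * μ * a * s 2 + (r ^ 2 - μ) * s 5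
    - 8 * r ^ 3 * q 0 + 4 * r * q 5 - 12 * r ^ 2 * p 0 + 2 * p 5
  let l := (n' / d - n * d' / d ^ 2) / 2 + q 6 / r ^ 2 - 2 * p 6 / r ^ 3
  let l' := (n'' / d - 2 * n' * d' / d ^ 2 - n * (12 * r ^ 2 - 2 * μ) / d ^ 2
    + 2 * n * d' ^ 2 / d ^ 3) / 2 + s 6 / r ^ 2 - 4 * q 6 / r ^ 3 + 6 * p 6 / r ^ 4
  let Q₁ := 2 * r ^ 3 / d - (r ^ 4 + μ * a ^ 2) * d' / (2 * d ^ 2)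
  let Q₂ := -(μ * a * d' / (2 * d ^ 2))
  let Q₃ := -(r / d) + (r ^ 2 - μ) * d' / (2 * d ^ 2)
  modeMatrix
    (4 * p 2 * b / r ^ 4 - 4 * b ^ 2 * p 6 / r ^ 6 + 2 * ρ * b ^ 2 / r ^ 4
      + d / r ^ 4 * (-(s 0 / 2) - ρ' * μ / (2 * r ^ 3) - ν * q 0 + 2 * (q 0 * m₁ + q 2 * m₃)
        - 2 * (m₁ ^ 2 * p 0 + 2 * m₁ * m₃ * p 2 + m₃ ^ 2 * p 5) + l * μ / r ^ 3))
    0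
    (2 * (p 2 * k + b * p 5) / r ^ 4 - 4 * b * k * p 6 / r ^ 6 + 2 * ρ * b * k / r ^ 4
      + d / r ^ 4 * (-(s 2 / 2) + ρ' * μ * a / (2 * r ^ 3) - ν * q 2
        + (q 0 * m₂ + q 2 * m₄ + q 2 * m₁ + q 5 * m₃)
        - 2 * (m₁ * m₂ * p 0 + (m₁ * m₄ + m₃ * m₂) * p 2 + m₃ * m₄ * p 5) - l * μ * a / r ^ 3))
    (-l' + ρ' * (3 / r + g) / 2 - g * l - (Q₁ * q 0 + 2 * Q₂ * q 2 + Q₃ * q 5)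
      + 2 * ((m₁ * Q₁ + m₂ * Q₂) * p 0 + 2 * (m₁ * Q₂ + m₂ * Q₃) * p 2
        + (m₃ * Q₂ + m₄ * Q₃) * p 5) - 2 * q 6 / r ^ 3 + 4 * p 6 / r ^ 4)
    0
    (4 * p 5 * k / r ^ 4 - 4 * k ^ 2 * p 6 / r ^ 6 + 2 * ρ * k ^ 2 / r ^ 4
      + d / r ^ 4 * (-(s 5 / 2) + ρ' * (r - μ * a ^ 2 / r ^ 3) / 2 - ν * q 5
        + 2 * (q 2 * m₂ + q 5 * m₄)
        - 2 * (m₂ ^ 2 * p 0 + 2 * m₂ * m₄ * p 2 + m₄ ^ 2 * p 5) - l * (r - μ * a ^ 2 / r ^ 3)))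
    (-(2 * p 5 / r ^ 2) + 2 * k * p 6 / r ^ 4 + ρ * (4 - 2 * k / r ^ 2)
      + d / r ^ 4 * (-(s 6 / 2) + ρ' * r / 2 - ν * q 6 + 2 * q 6 / r - 2 * p 6 / r ^ 2 - l * r))

/-- The contractions of `connectionOf c` with a vector in the upper index. -/
def connectionSum (c : Fin 12 → ℝ) (f : Fin 5 → ℝ) : Fin 5 → Fin 5 → ℝ
  | 0, 0 => c 0 * f 1
  | 0, 1 => c 3 * f 0 + c 5 * f 4
  | 0, 2 => -(c 10 * f 3)
  | 0, 3 => c 10 * f 2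
  | 0, 4 => c 1 * f 1
  | 1, 0 => c 3 * f 0 + c 5 * f 4
  | 1, 1 => c 7 * f 1
  | 1, 2 => c 9 * f 2
  | 1, 3 => c 9 * f 3
  | 1, 4 => c 4 * f 0 + c 6 * f 4
  | 2, 0 => -(c 10 * f 3)
  | 2, 1 => c 9 * f 2
  | 2, 2 => -(c 8 * f 1)
  | 2, 3 => f 4
  | 2, 4 => -(c 11 * f 3)
  | 3, 0 => c 10 * f 2
  | 3, 1 => c 9 * f 3
  | 3, 2 => -f 4
  | 3, 3 => -(c 8 * f 1)
  | 3, 4 => c 11 * f 2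
  | 4, 0 => c 1 * f 1
  | 4, 1 => c 4 * f 0 + c 6 * f 4
  | 4, 2 => (2 - c 11) * f 3
  | 4, 3 => (c 11 - 2) * f 2
  | 4, 4 => c 2 * f 1

lemma sum_connectionOf_mul (c : Fin 12 → ℝ) (f : Fin 5 → ℝ) (i j : Fin 5) :
    ∑ p, connectionOf c i p j * f p = connectionSum c f i j := by
  rw [Fin.sum_univ_five]
  fin_cases i <;> fin_cases j <;> simp [connectionOf, connectionSum]

/-- Each contraction with the connection has at most two non-zero terms; inserting them directly
keeps the expansion of the Ricci tensor small. -/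
lemma secondNabla_connectionOf (c : Fin 12 → ℝ) (N N' : Fin 5 → Matrix (Fin 5) (Fin 5) ℝ)
    (i j k l : Fin 5) :
    secondNabla (connectionOf c) N N' i j k l = (if i = 1 then N' j k l else 0)
      - (connectionSum c (fun p => N p k l) i j + connectionSum c (fun p => N j p l) i k
        + connectionSum c (fun p => N j k p) i l) := by
  simp only [secondNabla, ← sum_connectionOf_mul, Finset.sum_add_distrib]

set_option maxHeartbeats 8000000 in
-- This is a pointwise identity in which the profile values and their derivatives are independent
-- numbers. In the closed form `ρ` is `G h_{rr}` and `l` is half the radial derivative of the rest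
-- of the trace. The components `tr` and `r3` drop out, as they must since for stationary modes they
-- are pure gauge, and `h_{rr}` enters with at most one derivative.
lemma ricciOf_eq {μ a r : ℝ} (hr : 0 < r) (hD : 0 < Del μ a r) (p p' p'' : Fin 7 → ℝ)
    (i j : Fin 5) :
    ricciOf (radialMetricInv μ a r) (connection μ a r) (modeNabla (coef μ a r) p p')
      (modeNablaDeriv (coef μ a r) (coefDeriv μ a r) p p' p'') i j
      = ricciMode μ a r p p' p'' i j := by
  rw [radialMetricInv, connection, G_eq hr, ricciMode]
  obtain ⟨c, hc⟩ : ∃ c, c = coef μ a r := ⟨_, rfl⟩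
  obtain ⟨c', hc'⟩ : ∃ c', c' = coefDeriv μ a r := ⟨_, rfl⟩
  rw [← hc, ← hc']
  fin_cases i <;> fin_cases j
  all_goals
    simp only [ricciOf, Fin.sum_univ_five, ↓modeMatrix_apply,
      Fin.mk_zero, Fin.mk_one, Fin.reduceFinMk, Fin.isValue, zero_mul, add_zero, zero_add]
    simp only [secondNabla_connectionOf, ↓connectionSum, ↓if_true, ↓if_false, Fin.isValue,
      Fin.reduceEq, zero_ne_one, zero_add, zero_sub]
    simp only [modeNablaDeriv, Matrix.add_apply, Matrix.sub_apply, modeNabla_apply,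
      ↓modeMatrix_apply, ↓crossMatrix_apply, Pi.zero_apply,
      mul_zero, zero_mul, add_zero, zero_add, sub_zero, zero_sub, sub_self, neg_zero]
  all_goals
    simp only [hc, hc', coef, coefDeriv, Fin.isValue, Matrix.cons_val]
    field_simp
  all_goals
    simp only [Del]
    ring1

/-! ## Gauge transformations of the mode -/

/-- The point `(t, r)` of the half plane under `x`. -/
def tr (x : Point) : ℝ × ℝ := (x 0, x 1)

lemma frameDeriv_tr {μ a : ℝ} {x : Point} (hx : x ∈ exterior μ a) {f : Point → ℝ}
    {φ : ℝ × ℝ → ℝ} (hf : EqOn f (fun y => φ (tr y)) (exterior μ a))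
    (hφ : DifferentiableAt ℝ φ (tr x)) (i : Fin 5) :
    frameDeriv i f x
      = ![fderiv ℝ φ (tr x) (1, 0), fderiv ℝ φ (tr x) (0, 1), 0, 0, 0] i := by
  have hp : HasFDerivAt tr
      ((ContinuousLinearMap.proj (R := ℝ) (φ := fun _ : Fin 5 => ℝ) 0).prod
        (ContinuousLinearMap.proj (R := ℝ) (φ := fun _ : Fin 5 => ℝ) 1)) x :=
    (ContinuousLinearMap.proj (R := ℝ) (φ := fun _ : Fin 5 => ℝ) 0).hasFDerivAt.prodMk
      (ContinuousLinearMap.proj (R := ℝ) (φ := fun _ : Fin 5 => ℝ) 1).hasFDerivAt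
  have h : HasFDerivAt (fun y : Point => φ (tr y)) _ x := hφ.hasFDerivAt.comp x hp
  rw [frameDeriv_of_eqOn hx hf, frameDeriv, h.fderiv]
  fin_cases i <;> simp [frame, Prod.mk_zero_zero]

/-- The gauge variation of the mode generated by the covector with components `u` whose partial
derivatives with respect to `t` and `r` are `v` and `w`. -/
def gaugeMode (c : Fin 12 → ℝ) (u v w : Fin 3 → ℝ) : Matrix (Fin 5) (Fin 5) ℝ :=
  modeMatrix (2 * (v 0 - c 0 * u 1)) (v 1 + w 0 - 2 * (c 3 * u 0 + c 5 * u 2))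
    (v 2 - 2 * c 1 * u 1) (2 * (w 1 - c 7 * u 1)) (w 2 - 2 * (c 4 * u 0 + c 6 * u 2))
    (-(2 * c 2 * u 1)) (2 * c 8 * u 1)

lemma gaugeVariation_eq {μ a : ℝ} (hμ : 0 < μ) (ha : 4 * a ^ 2 < μ) {x : Point}
    (hx : x ∈ exterior μ a) {ξ : CovectorField} {p : Fin 3 → ℝ × ℝ → ℝ}
    (hξ : EqOn ξ (fun y => ![p 0 (tr y), p 1 (tr y), 0, 0, p 2 (tr y)]) (exterior μ a))
    (hp : ∀ i, DifferentiableAt ℝ (p i) (tr x)) :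
    gaugeVariation (metric μ a) ξ x = gaugeMode (coef μ a (x 1)) (fun i => p i (tr x))
      (fun i => fderiv ℝ (p i) (tr x) (1, 0)) (fun i => fderiv ℝ (p i) (tr x) (0, 1)) := by
  have e0 : EqOn (fun y => ξ y 0) (fun y => p 0 (tr y)) (exterior μ a) := fun y hy => by
    simp [hξ hy]
  have e1 : EqOn (fun y => ξ y 1) (fun y => p 1 (tr y)) (exterior μ a) := fun y hy => by
    simp [hξ hy]
  have e2 : EqOn (fun y => ξ y 2) (fun y => (fun _ => 0 : ℝ × ℝ → ℝ) (tr y))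
    (exterior μ a) := fun y hy => by simp [hξ hy]
  have e3 : EqOn (fun y => ξ y 3) (fun y => (fun _ => 0 : ℝ × ℝ → ℝ) (tr y))
    (exterior μ a) := fun y hy => by simp [hξ hy]
  have e4 : EqOn (fun y => ξ y 4) (fun y => p 2 (tr y)) (exterior μ a) := fun y hy => by
    simp [hξ hy]
  have d0 := frameDeriv_tr hx e0 (hp 0)
  have d1 := frameDeriv_tr hx e1 (hp 1)
  have d2 := frameDeriv_tr hx e2 (differentiableAt_const 0)
  have d3 := frameDeriv_tr hx e3 (differentiableAt_const 0)
  have d4 := frameDeriv_tr hx e4 (hp 2)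
  have key (i j : Fin 5) : nabla1 (metric μ a) ξ i j x = frameDeriv i (fun y => ξ y j) x
      - ∑ l, connectionOf (coef μ a (x 1)) i l j
        * ![p 0 (tr x), p 1 (tr x), 0, 0, p 2 (tr x)] l := by
    simp only [nabla1, christoffel_eq hμ ha hx, hξ hx, connection]
  ext i j
  rw [gaugeVariation, Matrix.of_apply, key, key]
  generalize coef μ a (x 1) = c
  fin_cases i <;> fin_cases j <;>
    simp [d0, d1, d2, d3, d4, Fin.sum_univ_five, connectionOf, gaugeMode, modeMatrix]
  all_goals ring

lemma IsStationaryGaugeField.isGaugeField {μ a : ℝ} {ξ : CovectorField}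
    (h : IsStationaryGaugeField μ a ξ) : IsGaugeField μ a ξ := by
  obtain ⟨p, hp, hξ⟩ := h
  exact ⟨fun i z => p i z.2, fun i => (hp i).comp contDiff_snd.contDiffOn fun z hz => hz.2, hξ⟩

lemma differentiableAt_of_contDiffOn_Ioi {c r : ℝ} {f : ℝ → ℝ} (hf : ContDiffOn ℝ ∞ f (Ioi c))
    (hr : c < r) : DifferentiableAt ℝ f r :=
  ((hf.contDiffAt (Ioi_mem_nhds hr)).differentiableAt (by simp))

/-- The gauge variation of a stationary gauge field. -/
lemma gaugeVariation_stationary {μ a : ℝ} (hμ : 0 < μ) (ha : 4 * a ^ 2 < μ) {x : Point}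
    (hx : x ∈ exterior μ a) {ξ : CovectorField} {p₀ p₁ p₂ : ℝ → ℝ} {w₀ w₁ w₂ : ℝ}
    (hξ : EqOn ξ (fun y => ![p₀ (y 1), p₁ (y 1), 0, 0, p₂ (y 1)]) (exterior μ a))
    (h₀ : HasDerivAt p₀ w₀ (x 1)) (h₁ : HasDerivAt p₁ w₁ (x 1)) (h₂ : HasDerivAt p₂ w₂ (x 1)) :
    gaugeVariation (metric μ a) ξ x
      = gaugeMode (coef μ a (x 1)) ![p₀ (x 1), p₁ (x 1), p₂ (x 1)] 0 ![w₀, w₁, w₂] := by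
  have h {p : ℝ → ℝ} {w : ℝ} (hp : HasDerivAt p w (x 1)) :
      HasFDerivAt (fun z : ℝ × ℝ => p z.2) (w • ContinuousLinearMap.snd ℝ ℝ ℝ)
        (x 0, x 1) :=
    hp.comp_hasFDerivAt (x 0, x 1) hasFDerivAt_snd
  rw [gaugeVariation_eq hμ ha hx (p := ![fun z => p₀ z.2, fun z => p₁ z.2, fun z => p₂ z.2]) hξ
    (fun i => by
      fin_cases i
      exacts [(h h₀).differentiableAt, (h h₁).differentiableAt, (h h₂).differentiableAt])]
  congr 1 <;> funext i <;> fin_cases i <;>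
    simp [(h h₀).fderiv, (h h₁).fderiv, (h h₂).fderiv, tr]

/-- The primitive starts at `c + 1`, inside the open half-line, because `u` need not be integrable
up to `c`. -/
lemma exists_antideriv {c : ℝ} {u : ℝ → ℝ} (hu : ContDiffOn ℝ ∞ u (Ioi c)) :
    ∃ f, ContDiffOn ℝ ∞ f (Ioi c) ∧ ∀ r, c < r → HasDerivAt f (u r) r := by
  have key (r : ℝ) (hr : c < r) :
      HasDerivAt (fun r => ∫ s in (c + 1)..r, u s) (u r) r := by
    have hc : ContinuousOn u (uIcc (c + 1) r) := hu.continuousOn.mono fun s hs => by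
      have := hs.1
      rcases le_total (c + 1) r with h | h
      · simp only [inf_eq_left.2 h] at this
        exact lt_of_lt_of_le (by linarith) this
      · simp only [inf_eq_right.2 h] at this
        exact lt_of_lt_of_le hr this
    exact intervalIntegral.integral_hasDerivAt_right hc.intervalIntegrable
      (hu.continuousOn.stronglyMeasurableAtFilter isOpen_Ioi r hr)
      (hu.continuousOn.continuousAt (Ioi_mem_nhds hr))
  refine ⟨_, ?_, key⟩
  rw [contDiffOn_infty_iff_deriv_of_isOpen isOpen_Ioi]
  exact ⟨fun r hr => (key r hr).differentiableAt.differentiableWithinAt,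
    hu.congr fun r hr => (key r hr).deriv⟩

lemma contDiffOn_const_div_pow {μ a : ℝ} (hμ : 0 < μ) (ha : 4 * a ^ 2 < μ) (c : ℝ) (n : ℕ) :
    ContDiffOn ℝ ∞ (fun r => c / r ^ n) (Ioi (rPlus μ a)) :=
  contDiffOn_const.div (by fun_prop) fun r hr => pow_ne_zero n (rad_pos hμ ha hr).ne'

lemma contDiff_Del (μ a : ℝ) : ContDiff ℝ ∞ (Del μ a) := by
  unfold Del
  fun_prop

/-- The general stationary gauge variation of the mode: `w` is the radial component of the
vector field, and the components `tr` and `r3` are arbitrary. -/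
def radialGauge (μ a r w w' X Z : ℝ) : Matrix (Fin 5) (Fin 5) ℝ :=
  modeMatrix (-(2 * μ / r ^ 3 * w)) X (2 * μ * a / r ^ 3 * w)
    (2 * w' * r ^ 4 / Del μ a r - w * (2 * μ / r ^ 3 - 4 * μ * a ^ 2 / r ^ 5) * r ^ 8 / Del μ a r ^ 2)
    Z ((2 * r - 2 * μ * a ^ 2 / r ^ 3) * w) (2 * r * w)

lemma exists_gauge {μ a : ℝ} (hμ : 0 < μ) (ha : 4 * a ^ 2 < μ) {w X Z : ℝ → ℝ}
    (hw : ContDiffOn ℝ ∞ w (Ioi (rPlus μ a))) (hX : ContDiffOn ℝ ∞ X (Ioi (rPlus μ a)))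
    (hZ : ContDiffOn ℝ ∞ Z (Ioi (rPlus μ a))) :
    ∃ ξ, IsStationaryGaugeField μ a ξ ∧ EqOn (gaugeVariation (metric μ a) ξ)
      (fun x => radialGauge μ a (x 1) (w (x 1)) (deriv w (x 1)) (X (x 1)) (Z (x 1)))
      (exterior μ a) := by
  have hDne : ∀ r ∈ Ioi (rPlus μ a), Del μ a r ≠ 0 := fun r hr => (Del_pos hμ ha hr).ne'
  have hDs : ContDiffOn ℝ ∞ (Del μ a) (Ioi (rPlus μ a)) := (contDiff_Del μ a).contDiffOn
  have hpow (n : ℕ) : ContDiffOn ℝ ∞ (fun r : ℝ => r ^ n) (Ioi (rPlus μ a)) := by fun_prop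
  -- The functions `f` and `k` are the contravariant components `ξ^t` and `ξ^3`. Since `(δg)_{tr} =
  -- g_{tt} f' + g_{t3} k'` and `(δg)_{r3} = g_{t3} f' + g_{33} k'`, prescribing `X` and `Z` means
  -- integrating the inverse of the `t3` block applied to `(X, Z)`. The witness below lowers the
  -- index again; its radial entry is `w / G`.
  obtain ⟨f, hf, hf'⟩ := exists_antideriv (c := rPlus μ a)
    (u := fun r => -((r ^ 4 + μ * a ^ 2) / Del μ a r * X r) - μ * a / Del μ a r * Z r)
    (((((hpow 4).add contDiffOn_const).div hDs hDne).mul hX).neg.sub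
      ((contDiffOn_const.div hDs hDne).mul hZ))
  obtain ⟨k, hk, hk'⟩ := exists_antideriv (c := rPlus μ a)
    (u := fun r => -(μ * a / Del μ a r * X r) + (r ^ 2 - μ) / Del μ a r * Z r)
    (((contDiffOn_const.div hDs hDne).mul hX).neg.add
      ((((hpow 2).sub contDiffOn_const).div hDs hDne).mul hZ))
  have hA : ContDiffOn ℝ ∞ (fun r => -1 + μ / r ^ 2) (Ioi (rPlus μ a)) :=
    contDiffOn_const.add (contDiffOn_const_div_pow hμ ha μ 2)
  have hB : ContDiffOn ℝ ∞ (fun r => -(μ * a / r ^ 2)) (Ioi (rPlus μ a)) :=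
    (contDiffOn_const_div_pow hμ ha _ 2).neg
  have hC : ContDiffOn ℝ ∞ (fun r => r ^ 2 + μ * a ^ 2 / r ^ 2) (Ioi (rPlus μ a)) :=
    (hpow 2).add (contDiffOn_const_div_pow hμ ha _ 2)
  refine ⟨fun x => ![(fun r => (-1 + μ / r ^ 2) * f r + -(μ * a / r ^ 2) * k r) (x 1),
    (fun r => w r * (r ^ 4 / Del μ a r)) (x 1), 0, 0,
    (fun r => -(μ * a / r ^ 2) * f r + (r ^ 2 + μ * a ^ 2 / r ^ 2) * k r) (x 1)],
    ⟨![fun r => (-1 + μ / r ^ 2) * f r + -(μ * a / r ^ 2) * k r,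
      fun r => w r * (r ^ 4 / Del μ a r),
      fun r => -(μ * a / r ^ 2) * f r + (r ^ 2 + μ * a ^ 2 / r ^ 2) * k r], ?_, fun x _ => rfl⟩, fun x hx => ?_⟩
  · intro i
    fin_cases i
    · exact (hA.mul hf).add (hB.mul hk)
    · exact hw.mul ((hpow 4).div hDs hDne)
    · exact (hB.mul hf).add (hC.mul hk)
  · have hr := rad_pos hμ ha hx.1
    have hD := Del_pos hμ ha hx.1
    have dA := (hasDerivAt_const_div_pow μ 2 hr.ne').const_add (-1)
    have dB := (hasDerivAt_const_div_pow (μ * a) 2 hr.ne').neg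
    have dC := (hasDerivAt_pow 2 (x 1)).add (hasDerivAt_const_div_pow (μ * a ^ 2) 2 hr.ne')
    have df := hf' _ hx.1
    have dk := hk' _ hx.1
    have dw := (differentiableAt_of_contDiffOn_Ioi hw hx.1).hasDerivAt
    have dg := (hasDerivAt_pow 4 (x 1)).div (hasDerivAt_Del μ a (x 1)) hD.ne'
    rw [gaugeVariation_stationary hμ ha hx
      (p₀ := fun r => (-1 + μ / r ^ 2) * f r + -(μ * a / r ^ 2) * k r)
      (p₁ := fun r => w r * (r ^ 4 / Del μ a r))
      (p₂ := fun r => -(μ * a / r ^ 2) * f r + (r ^ 2 + μ * a ^ 2 / r ^ 2) * k r)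
      (fun y _ => rfl) ((dA.mul df).add (dB.mul dk)) (dw.mul dg) ((dB.mul df).add (dC.mul dk))]
    beta_reduce
    generalize x 1 = r at *
    have hDu : Del μ a r = r ^ 4 - μ * r ^ 2 + μ * a ^ 2 := rfl
    simp only [gaugeMode, radialGauge, coef, Matrix.cons_val, Pi.zero_apply, Pi.neg_apply,
      Pi.add_apply, Pi.div_apply, Nat.cast_ofNat]
    congr 1
    · field_simp
      ring
    · field_simp
      rw [hDu]
      ring
    · field_simp
      ring
    · field_simp
      rw [hDu]
      ring
    · field_simp
      rw [hDu]
      ring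
    · field_simp
    · field_simp

/-! ## Solutions in terms of the profile functions -/

lemma modeMatrix_inj {a b c d e f g a' b' c' d' e' f' g' : ℝ} :
    modeMatrix a b c d e f g = modeMatrix a' b' c' d' e' f' g' ↔
      a = a' ∧ b = b' ∧ c = c' ∧ d = d' ∧ e = e' ∧ f = f' ∧ g = g' := by
  constructor
  · intro h
    have h (i j : Fin 5) := congrFun (congrFun h i) j
    exact ⟨h 0 0, h 0 1, h 0 4, h 1 1, h 1 4, h 4 4, h 2 2⟩
  · rintro ⟨rfl, rfl, rfl, rfl, rfl, rfl, rfl⟩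
    rfl

lemma linRicci_eq_ricciMode {μ a : ℝ} (hμ : 0 < μ) (ha : 4 * a ^ 2 < μ) {x : Point}
    (hx : x ∈ exterior μ a) {h : TensorField} {p q : ℝ → Fin 7 → ℝ} {s : Fin 7 → ℝ}
    (hh : EqOn h (fun y => radialMode (p (y 1))) (exterior μ a))
    (hp : ∀ r, rPlus μ a < r → ∀ i, HasDerivAt (fun r => p r i) (q r i) r)
    (hq : ∀ i, HasDerivAt (fun r => q r i) (s i) (x 1)) :
    linRicci (metric μ a) h x = ricciMode μ a (x 1) (p (x 1)) (q (x 1)) s := by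
  ext i j
  rw [linRicci_mode hμ ha hx hh hp hq,
    ricciOf_eq (rad_pos hμ ha hx.1) (Del_pos hμ ha hx.1)]

lemma trace_metricInv_metric {μ a : ℝ} (hμ : 0 < μ) (ha : 4 * a ^ 2 < μ) {x : Point}
    (hx : x ∈ exterior μ a) : ∑ k, ∑ l, (metric μ a x)⁻¹ k l * metric μ a x k l = 5 := by
  have hr := rad_pos hμ ha hx.1
  have hD := Del_pos hμ ha hx.1
  rw [metric_inv hμ ha hx]
  change ∑ k, ∑ l, _ * radialMetric μ a (x 1) k l = 5
  generalize x 1 = r at *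
  simp only [Fin.sum_univ_five, radialMetric, radialMetricInv, modeMatrix, Fin.isValue,
    Matrix.of_apply, Matrix.cons_val, Matrix.cons_val', Matrix.cons_val_fin_one, mul_zero, add_zero,
    zero_add, G_eq hr]
  field_simp
  simp only [Del]
  ring

/-- If `δR = t g` with `t` half the trace of `δR`, taking the trace in dimension five gives `2 t = 5
t`, hence `t = 0`. -/
lemma linEinstein_eq_zero_iff {μ a : ℝ} (hμ : 0 < μ) (ha : 4 * a ^ 2 < μ) {x : Point}
    (hx : x ∈ exterior μ a) (h : TensorField) :
    linEinstein (metric μ a) h x = 0 ↔ linRicci (metric μ a) h x = 0 := by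
  constructor
  · intro h0
    rw [linEinstein, sub_eq_zero] at h0
    set t := 1 / 2 * ∑ k, ∑ l, (metric μ a x)⁻¹ k l * linRicci (metric μ a) h x k l with ht
    have h1 : 2 * t = 5 * t := by
      calc 2 * t = ∑ k, ∑ l, (metric μ a x)⁻¹ k l * linRicci (metric μ a) h x k l := by
            rw [ht]; ring
        _ = ∑ k, ∑ l, (metric μ a x)⁻¹ k l * (t * metric μ a x k l) := by
            simp only [h0, Matrix.smul_apply, smul_eq_mul]
        _ = t * ∑ k, ∑ l, (metric μ a x)⁻¹ k l * metric μ a x k l := by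
            simp only [Finset.mul_sum]
            exact Finset.sum_congr rfl fun k _ => Finset.sum_congr rfl fun l _ => by ring
        _ = 5 * t := by rw [trace_metricInv_metric hμ ha hx]; ring
    rw [h0, show t = 0 by linarith, zero_smul]
  · intro h0
    simp [linEinstein, h0]

lemma isSolution_iff {μ a : ℝ} (hμ : 0 < μ) (ha : 4 * a ^ 2 < μ) {h : TensorField}
    {p q s : ℝ → Fin 7 → ℝ}
    (hh : EqOn h (fun y => radialMode (p (y 1))) (exterior μ a))
    (hp : ∀ r, rPlus μ a < r → ∀ i, HasDerivAt (fun r => p r i) (q r i) r)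
    (hq : ∀ r, rPlus μ a < r → ∀ i, HasDerivAt (fun r => q r i) (s r i) r) :
    IsSolution μ a h ↔ ∀ r, rPlus μ a < r → ricciMode μ a r (p r) (q r) (s r) = 0 := by
  constructor
  · intro hs r hr
    -- The equations depend on `r` only, so one point of the chart at each radius suffices.
    have hx := equator_mem (μ := μ) (a := a) (t := 0) hr
    have := (linEinstein_eq_zero_iff hμ ha hx h).1 (hs _ hx)
    rwa [linRicci_eq_ricciMode hμ ha hx hh hp (hq _ hx.1)] at this
  · intro hs x hx
    rw [linEinstein_eq_zero_iff hμ ha hx, linRicci_eq_ricciMode hμ ha hx hh hp (hq _ hx.1)]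
    exact hs _ hx.1

/-- The components of `ricciMode` are linear. -/
lemma ricciMode_add_smul (μ a r t : ℝ) (p q s p' q' s' : Fin 7 → ℝ) :
    ricciMode μ a r (p + t • p') (q + t • q') (s + t • s')
      = ricciMode μ a r p q s + t • ricciMode μ a r p' q' s' := by
  simp only [ricciMode, smul_modeMatrix, modeMatrix_add, modeMatrix_inj, Pi.add_apply,
    Pi.smul_apply, smul_eq_mul]
  refine ⟨?_, ?_, ?_, ?_, ?_, ?_, ?_⟩ <;> ring

/-- `h` is a mode tensor with profile functions `p`, with first and second derivatives `q`, `s`. -/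
structure HasProfile (μ a : ℝ) (h : TensorField) (p q s : ℝ → Fin 7 → ℝ) : Prop where
  smooth : ∀ i, ContDiffOn ℝ ∞ (fun r => p r i) (Ioi (rPlus μ a))
  eqOn : EqOn h (fun y => radialMode (p (y 1))) (exterior μ a)
  deriv₁ : ∀ r, rPlus μ a < r → ∀ i, HasDerivAt (fun r => p r i) (q r i) r
  deriv₂ : ∀ r, rPlus μ a < r → ∀ i, HasDerivAt (fun r => q r i) (s r i) r

lemma IsStationaryMode.exists_profile {μ a : ℝ} {h : TensorField} (hh : IsStationaryMode μ a h) :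
    ∃ p q s, HasProfile μ a h p q s := by
  obtain ⟨p, hp, he⟩ := hh
  refine ⟨fun r i => p i r, fun r i => deriv (p i) r, fun r i => deriv (deriv (p i)) r,
    hp, he, fun r hr i => ?_, fun r hr i => ?_⟩
  · exact (differentiableAt_of_contDiffOn_Ioi (hp i) hr).hasDerivAt
  · have := ((contDiffOn_infty_iff_deriv_of_isOpen isOpen_Ioi).1 (hp i)).2
    exact (differentiableAt_of_contDiffOn_Ioi this hr).hasDerivAt

lemma HasProfile.isStationaryMode {μ a : ℝ} {h : TensorField} {p q s : ℝ → Fin 7 → ℝ}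
    (hh : HasProfile μ a h p q s) : IsStationaryMode μ a h :=
  ⟨fun i r => p r i, hh.smooth, hh.eqOn⟩

lemma HasProfile.isSolution_iff {μ a : ℝ} (hμ : 0 < μ) (ha : 4 * a ^ 2 < μ) {h : TensorField}
    {p q s : ℝ → Fin 7 → ℝ} (hh : HasProfile μ a h p q s) :
    IsSolution μ a h ↔ ∀ r, rPlus μ a < r → ricciMode μ a r (p r) (q r) (s r) = 0 :=
  MyersPerry.isSolution_iff hμ ha hh.eqOn hh.deriv₁ hh.deriv₂

lemma HasProfile.add_smul {μ a : ℝ} {h h' : TensorField} {p q s p' q' s' : ℝ → Fin 7 → ℝ}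
    (hh : HasProfile μ a h p q s) (hh' : HasProfile μ a h' p' q' s') (t : ℝ) :
    HasProfile μ a (h + t • h') (p + t • p') (q + t • q') (s + t • s') where
  smooth i := (hh.smooth i).add ((hh'.smooth i).const_smul t)
  eqOn x hx := by
    simp only [Pi.add_apply, Pi.smul_apply, hh.eqOn hx, hh'.eqOn hx, radialMode,
      smul_modeMatrix, modeMatrix_add, smul_eq_mul]
  deriv₁ r hr i := (hh.deriv₁ r hr i).add ((hh'.deriv₁ r hr i).const_smul t)
  deriv₂ r hr i := (hh.deriv₂ r hr i).add ((hh'.deriv₂ r hr i).const_smul t)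

/-- Stationary gauge variations solve the linearized Einstein equation. -/
lemma ricciMode_radialGauge {μ a r : ℝ} (hr : 0 < r) (hD : 0 < Del μ a r)
    (w w' w'' X X' X'' Z Z' Z'' rr'' : ℝ) :
    ricciMode μ a r
      ![-(2 * μ / r ^ 3 * w), X, 2 * μ * a / r ^ 3 * w,
        2 * w' * r ^ 4 / Del μ a r
          - w * (2 * μ / r ^ 3 - 4 * μ * a ^ 2 / r ^ 5) * r ^ 8 / Del μ a r ^ 2,
        Z, (2 * r - 2 * μ * a ^ 2 / r ^ 3) * w, 2 * r * w]
      ![6 * μ / r ^ 4 * w - 2 * μ / r ^ 3 * w', X', 2 * μ * a / r ^ 3 * w' - 6 * μ * a / r ^ 4 * w,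
        2 * w'' * r ^ 4 / Del μ a r + 8 * w' * r ^ 3 / Del μ a r
          - 2 * w' * r ^ 4 * (4 * r ^ 3 - 2 * μ * r) / Del μ a r ^ 2
          - w' * (2 * μ * r ^ 5 - 4 * μ * a ^ 2 * r ^ 3) / Del μ a r ^ 2
          - w * (10 * μ * r ^ 4 - 12 * μ * a ^ 2 * r ^ 2) / Del μ a r ^ 2
          + 2 * w * (2 * μ * r ^ 5 - 4 * μ * a ^ 2 * r ^ 3) * (4 * r ^ 3 - 2 * μ * r)
            / Del μ a r ^ 3,
        Z', (2 * r - 2 * μ * a ^ 2 / r ^ 3) * w' + (2 + 6 * μ * a ^ 2 / r ^ 4) * w,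
        2 * r * w' + 2 * w]
      ![-(24 * μ / r ^ 5 * w) + 12 * μ / r ^ 4 * w' - 2 * μ / r ^ 3 * w'', X'',
        2 * μ * a / r ^ 3 * w'' - 12 * μ * a / r ^ 4 * w' + 24 * μ * a / r ^ 5 * w, rr'', Z'',
        (2 * r - 2 * μ * a ^ 2 / r ^ 3) * w'' + 2 * (2 + 6 * μ * a ^ 2 / r ^ 4) * w'
          - 24 * μ * a ^ 2 / r ^ 5 * w,
        2 * r * w'' + 4 * w'] = 0 := by
  have h0 : (0 : Matrix (Fin 5) (Fin 5) ℝ) = modeMatrix 0 0 0 0 0 0 0 := by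
    ext i j
    fin_cases i <;> fin_cases j <;> rfl
  have hDu : Del μ a r = r ^ 4 - μ * r ^ 2 + μ * a ^ 2 := rfl
  rw [h0, ricciMode, modeMatrix_inj]
  simp only [Fin.isValue, Matrix.cons_val]
  refine ⟨?_, trivial, ?_, ?_, trivial, ?_, ?_⟩
  -- The number `rr''` may be arbitrary because the Ricci tensor does not contain the second
  -- derivative of `h_{rr}`.
  all_goals
    field_simp
    rw [hDu]
    ring

/-! ## Consequences for gauge fields -/

lemma isOpen_univ_prod_Ioi (c : ℝ) : IsOpen ((univ : Set ℝ) ×ˢ Ioi c) :=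
  isOpen_univ.prod isOpen_Ioi

lemma differentiableAt_of_contDiffOn_prod {c : ℝ} {z : ℝ × ℝ} {f : ℝ × ℝ → ℝ}
    (hf : ContDiffOn ℝ ∞ f (univ ×ˢ Ioi c)) (hz : c < z.2) : DifferentiableAt ℝ f z :=
  (hf.contDiffAt ((isOpen_univ_prod_Ioi c).mem_nhds ⟨mem_univ _, hz⟩)).differentiableAt (by simp)

lemma gaugeMode_add_smul (c : Fin 12 → ℝ) (t : ℝ) (u v w u' v' w' : Fin 3 → ℝ) :
    gaugeMode c (fun i => u i + t * u' i) (fun i => v i + t * v' i) (fun i => w i + t * w' i)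
      = gaugeMode c u v w + t • gaugeMode c u' v' w' := by
  simp only [gaugeMode, smul_modeMatrix, modeMatrix_add, modeMatrix_inj]
  refine ⟨?_, ?_, ?_, ?_, ?_, ?_, ?_⟩ <;> ring

lemma IsGaugeField.add_smul {μ a : ℝ} {ξ η : CovectorField} (hξ : IsGaugeField μ a ξ)
    (hη : IsGaugeField μ a η) (t : ℝ) : IsGaugeField μ a (ξ + t • η) := by
  obtain ⟨p, hp, ep⟩ := hξ
  obtain ⟨q, hq, eq⟩ := hη
  refine ⟨fun i z => p i z + t * q i z, fun i => (hp i).add ((hq i).const_smul t), fun x hx => ?_⟩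
  simp only [Pi.add_apply, Pi.smul_apply, ep hx, eq hx]
  ext i
  fin_cases i <;> simp

lemma IsStationaryGaugeField.add_smul {μ a : ℝ} {ξ η : CovectorField}
    (hξ : IsStationaryGaugeField μ a ξ) (hη : IsStationaryGaugeField μ a η) (t : ℝ) :
    IsStationaryGaugeField μ a (ξ + t • η) := by
  obtain ⟨p, hp, ep⟩ := hξ
  obtain ⟨q, hq, eq⟩ := hη
  refine ⟨fun i z => p i z + t * q i z, fun i => (hp i).add ((hq i).const_smul t), fun x hx => ?_⟩
  simp only [Pi.add_apply, Pi.smul_apply, ep hx, eq hx]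
  ext i
  fin_cases i <;> simp

lemma gaugeVariation_add_smul {μ a : ℝ} (hμ : 0 < μ) (ha : 4 * a ^ 2 < μ) {ξ η : CovectorField}
    (hξ : IsGaugeField μ a ξ) (hη : IsGaugeField μ a η) (t : ℝ) :
    EqOn (gaugeVariation (metric μ a) (ξ + t • η))
      (gaugeVariation (metric μ a) ξ + t • gaugeVariation (metric μ a) η) (exterior μ a) := by
  obtain ⟨p, hp, ep⟩ := hξ
  obtain ⟨q, hq, eq⟩ := hη
  intro x hx
  have dp (i) : DifferentiableAt ℝ (p i) (tr x) := differentiableAt_of_contDiffOn_prod (hp i) hx.1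
  have dq (i) : DifferentiableAt ℝ (q i) (tr x) := differentiableAt_of_contDiffOn_prod (hq i) hx.1
  rw [gaugeVariation_eq hμ ha hx (p := fun i z => p i z + t * q i z) (fun y hy => ?_)
    fun i => (dp i).add ((dq i).const_mul t), Pi.add_apply, Pi.smul_apply,
    gaugeVariation_eq hμ ha hx ep dp, gaugeVariation_eq hμ ha hx eq dq, ← gaugeMode_add_smul]
  · congr 1 <;> funext i <;>
    rw [fderiv_fun_add (dp i) ((dq i).const_mul t), fderiv_const_mul (dq i)] <;> simp
  · simp only [Pi.add_apply, Pi.smul_apply, ep hy, eq hy]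
    ext i
    fin_cases i <;> simp [tr]

/-- The explicit values and first derivatives are exported for the symmetry operator. The derivative
of `h_{rr}` is left as an unspecified `y`, since `symMode` does not involve it. -/
lemma profile_of_gauge {μ a : ℝ} (hμ : 0 < μ) (ha : 4 * a ^ 2 < μ) {w X Z : ℝ → ℝ}
    (hw : ContDiffOn ℝ ∞ w (Ioi (rPlus μ a))) (hX : ContDiffOn ℝ ∞ X (Ioi (rPlus μ a)))
    (hZ : ContDiffOn ℝ ∞ Z (Ioi (rPlus μ a))) {h : TensorField}
    (hh : EqOn h (fun x => radialGauge μ a (x 1) (w (x 1)) (deriv w (x 1)) (X (x 1)) (Z (x 1)))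
      (exterior μ a)) :
    ∃ p q s, HasProfile μ a h p q s ∧ IsSolution μ a h ∧ ∀ r, rPlus μ a < r →
      p r = ![-(2 * μ / r ^ 3 * w r), X r, 2 * μ * a / r ^ 3 * w r,
        2 * deriv w r * r ^ 4 / Del μ a r
          - w r * (2 * μ / r ^ 3 - 4 * μ * a ^ 2 / r ^ 5) * r ^ 8 / Del μ a r ^ 2,
        Z r, (2 * r - 2 * μ * a ^ 2 / r ^ 3) * w r, 2 * r * w r] ∧
      ∃ y, q r = ![6 * μ / r ^ 4 * w r - 2 * μ / r ^ 3 * deriv w r, deriv X r,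
        2 * μ * a / r ^ 3 * deriv w r - 6 * μ * a / r ^ 4 * w r, y,
        deriv Z r, (2 * r - 2 * μ * a ^ 2 / r ^ 3) * deriv w r
          + (2 + 6 * μ * a ^ 2 / r ^ 4) * w r,
        2 * r * deriv w r + 2 * w r] := by
  have hw1 := ((contDiffOn_infty_iff_deriv_of_isOpen isOpen_Ioi).1 hw).2
  have hw2 := ((contDiffOn_infty_iff_deriv_of_isOpen isOpen_Ioi).1 hw1).2
  have hX1 := ((contDiffOn_infty_iff_deriv_of_isOpen isOpen_Ioi).1 hX).2
  have hZ1 := ((contDiffOn_infty_iff_deriv_of_isOpen isOpen_Ioi).1 hZ).2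
  have hDne : ∀ r ∈ Ioi (rPlus μ a), Del μ a r ≠ 0 := fun r hr => (Del_pos hμ ha hr).ne'
  have hDs : ContDiffOn ℝ ∞ (Del μ a) (Ioi (rPlus μ a)) := (contDiff_Del μ a).contDiffOn
  have hpow (n : ℕ) : ContDiffOn ℝ ∞ (fun r : ℝ => r ^ n) (Ioi (rPlus μ a)) := by fun_prop
  have hc (c : ℝ) (n : ℕ) := contDiffOn_const_div_pow hμ ha c n
  set p3 : ℝ → ℝ := fun r => 2 * deriv w r * r ^ 4 / Del μ a r
          - w r * (2 * μ / r ^ 3 - 4 * μ * a ^ 2 / r ^ 5) * r ^ 8 / Del μ a r ^ 2 with hp3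
  have sp3 : ContDiffOn ℝ ∞ p3 (Ioi (rPlus μ a)) :=
    (((contDiffOn_const.mul hw1).mul (hpow 4)).div hDs hDne).sub
      (((hw.mul ((hc _ 3).sub (hc _ 5))).mul (hpow 8)).div (hDs.pow 2)
        fun r hr => pow_ne_zero 2 (hDne r hr))
  have sp3' := ((contDiffOn_infty_iff_deriv_of_isOpen isOpen_Ioi).1 sp3).2
  set P : ℝ → Fin 7 → ℝ := fun r => ![-(2 * μ / r ^ 3 * w r), X r, 2 * μ * a / r ^ 3 * w r, p3 r,
    Z r, (2 * r - 2 * μ * a ^ 2 / r ^ 3) * w r, 2 * r * w r] with hP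
  set Q : ℝ → Fin 7 → ℝ := fun r =>
      ![6 * μ / r ^ 4 * w r - 2 * μ / r ^ 3 * deriv w r, deriv X r,
        2 * μ * a / r ^ 3 * deriv w r - 6 * μ * a / r ^ 4 * w r, deriv p3 r,
        deriv Z r, (2 * r - 2 * μ * a ^ 2 / r ^ 3) * deriv w r
          + (2 + 6 * μ * a ^ 2 / r ^ 4) * w r,
        2 * r * deriv w r + 2 * w r] with hQ
  set S : ℝ → Fin 7 → ℝ := fun r =>
      ![-(24 * μ / r ^ 5 * w r) + 12 * μ / r ^ 4 * deriv w r - 2 * μ / r ^ 3 * deriv (deriv w) r,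
        deriv (deriv X) r,
        2 * μ * a / r ^ 3 * deriv (deriv w) r - 12 * μ * a / r ^ 4 * deriv w r
          + 24 * μ * a / r ^ 5 * w r, deriv (deriv p3) r, deriv (deriv Z) r,
        (2 * r - 2 * μ * a ^ 2 / r ^ 3) * deriv (deriv w) r
          + 2 * (2 + 6 * μ * a ^ 2 / r ^ 4) * deriv w r - 24 * μ * a ^ 2 / r ^ 5 * w r,
        2 * r * deriv (deriv w) r + 4 * deriv w r] with hS
  have dP : ∀ r, rPlus μ a < r → ∀ i, HasDerivAt (fun r => P r i) (Q r i) r := by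
    intro r hr i
    have hr0 := (rad_pos hμ ha hr).ne'
    have dw := (differentiableAt_of_contDiffOn_Ioi hw hr).hasDerivAt
    have dd (c : ℝ) (n : ℕ) := hasDerivAt_const_div_pow c n hr0
    have dl : HasDerivAt (fun r : ℝ => 2 * r) 2 r := by
      simpa using (hasDerivAt_id r).const_mul (2 : ℝ)
    fin_cases i
    · exact (((dd (2 * μ) 3).mul dw).neg).congr_deriv (by simp [hQ]; field_simp; ring)
    · exact (differentiableAt_of_contDiffOn_Ioi hX hr).hasDerivAt
    · exact ((dd (2 * μ * a) 3).mul dw).congr_deriv (by simp [hQ]; field_simp; ring)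
    · exact (differentiableAt_of_contDiffOn_Ioi sp3 hr).hasDerivAt
    · exact (differentiableAt_of_contDiffOn_Ioi hZ hr).hasDerivAt
    · exact ((dl.sub (dd (2 * μ * a ^ 2) 3)).mul dw).congr_deriv
        (by simp [hQ]; field_simp; ring)
    · exact (dl.mul dw).congr_deriv (by simp [hQ]; ring)
  have dQ : ∀ r, rPlus μ a < r → ∀ i, HasDerivAt (fun r => Q r i) (S r i) r := by
    intro r hr i
    have hr0 := (rad_pos hμ ha hr).ne'
    have dw := (differentiableAt_of_contDiffOn_Ioi hw hr).hasDerivAt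
    have dw' := (differentiableAt_of_contDiffOn_Ioi hw1 hr).hasDerivAt
    have dd (c : ℝ) (n : ℕ) := hasDerivAt_const_div_pow c n hr0
    have dl : HasDerivAt (fun r : ℝ => 2 * r) 2 r := by
      simpa using (hasDerivAt_id r).const_mul (2 : ℝ)
    fin_cases i
    · exact (((dd (6 * μ) 4).mul dw).sub ((dd (2 * μ) 3).mul dw')).congr_deriv
        (by simp [hS]; field_simp; ring)
    · exact (differentiableAt_of_contDiffOn_Ioi hX1 hr).hasDerivAt
    · exact (((dd (2 * μ * a) 3).mul dw').sub ((dd (6 * μ * a) 4).mul dw)).congr_deriv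
        (by simp [hS]; field_simp; ring)
    · exact (differentiableAt_of_contDiffOn_Ioi sp3' hr).hasDerivAt
    · exact (differentiableAt_of_contDiffOn_Ioi hZ1 hr).hasDerivAt
    · exact (((dl.sub (dd (2 * μ * a ^ 2) 3)).mul dw').add
        (((dd (6 * μ * a ^ 2) 4).const_add 2).mul dw)).congr_deriv
        (by simp [hS]; field_simp; ring)
    · exact ((dl.mul dw').add (dw.const_mul 2)).congr_deriv (by simp [hS]; ring)
  have hprof : HasProfile μ a h P Q S := by
    refine ⟨fun i => ?_, hh, dP, dQ⟩
    fin_cases i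
    · exact ((hc _ 3).mul hw).neg
    · exact hX
    · exact (hc _ 3).mul hw
    · exact sp3
    · exact hZ
    · exact ((contDiffOn_const.mul contDiffOn_id).sub (hc _ 3)).mul hw
    · exact (contDiffOn_const.mul contDiffOn_id).mul hw
  refine ⟨P, Q, S, hprof, (hprof.isSolution_iff hμ ha).2 fun r hr => ?_,
    fun r hr => ⟨rfl, _, rfl⟩⟩
  have hr0 := rad_pos hμ ha hr
  have hD := Del_pos hμ ha hr
  have e3 : deriv p3 r = 2 * deriv (deriv w) r * r ^ 4 / Del μ a r
          + 8 * deriv w r * r ^ 3 / Del μ a r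
          - 2 * deriv w r * r ^ 4 * (4 * r ^ 3 - 2 * μ * r) / Del μ a r ^ 2
          - deriv w r * (2 * μ * r ^ 5 - 4 * μ * a ^ 2 * r ^ 3) / Del μ a r ^ 2
          - w r * (10 * μ * r ^ 4 - 12 * μ * a ^ 2 * r ^ 2) / Del μ a r ^ 2
          + 2 * w r * (2 * μ * r ^ 5 - 4 * μ * a ^ 2 * r ^ 3) * (4 * r ^ 3 - 2 * μ * r)
            / Del μ a r ^ 3 := by
    have dw := (differentiableAt_of_contDiffOn_Ioi hw hr).hasDerivAt
    have dw' := (differentiableAt_of_contDiffOn_Ioi hw1 hr).hasDerivAt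
    have dd (c : ℝ) (n : ℕ) := hasDerivAt_const_div_pow c n hr0.ne'
    have dD := hasDerivAt_Del μ a r
    have := ((((dw'.const_mul 2).mul (hasDerivAt_pow 4 r)).div dD hD.ne').sub
      (((dw.mul ((dd (2 * μ) 3).sub (dd (4 * μ * a ^ 2) 5))).mul (hasDerivAt_pow 8 r)).div
        (dD.pow 2) (pow_ne_zero 2 hD.ne')))
    refine this.deriv.trans ?_
    simp only [Pi.mul_apply, Pi.sub_apply, Pi.pow_apply, Nat.cast_ofNat]
    field_simp
    ring
  have := ricciMode_radialGauge hr0 hD (w r) (deriv w r) (deriv (deriv w) r) (X r) (deriv X r)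
    (deriv (deriv X) r) (Z r) (deriv Z r) (deriv (deriv Z) r) (deriv (deriv p3) r)
  rw [← e3] at this
  exact this

/-- Every mode can be brought to the gauge `h_{tr} = h_{r3} = h_{+-} = 0`. -/
lemma exists_isGaugeFixed {μ a : ℝ} (hμ : 0 < μ) (ha : 4 * a ^ 2 < μ) {h : TensorField}
    (hh : IsStationaryMode μ a h) : ∃ (ξ : CovectorField) (w X Z : ℝ → ℝ),
      ContDiffOn ℝ ∞ w (Ioi (rPlus μ a)) ∧ ContDiffOn ℝ ∞ X (Ioi (rPlus μ a)) ∧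
      ContDiffOn ℝ ∞ Z (Ioi (rPlus μ a)) ∧ IsStationaryGaugeField μ a ξ ∧
      EqOn (gaugeVariation (metric μ a) ξ)
        (fun x => radialGauge μ a (x 1) (w (x 1)) (deriv w (x 1)) (X (x 1)) (Z (x 1)))
        (exterior μ a) ∧ IsGaugeFixed μ a (h + gaugeVariation (metric μ a) ξ) := by
  obtain ⟨p, hp, he⟩ := hh
  -- The `+-` component of `radialGauge` is `2 r w`, which dictates this choice of `w`.
  have hw : ContDiffOn ℝ ∞ (fun r => -p 6 r / (2 * r)) (Ioi (rPlus μ a)) :=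
    (hp 6).neg.div (by fun_prop) fun r hr => mul_ne_zero two_ne_zero (rad_pos hμ ha hr).ne'
  obtain ⟨ξ, hξ, hv⟩ := exists_gauge hμ ha hw (hp 1).neg (hp 4).neg
  refine ⟨ξ, _, _, _, hw, (hp 1).neg, (hp 4).neg, hξ, hv, fun x hx => ?_⟩
  have hr := rad_pos hμ ha hx.1
  simp only [Pi.add_apply, Matrix.add_apply, he hx, hv hx, radialGauge]
  simp [modeMatrix]
  field_simp
  ring

/-! ## The residual gauge freedom -/

lemma tr_equator (t r : ℝ) : tr (equator t r) = (t, r) := rfl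

lemma hasDerivAt_snd_of_fderiv {f : ℝ × ℝ → ℝ} {t r : ℝ} (hf : DifferentiableAt ℝ f (t, r)) :
    HasDerivAt (fun s => f (t, s)) (fderiv ℝ f (t, r) (0, 1)) r := by
  have := hf.hasFDerivAt.comp_hasDerivAt r ((hasDerivAt_const r t).prodMk (hasDerivAt_id r))
  exact this

lemma hasDerivAt_fst_of_fderiv {f : ℝ × ℝ → ℝ} {t r : ℝ} (hf : DifferentiableAt ℝ f (t, r)) :
    HasDerivAt (fun s => f (s, r)) (fderiv ℝ f (t, r) (1, 0)) t := by
  have := hf.hasFDerivAt.comp_hasDerivAt t ((hasDerivAt_id t).prodMk (hasDerivAt_const t r))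
  exact this

lemma is_const_of_hasDerivAt_zero {c : ℝ} {f : ℝ → ℝ}
    (hf : ∀ r, c < r → HasDerivAt f 0 r) : ∃ k, ∀ r, c < r → f r = k := by
  obtain ⟨k, hk⟩ := isOpen_Ioi.exists_is_const_of_deriv_eq_zero isPreconnected_Ioi
    (fun r hr => (hf r hr).differentiableAt.differentiableWithinAt) fun r hr => (hf r hr).deriv
  exact ⟨k, fun r hr => hk r hr⟩

lemma eq_add_of_hasDerivAt_const {f : ℝ → ℝ} {k : ℝ} (hf : ∀ t, HasDerivAt f k t) :
    f 1 = f 0 + k := by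
  have h (t : ℝ) : HasDerivAt (fun t => f t - t * k) 0 t := by
    simpa using (hf t).fun_sub ((hasDerivAt_id t).mul_const k)
  have := is_const_of_deriv_eq_zero (fun t => (h t).differentiableAt) (fun t => (h t).deriv) 1 0
  simp at this
  linarith

/-- The condition on `h_{+-}` forces `ξ_r = 0`. Stationarity of `h_{tt}` and `h_{t3}` then makes
`ξ_t` and `ξ_3` affine in `t`, with slopes depending on `r`. The remaining gauge conditions are
linear radial equations for these slopes, solved by a constant vector with lowered index. -/
lemma residual_gauge {μ a : ℝ} (hμ : 0 < μ) (ha : 4 * a ^ 2 < μ) {ξ : CovectorField}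
    (hξ : IsGaugeField μ a ξ) (hs : IsStationaryMode μ a (gaugeVariation (metric μ a) ξ))
    (hg : IsGaugeFixed μ a (gaugeVariation (metric μ a) ξ)) :
    ∃ c₁ c₂ : ℝ, EqOn (gaugeVariation (metric μ a) ξ)
        (c₁ • hg1 μ a + c₂ • hg2 μ a) (exterior μ a) := by
  obtain ⟨u, hu, eu⟩ := hξ
  obtain ⟨P, -, eP⟩ := hs
  have du (i) (t : ℝ) {r : ℝ} (hr : rPlus μ a < r) : DifferentiableAt ℝ (u i) (t, r) :=
    differentiableAt_of_contDiffOn_prod (hu i) hr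
  have key (x : Point) (hx : x ∈ exterior μ a) := gaugeVariation_eq hμ ha hx eu
    fun i => differentiableAt_of_contDiffOn_prod (hu i) hx.1
  have u1 (t r : ℝ) (hr : rPlus μ a < r) : u 1 (t, r) = 0 := by
    have h := (hg _ (equator_mem (t := t) hr)).2.2
    rw [key _ (equator_mem hr), tr_equator] at h
    simp only [gaugeMode, modeMatrix, coef] at h
    have h0 := rad_pos hμ ha hr
    have h1 := Del_pos hμ ha hr
    simpa [equator, h0.ne', h1.ne'] using h
  have u1t (t r : ℝ) (hr : rPlus μ a < r) : fderiv ℝ (u 1) (t, r) (1, 0) = 0 :=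
    (hasDerivAt_fst_of_fderiv (du 1 t hr)).unique
      ((hasDerivAt_const t (0 : ℝ)).congr_of_eventuallyEq
        (Filter.Eventually.of_forall fun s => u1 s r hr))
  have u1r (t r : ℝ) (hr : rPlus μ a < r) : fderiv ℝ (u 1) (t, r) (0, 1) = 0 :=
    (hasDerivAt_snd_of_fderiv (du 1 t hr)).unique
      ((hasDerivAt_const r (0 : ℝ)).congr_of_eventuallyEq
        (Filter.mem_of_superset (Ioi_mem_nhds hr) fun s hs => u1 t s hs))
  have eqs (t r : ℝ) (hr : rPlus μ a < r) := (key _ (equator_mem (t := t) hr)).symm.trans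
    (eP (equator_mem (t := t) hr))
  simp only [gaugeMode, tr_equator, modeMatrix_inj] at eqs
  have e0 (t r : ℝ) (hr : rPlus μ a < r) : fderiv ℝ (u 0) (t, r) (1, 0) = P 0 r / 2 := by
    have := (eqs t r hr).1
    rw [u1 t r hr, show equator t r 1 = r from rfl] at this
    linarith
  have e2 (t r : ℝ) (hr : rPlus μ a < r) : fderiv ℝ (u 2) (t, r) (1, 0) = P 2 r := by
    have := (eqs t r hr).2.2.1
    rw [u1 t r hr, show equator t r 1 = r from rfl] at this
    linarith
  -- The slope in `t` is expressed as a difference between `t = 1` and `t = 0`, so that its radial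
  -- derivative follows from the conditions on `h_{tr}` and `h_{r3}` at these two times, without
  -- mixed second derivatives.
  have A0 (r : ℝ) (hr : rPlus μ a < r) : u 0 (1, r) = u 0 (0, r) + P 0 r / 2 :=
    eq_add_of_hasDerivAt_const (f := fun t => u 0 (t, r)) fun t =>
      e0 t r hr ▸ hasDerivAt_fst_of_fderiv (du 0 t hr)
  have A2 (r : ℝ) (hr : rPlus μ a < r) : u 2 (1, r) = u 2 (0, r) + P 2 r :=
    eq_add_of_hasDerivAt_const (f := fun t => u 2 (t, r)) fun t =>
      e2 t r hr ▸ hasDerivAt_fst_of_fderiv (du 2 t hr)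
  have hfix (t r : ℝ) (hr : rPlus μ a < r) := hg _ (equator_mem (t := t) hr)
  have dA0 (r : ℝ) (hr : rPlus μ a < r) : HasDerivAt (fun r => u 0 (1, r) - u 0 (0, r))
      (2 * (coef μ a r 3 * (P 0 r / 2) + coef μ a r 5 * P 2 r)) r := by
    refine ((hasDerivAt_snd_of_fderiv (du 0 1 hr)).sub
      (hasDerivAt_snd_of_fderiv (du 0 0 hr))).congr_deriv ?_
    have h1 := (hfix 1 r hr).1
    have h2 := (hfix 0 r hr).1
    rw [key _ (equator_mem hr), tr_equator] at h1 h2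
    simp only [gaugeMode, modeMatrix, u1t _ r hr, show ∀ t, equator t r 1 = r from fun _ => rfl]
      at h1 h2
    simp only [Matrix.of_apply, Matrix.cons_val, Matrix.cons_val', A0 r hr, A2 r hr] at h1 h2
    linarith
  have dA2 (r : ℝ) (hr : rPlus μ a < r) : HasDerivAt (fun r => u 2 (1, r) - u 2 (0, r))
      (2 * (coef μ a r 4 * (P 0 r / 2) + coef μ a r 6 * P 2 r)) r := by
    refine ((hasDerivAt_snd_of_fderiv (du 2 1 hr)).sub
      (hasDerivAt_snd_of_fderiv (du 2 0 hr))).congr_deriv ?_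
    have h1 := (hfix 1 r hr).2.1
    have h2 := (hfix 0 r hr).2.1
    rw [key _ (equator_mem hr), tr_equator] at h1 h2
    simp only [gaugeMode, modeMatrix, u1t _ r hr, show ∀ t, equator t r 1 = r from fun _ => rfl]
      at h1 h2
    simp only [Matrix.of_apply, Matrix.cons_val, Matrix.cons_val', A0 r hr, A2 r hr] at h1 h2
    linarith
  have dA (r : ℝ) (hr : rPlus μ a < r) : HasDerivAt (fun r => P 0 r / 2)
      (2 * (coef μ a r 3 * (P 0 r / 2) + coef μ a r 5 * P 2 r)) r :=
    (dA0 r hr).congr_of_eventuallyEq (Filter.mem_of_superset (Ioi_mem_nhds hr) fun s hs => by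
      simp [A0 s hs])
  have dB (r : ℝ) (hr : rPlus μ a < r) : HasDerivAt (fun r => P 2 r)
      (2 * (coef μ a r 4 * (P 0 r / 2) + coef μ a r 6 * P 2 r)) r :=
    (dA2 r hr).congr_of_eventuallyEq (Filter.mem_of_superset (Ioi_mem_nhds hr) fun s hs => by
      simp [A2 s hs])
  -- The index of the slope covector `(P 0 / 2, P 2)` is raised; `c₁` and `c₂` are the resulting `t`
  -- and `3` components.
  obtain ⟨c₁, h₁⟩ := is_const_of_hasDerivAt_zero (c := rPlus μ a)
    (f := fun r => (-(r ^ 4 + μ * a ^ 2) * (P 0 r / 2) - μ * a * P 2 r) / Del μ a r)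
    fun r hr => by
      have h0 := rad_pos hμ ha hr
      have hD := Del_pos hμ ha hr
      refine ((((((hasDerivAt_pow 4 r).add_const (μ * a ^ 2)).neg.mul (dA r hr)).sub
        ((dB r hr).const_mul (μ * a))).div (hasDerivAt_Del μ a r) hD.ne')).congr_deriv ?_
      have hDu : Del μ a r = r ^ 4 - μ * r ^ 2 + μ * a ^ 2 := rfl
      simp [coef, hD.ne']
      field_simp
      rw [hDu]
      ring
  obtain ⟨c₂, h₂⟩ := is_const_of_hasDerivAt_zero (c := rPlus μ a)
    (f := fun r => (-(μ * a * (P 0 r / 2)) + (r ^ 2 - μ) * P 2 r) / Del μ a r)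
    fun r hr => by
      have h0 := rad_pos hμ ha hr
      have hD := Del_pos hμ ha hr
      refine (((((dA r hr).const_mul (μ * a)).neg.add
        (((hasDerivAt_pow 2 r).sub_const μ).mul (dB r hr))).div (hasDerivAt_Del μ a r)
          hD.ne')).congr_deriv ?_
      have hDu : Del μ a r = r ^ 4 - μ * r ^ 2 + μ * a ^ 2 := rfl
      simp [coef, hD.ne']
      field_simp
      rw [hDu]
      ring
  refine ⟨c₁, c₂, fun x hx => ?_⟩
  have hr := rad_pos hμ ha hx.1
  have hD := Del_pos hμ ha hx.1
  have hDu : Del μ a (x 1) = x 1 ^ 4 - μ * x 1 ^ 2 + μ * a ^ 2 := rfl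
  rw [key x hx, Pi.add_apply, Pi.smul_apply, Pi.smul_apply, hg1, hg2, smul_modeMatrix,
    smul_modeMatrix, modeMatrix_add, gaugeMode, modeMatrix_inj]
  have htr := (hg x hx).1
  have hr3 := (hg x hx).2.1
  rw [key x hx] at htr hr3
  simp only [gaugeMode, modeMatrix, Matrix.of_apply, Matrix.cons_val, Matrix.cons_val'] at htr hr3
  have hc₁ := h₁ _ hx.1
  have hc₂ := h₂ _ hx.1
  have q0 := e0 (x 0) _ hx.1
  have q1 := u1 (x 0) _ hx.1
  have q2 := e2 (x 0) _ hx.1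
  have q3 := u1r (x 0) _ hx.1
  simp only [tr] at *
  rw [q0, q1, q2, q3, ← hc₁, ← hc₂]
  refine ⟨?_, by simpa using htr, ?_, by simp, by simpa using hr3, by simp, by simp⟩
  · field_simp
    rw [hDu]
    ring
  · field_simp
    rw [hDu]
    ring

lemma lower_metric (μ a b c : ℝ) (x : Point) :
    lower (metric μ a) (fun y => ![b * y 0, 0, 0, 0, c * y 0]) x
      = ![x 0 * (b * (-1 + μ / x 1 ^ 2) - c * (μ * a / x 1 ^ 2)), 0, 0, 0,
          x 0 * (c * (x 1 ^ 2 + μ * a ^ 2 / x 1 ^ 2) - b * (μ * a / x 1 ^ 2))] := by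
  ext i
  fin_cases i <;>
    simp [lower, metric, modeMatrix, Matrix.mulVec, dotProduct, Fin.sum_univ_five] <;> ring

lemma isGaugeField_lower {μ a : ℝ} (hμ : 0 < μ) (ha : 4 * a ^ 2 < μ) (b c : ℝ) :
    IsGaugeField μ a (lower (metric μ a) (fun y => ![b * y 0, 0, 0, 0, c * y 0])) := by
  refine ⟨![fun z => z.1 * (b * (-1 + μ / z.2 ^ 2) - c * (μ * a / z.2 ^ 2)), fun _ => 0,
    fun z => z.1 * (c * (z.2 ^ 2 + μ * a ^ 2 / z.2 ^ 2) - b * (μ * a / z.2 ^ 2))], fun i => ?_,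
    fun x _ => lower_metric μ a b c x⟩
  have h (k : ℝ) : ContDiffOn ℝ ∞ (fun z : ℝ × ℝ => k / z.2 ^ 2) (univ ×ˢ Ioi (rPlus μ a)) :=
    contDiffOn_const.div (by fun_prop) fun z hz => pow_ne_zero 2 (rad_pos hμ ha hz.2).ne'
  fin_cases i
  · exact contDiff_fst.contDiffOn.mul ((contDiffOn_const.mul (contDiffOn_const.add (h μ))).sub
      (contDiffOn_const.mul (h _)))
  · exact contDiffOn_const
  · exact contDiff_fst.contDiffOn.mul ((contDiffOn_const.mul
      ((contDiff_snd.pow 2).contDiffOn.add (h _))).sub (contDiffOn_const.mul (h _)))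

/-- Since `∂_t` and `σ̄_3` are Killing fields, multiplying them by `t` leaves only terms containing
`dt`, and these give the two residual modes. -/
lemma gaugeVariation_lower {μ a : ℝ} (hμ : 0 < μ) (ha : 4 * a ^ 2 < μ) (b c : ℝ) :
    EqOn (gaugeVariation (metric μ a) (lower (metric μ a) (fun y => ![b * y 0, 0, 0, 0, c * y 0])))
      (b • hg1 μ a + c • hg2 μ a) (exterior μ a) := by
  intro x hx
  have hr := rad_pos hμ ha hx.1
  have hD := Del_pos hμ ha hx.1
  have hDu : Del μ a (x 1) = x 1 ^ 4 - μ * x 1 ^ 2 + μ * a ^ 2 := rfl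
  have dF {F : ℝ → ℝ} {F' : ℝ} (hF : HasDerivAt F F' (x 1)) :
      HasFDerivAt (fun z : ℝ × ℝ => z.1 * F z.2)
        (x 0 • F' • ContinuousLinearMap.snd ℝ ℝ ℝ + F (x 1) • ContinuousLinearMap.fst ℝ ℝ ℝ)
        (tr x) :=
    hasFDerivAt_fst.mul (hF.comp_hasFDerivAt (x 0, x 1) hasFDerivAt_snd)
  have d0 := dF ((((hasDerivAt_const_div_pow μ 2 hr.ne').const_add (-1)).const_mul b).sub
    ((hasDerivAt_const_div_pow (μ * a) 2 hr.ne').const_mul c))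
  have d2 := dF ((((hasDerivAt_pow 2 (x 1)).add
    (hasDerivAt_const_div_pow (μ * a ^ 2) 2 hr.ne')).const_mul c).sub
    ((hasDerivAt_const_div_pow (μ * a) 2 hr.ne').const_mul b))
  rw [gaugeVariation_eq hμ ha hx
    (p := ![fun z => z.1 * (b * (-1 + μ / z.2 ^ 2) - c * (μ * a / z.2 ^ 2)), fun _ => 0,
    fun z => z.1 * (c * (z.2 ^ 2 + μ * a ^ 2 / z.2 ^ 2) - b * (μ * a / z.2 ^ 2))])
    (fun y _ => lower_metric μ a b c y) (fun i => by
      fin_cases i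
      exacts [d0.differentiableAt, differentiableAt_const 0, d2.differentiableAt]),
    Pi.add_apply, Pi.smul_apply, Pi.smul_apply, hg1, hg2, smul_modeMatrix,
    smul_modeMatrix, modeMatrix_add, gaugeMode, modeMatrix_inj]
  have f0 := d0.fderiv
  have f2 := d2.fderiv
  simp only [Pi.sub_apply, Pi.add_apply, tr] at f0 f2
  simp [f0, f2, tr, coef]
  generalize x 1 = r at *
  refine ⟨?_, ?_, ?_, ?_⟩
  · ring
  · field_simp
    rw [hDu]
    ring
  · field_simp
    try ring
  · field_simp
    rw [hDu]
    ring

/-! ## The six solutions -/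

/-- The Laurent polynomial `k₀ / r² + k₁ + k₂ r² + k₃ r⁴`. -/
def laurent (k : Fin 4 → ℝ) (r : ℝ) : ℝ := k 0 / r ^ 2 + k 1 + k 2 * r ^ 2 + k 3 * r ^ 4

/-- The derivative of `laurent`. -/
def laurent₁ (k : Fin 4 → ℝ) (r : ℝ) : ℝ := -(2 * k 0 / r ^ 3) + 2 * k 2 * r + 4 * k 3 * r ^ 3

/-- The second derivative of `laurent`. -/
def laurent₂ (k : Fin 4 → ℝ) (r : ℝ) : ℝ := 6 * k 0 / r ^ 4 + 2 * k 2 + 12 * k 3 * r ^ 2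

lemma hasDerivAt_laurent (k : Fin 4 → ℝ) {r : ℝ} (hr : r ≠ 0) :
    HasDerivAt (laurent k) (laurent₁ k r) r := by
  refine ((((hasDerivAt_const_div_pow (k 0) 2 hr).add_const (k 1)).add
    ((hasDerivAt_pow 2 r).const_mul (k 2))).add
      ((hasDerivAt_pow 4 r).const_mul (k 3))).congr_deriv ?_
  simp [laurent₁]
  ring

lemma hasDerivAt_laurent₁ (k : Fin 4 → ℝ) {r : ℝ} (hr : r ≠ 0) :
    HasDerivAt (laurent₁ k) (laurent₂ k r) r := by
  refine (((hasDerivAt_const_div_pow (2 * k 0) 3 hr).neg.add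
    ((hasDerivAt_id r).const_mul (2 * k 2))).add
      ((hasDerivAt_pow 3 r).const_mul (4 * k 3))).congr_deriv ?_
  simp [laurent₂]
  ring

lemma logN_args_pos {μ a r : ℝ} (hμ : 0 < μ) (ha : 4 * a ^ 2 < μ) (hr : rPlus μ a < r) :
    0 < r ^ 2 - μ / 2 - D μ a ∧ 0 < r ^ 2 - μ / 2 + D μ a := by
  have := sq_gt hμ ha hr
  have := D_pos hμ ha
  constructor <;> linarith

lemma Del_factor {μ a : ℝ} (r : ℝ) (hμ : 0 < μ) (ha : 4 * a ^ 2 < μ) :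
    (r ^ 2 - μ / 2 - D μ a) * (r ^ 2 - μ / 2 + D μ a) = Del μ a r := by
  have := D_sq hμ ha
  rw [Del]
  linear_combination -this

lemma hasDerivAt_logN {μ a r : ℝ} (hμ : 0 < μ) (ha : 4 * a ^ 2 < μ) (hr : rPlus μ a < r) :
    HasDerivAt (logN μ a) (4 * D μ a * r / Del μ a r) r := by
  obtain ⟨h1, h2⟩ := logN_args_pos hμ ha hr
  have d1 := (((hasDerivAt_pow 2 r).sub_const (μ / 2)).sub_const (D μ a)).div
    (((hasDerivAt_pow 2 r).sub_const (μ / 2)).add_const (D μ a)) h2.ne'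
  refine (d1.log (div_ne_zero h1.ne' h2.ne')).congr_deriv ?_
  rw [← Del_factor r hμ ha]
  simp only [Pi.div_apply, Nat.cast_ofNat]
  field_simp
  ring

lemma contDiffOn_laurent {μ a : ℝ} (hμ : 0 < μ) (ha : 4 * a ^ 2 < μ) (k : Fin 4 → ℝ) :
    ContDiffOn ℝ ∞ (laurent k) (Ioi (rPlus μ a)) :=
  (((contDiffOn_const_div_pow hμ ha _ 2).add contDiffOn_const).add (by fun_prop)).add (by fun_prop)

lemma contDiffOn_logN {μ a : ℝ} (hμ : 0 < μ) (ha : 4 * a ^ 2 < μ) :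
    ContDiffOn ℝ ∞ (logN μ a) (Ioi (rPlus μ a)) :=
  (ContDiffOn.div (by fun_prop) (by fun_prop) fun r hr => (logN_args_pos hμ ha hr).2.ne').log
    fun r hr => (div_pos (logN_args_pos hμ ha hr).1 (logN_args_pos hμ ha hr).2).ne'

/-- The function with coefficients `k`: a Laurent polynomial plus one times the logarithm. -/
def logFun (μ a : ℝ) (k : Fin 2 → Fin 4 → ℝ) (r : ℝ) : ℝ :=
  laurent (k 0) r + laurent (k 1) r * logN μ a r

/-- The derivative of `logFun`. -/
def logFun₁ (μ a : ℝ) (k : Fin 2 → Fin 4 → ℝ) (r : ℝ) : ℝ :=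
  laurent₁ (k 0) r + laurent₁ (k 1) r * logN μ a r + laurent (k 1) r * (4 * D μ a * r / Del μ a r)

/-- The second derivative of `logFun`. -/
def logFun₂ (μ a : ℝ) (k : Fin 2 → Fin 4 → ℝ) (r : ℝ) : ℝ :=
  laurent₂ (k 0) r + laurent₂ (k 1) r * logN μ a r
    + 2 * laurent₁ (k 1) r * (4 * D μ a * r / Del μ a r)
    + laurent (k 1) r * (4 * D μ a / Del μ a r
      - 4 * D μ a * r * (4 * r ^ 3 - 2 * μ * r) / Del μ a r ^ 2)

lemma hasDerivAt_logFun {μ a r : ℝ} (hμ : 0 < μ) (ha : 4 * a ^ 2 < μ) (k : Fin 2 → Fin 4 → ℝ)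
    (hr : rPlus μ a < r) : HasDerivAt (logFun μ a k) (logFun₁ μ a k r) r := by
  have h0 := (rad_pos hμ ha hr).ne'
  refine ((hasDerivAt_laurent (k 0) h0).add ((hasDerivAt_laurent (k 1) h0).mul
    (hasDerivAt_logN hμ ha hr))).congr_deriv ?_
  rw [logFun₁]
  ring

lemma hasDerivAt_logFun₁ {μ a r : ℝ} (hμ : 0 < μ) (ha : 4 * a ^ 2 < μ) (k : Fin 2 → Fin 4 → ℝ)
    (hr : rPlus μ a < r) : HasDerivAt (logFun₁ μ a k) (logFun₂ μ a k r) r := by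
  have h0 := (rad_pos hμ ha hr).ne'
  have hD := (Del_pos hμ ha hr).ne'
  refine (((hasDerivAt_laurent₁ (k 0) h0).add ((hasDerivAt_laurent₁ (k 1) h0).mul
    (hasDerivAt_logN hμ ha hr))).add ((hasDerivAt_laurent (k 1) h0).mul
      (((hasDerivAt_id r).const_mul (4 * D μ a)).div (hasDerivAt_Del μ a r) hD))).congr_deriv ?_
  rw [logFun₂]
  simp only [Pi.div_apply, id]
  field_simp
  ring

lemma contDiffOn_logFun {μ a : ℝ} (hμ : 0 < μ) (ha : 4 * a ^ 2 < μ) (k : Fin 2 → Fin 4 → ℝ) :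
    ContDiffOn ℝ ∞ (logFun μ a k) (Ioi (rPlus μ a)) :=
  (contDiffOn_laurent hμ ha _).add ((contDiffOn_laurent hμ ha _).mul (contDiffOn_logN hμ ha))

/-- The coefficients of the components `tt`, `t3`, `rr` (without the factor `r⁶ / Δ²`) and `33`
of a combination of the six tensors. -/
def combCoef (μ a : ℝ) (c : Fin 6 → ℝ) : Fin 4 → Fin 2 → Fin 4 → ℝ :=
  ![![![2 * μ * c 0 - 2 * μ * a * c 1 + c 2 - μ ^ 2 / 2 * c 4,
        -(2 * c 0) + μ * c 4 - 3 * D μ a * c 5, 0, 0],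
      ![-(μ * (μ - 4 * a ^ 2) / 8 * c 5), (μ - 4 * a ^ 2) / 4 * c 5, 0, 0]],
    ![![-(μ * a * c 0) + μ * a ^ 2 * c 1 - a * c 2 - c 3 + μ ^ 2 * a / 2 * c 4,
        -(μ * a * c 4) + 3 * a * D μ a / 2 * c 5, c 1, 0],
      ![μ * a * (μ + 2 * a ^ 2) / 8 * c 5, -(3 * μ * a / 4 * c 5), 3 * a / 4 * c 5, 0]],
    ![![-(a ^ 2 * c 2) - 2 * a * c 3 + μ ^ 2 * a ^ 2 / 2 * c 4,
        c 2 - 3 * μ * a ^ 2 * c 4 - 2 * D μ a * (μ - a ^ 2) * c 5,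
        3 * μ / 2 * c 4 - 3 / 2 * D μ a * c 5, -c 4],
      ![μ * a ^ 2 * (μ + 8 * a ^ 2) / 8 * c 5, -(μ * (μ + 5 * a ^ 2) / 4 * c 5),
        9 * μ / 8 * c 5, -(3 / 4 * c 5)]],
    ![![a ^ 2 * c 2 + 2 * a * c 3 - μ ^ 2 * a ^ 2 / 2 * c 4, μ * a ^ 2 * c 4,
        μ / 2 * c 4 - 3 / 2 * D μ a * c 5, -c 4],
      ![-(μ * a ^ 2 * (μ + 8 * a ^ 2) / 8 * c 5), 3 * μ * a ^ 2 / 4 * c 5, 3 * μ / 8 * c 5,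
        -(3 / 4 * c 5)]]]

/-- The components of a combination of the six tensors. -/
def combProfile (μ a : ℝ) (c : Fin 6 → ℝ) (r : ℝ) : Fin 7 → ℝ :=
  ![logFun μ a (combCoef μ a c 0) r, 0, logFun μ a (combCoef μ a c 1) r,
    r ^ 6 * logFun μ a (combCoef μ a c 2) r / Del μ a r ^ 2, 0, logFun μ a (combCoef μ a c 3) r, 0]

/-- The derivatives of the components of a combination of the six tensors. -/
def combProfile₁ (μ a : ℝ) (c : Fin 6 → ℝ) (r : ℝ) : Fin 7 → ℝ :=
  ![logFun₁ μ a (combCoef μ a c 0) r, 0, logFun₁ μ a (combCoef μ a c 1) r,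
    (r ^ 6 * logFun₁ μ a (combCoef μ a c 2) r + 6 * r ^ 5 * logFun μ a (combCoef μ a c 2) r)
        / Del μ a r ^ 2
      - 2 * r ^ 6 * logFun μ a (combCoef μ a c 2) r * (4 * r ^ 3 - 2 * μ * r) / Del μ a r ^ 3, 0,
    logFun₁ μ a (combCoef μ a c 3) r, 0]

/-- The second derivatives of the components of a combination of the six tensors. -/
def combProfile₂ (μ a : ℝ) (c : Fin 6 → ℝ) (r : ℝ) : Fin 7 → ℝ :=
  ![logFun₂ μ a (combCoef μ a c 0) r, 0, logFun₂ μ a (combCoef μ a c 1) r,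
    deriv (fun s => combProfile₁ μ a c s 3) r, 0, logFun₂ μ a (combCoef μ a c 3) r, 0]

lemma comb_apply (μ a : ℝ) (c : Fin 6 → ℝ) (x : Point) :
    comb μ a c x = c 0 • hg1 μ a x + c 1 • hg2 μ a x + c 2 • hmd μ a x + c 3 • hsd μ a x
      + c 4 • hsq μ a x + c 5 • hsi μ a x := by
  simp [comb, basisTensor, Fin.sum_univ_six]

lemma comb_eqOn {μ a : ℝ} (hμ : 0 < μ) (ha : 4 * a ^ 2 < μ) (c : Fin 6 → ℝ) :
    EqOn (comb μ a c) (fun x => radialMode (combProfile μ a c (x 1))) (exterior μ a) := by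
  intro x hx
  have hr := rad_pos hμ ha hx.1
  have hD := Del_pos hμ ha hx.1
  rw [comb_apply]
  simp only [hg1, hg2, hmd, hsd, hsq, hsi, smul_modeMatrix, modeMatrix_add, G_eq hr, D_sq hμ ha,
    radialMode, modeMatrix_inj]
  generalize x 1 = r at *
  simp only [combProfile, combCoef, logFun, laurent, Matrix.cons_val]
  refine ⟨?_, by ring, ?_, ?_, by ring, ?_, by ring⟩
  · field_simp
    ring
  · field_simp
    ring
  · field_simp
    simp only [Del]
    ring
  · field_simp
    ring

/-- No formula for the second derivative of the `rr` component is required, because it never enters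
the field equations; its existence follows from smoothness. -/
lemma hasProfile_comb {μ a : ℝ} (hμ : 0 < μ) (ha : 4 * a ^ 2 < μ) (c : Fin 6 → ℝ) :
    HasProfile μ a (comb μ a c) (combProfile μ a c) (combProfile₁ μ a c)
      (combProfile₂ μ a c) := by
  have hDs : ContDiffOn ℝ ∞ (fun r => Del μ a r ^ 2) (Ioi (rPlus μ a)) :=
    ((contDiff_Del μ a).pow 2).contDiffOn
  have h3 : ContDiffOn ℝ ∞ (fun r => combProfile μ a c r 3) (Ioi (rPlus μ a)) :=
    ((contDiff_id.pow 6).contDiffOn.mul (contDiffOn_logFun hμ ha _)).div hDs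
      fun r hr => pow_ne_zero 2 (Del_pos hμ ha hr).ne'
  have d3 (r : ℝ) (hr : rPlus μ a < r) : HasDerivAt (fun r => combProfile μ a c r 3)
      (combProfile₁ μ a c r 3) r := by
    have hD := (Del_pos hμ ha hr).ne'
    refine (((hasDerivAt_pow 6 r).mul (hasDerivAt_logFun hμ ha (combCoef μ a c 2) hr)).div
      ((hasDerivAt_Del μ a r).pow 2) (pow_ne_zero 2 hD)).congr_deriv ?_
    simp [combProfile₁]
    field_simp
    ring
  refine ⟨fun i => ?_, comb_eqOn hμ ha c, fun r hr i => ?_, fun r hr i => ?_⟩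
  · fin_cases i
    exacts [contDiffOn_logFun hμ ha _, contDiffOn_const, contDiffOn_logFun hμ ha _, h3,
      contDiffOn_const, contDiffOn_logFun hμ ha _, contDiffOn_const]
  · fin_cases i
    exacts [hasDerivAt_logFun hμ ha _ hr, hasDerivAt_const _ _, hasDerivAt_logFun hμ ha _ hr,
      d3 r hr, hasDerivAt_const _ _, hasDerivAt_logFun hμ ha _ hr, hasDerivAt_const _ _]
  · have h3' : ContDiffOn ℝ ∞ (fun r => combProfile₁ μ a c r 3) (Ioi (rPlus μ a)) :=
      ((contDiffOn_infty_iff_deriv_of_isOpen isOpen_Ioi).1 h3).2.congr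
        fun s hs => (d3 s hs).deriv.symm
    fin_cases i
    exacts [hasDerivAt_logFun₁ hμ ha _ hr, hasDerivAt_const _ _, hasDerivAt_logFun₁ hμ ha _ hr,
      (differentiableAt_of_contDiffOn_Ioi h3' hr).hasDerivAt, hasDerivAt_const _ _,
      hasDerivAt_logFun₁ hμ ha _ hr, hasDerivAt_const _ _]

set_option maxHeartbeats 4000000 in
-- Because `combCoef` has already eliminated `D²`, the logarithm and `D` can be replaced by free
-- variables, and the field equations become rational identities.
lemma ricciMode_comb {μ a r : ℝ} (hr : 0 < r) (hD : 0 < Del μ a r) (c : Fin 6 → ℝ) :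
    ricciMode μ a r (combProfile μ a c r) (combProfile₁ μ a c r) (combProfile₂ μ a c r) = 0 := by
  have h0 : (0 : Matrix (Fin 5) (Fin 5) ℝ) = modeMatrix 0 0 0 0 0 0 0 := by
    ext i j
    fin_cases i <;> fin_cases j <;> rfl
  rw [h0, ricciMode, modeMatrix_inj]
  simp only [combProfile, combProfile₁, combProfile₂, logFun, logFun₁, logFun₂, laurent, laurent₁,
    laurent₂, combCoef, Matrix.cons_val]
  generalize logN μ a r = L
  generalize D μ a = δ
  have hDu : Del μ a r = r ^ 4 - μ * r ^ 2 + μ * a ^ 2 := rfl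
  generalize Del μ a r = d at *
  refine ⟨?_, trivial, ?_, ?_, trivial, ?_, ?_⟩
  · field_simp
    rw [hDu]
    ring
  · field_simp
    rw [hDu]
    ring
  · field_simp
    rw [hDu]
    ring
  · field_simp
    rw [hDu]
    ring
  · field_simp
    rw [hDu]
    ring

/-! ## Initial data of the six solutions -/

lemma combCoef_add_smul (μ a t : ℝ) (c c' : Fin 6 → ℝ) :
    combCoef μ a (c + t • c') = combCoef μ a c + t • combCoef μ a c' := by
  funext i j k
  fin_cases i <;> fin_cases j <;> fin_cases k <;>
    simp only [combCoef, Fin.isValue, Fin.zero_eta, Fin.mk_one, Fin.reduceFinMk, Matrix.cons_val,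
      Pi.add_apply, Pi.smul_apply, smul_eq_mul] <;> ring

lemma logFun_add_smul (μ a t : ℝ) (k k' : Fin 2 → Fin 4 → ℝ) (r : ℝ) :
    logFun μ a (k + t • k') r = logFun μ a k r + t * logFun μ a k' r := by
  simp only [logFun, laurent, Pi.add_apply, Pi.smul_apply, smul_eq_mul]
  ring

lemma logFun₁_add_smul (μ a t : ℝ) (k k' : Fin 2 → Fin 4 → ℝ) (r : ℝ) :
    logFun₁ μ a (k + t • k') r = logFun₁ μ a k r + t * logFun₁ μ a k' r := by
  simp only [logFun₁, laurent, laurent₁, Pi.add_apply, Pi.smul_apply, smul_eq_mul]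
  ring

lemma combProfile_add_smul (μ a t : ℝ) (c c' : Fin 6 → ℝ) (r : ℝ) :
    combProfile μ a (c + t • c') r = combProfile μ a c r + t • combProfile μ a c' r := by
  simp only [combProfile, combCoef_add_smul, Pi.add_apply, Pi.smul_apply, logFun_add_smul,
    Matrix.smul_cons, Matrix.cons_add_cons, Matrix.smul_empty, Matrix.empty_add_empty, smul_eq_mul,
    mul_zero, add_zero]
  congr 4
  ring

lemma combProfile₁_add_smul (μ a t : ℝ) (c c' : Fin 6 → ℝ) (r : ℝ) :
    combProfile₁ μ a (c + t • c') r = combProfile₁ μ a c r + t • combProfile₁ μ a c' r := by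
  simp only [combProfile₁, combCoef_add_smul, Pi.add_apply, Pi.smul_apply, logFun_add_smul,
    logFun₁_add_smul, Matrix.smul_cons, Matrix.cons_add_cons, Matrix.smul_empty,
    Matrix.empty_add_empty, smul_eq_mul, mul_zero, add_zero]
  congr 4
  ring

/-- The values and first derivatives at `r` of the components `tt`, `t3`, `33`. -/
def dataVec (p q : Fin 7 → ℝ) : Fin 6 → ℝ := ![p 0, p 2, p 5, q 0, q 2, q 5]

lemma dataVec_add_smul (t : ℝ) (p q p' q' : Fin 7 → ℝ) :
    dataVec (p + t • p') (q + t • q') = dataVec p q + t • dataVec p' q' := by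
  simp [dataVec]

/-- The initial data at `r` of the combinations of the six tensors. -/
def initialData (μ a r : ℝ) : (Fin 6 → ℝ) →ₗ[ℝ] (Fin 6 → ℝ) where
  toFun c := dataVec (combProfile μ a c r) (combProfile₁ μ a c r)
  map_add' c c' := by
    have := dataVec_add_smul 1 (combProfile μ a c r) (combProfile₁ μ a c r)
      (combProfile μ a c' r) (combProfile₁ μ a c' r)
    rwa [← combProfile_add_smul, ← combProfile₁_add_smul, one_smul, one_smul] at this
  map_smul' t c := by
    have h (c : Fin 6 → ℝ) : combProfile μ a (t • c) r = t • combProfile μ a c r := by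
      have h0 := combProfile_add_smul μ a (-1) 0 0 r
      have h1 := combProfile_add_smul μ a t 0 c r
      simp at h0 h1
      rw [h1, h0, zero_add]
    have h' (c : Fin 6 → ℝ) : combProfile₁ μ a (t • c) r = t • combProfile₁ μ a c r := by
      have h0 := combProfile₁_add_smul μ a (-1) 0 0 r
      have h1 := combProfile₁_add_smul μ a t 0 c r
      simp at h0 h1
      rw [h1, h0, zero_add]
    rw [h, h']
    simp [dataVec]

/-- Suitable combinations of the data isolate a two-by-two system for the coefficients of `hsq` and
`hsi`. Its determinant is a non-zero multiple of `(μ - 4 a²)² (3 r⁴ - μ a²)`, positive outside the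
horizon. The other four coefficients follow one after another. -/
lemma initialData_injective {μ a r : ℝ} (hμ : 0 < μ) (ha : 4 * a ^ 2 < μ)
    (hr : rPlus μ a < r) : Function.Injective (initialData μ a r) := by
  rw [injective_iff_map_eq_zero]
  intro c hc
  have h0 := rad_pos hμ ha hr
  have hD := Del_pos hμ ha hr
  have hδ := D_pos hμ ha
  have hu := sq_gt hμ ha hr
  have hDu : Del μ a r = r ^ 4 - μ * r ^ 2 + μ * a ^ 2 := rfl
  have e0 : combProfile μ a c r 0 = 0 := congrFun hc 0
  have e1 : combProfile μ a c r 2 = 0 := congrFun hc 1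
  have e2 : combProfile μ a c r 5 = 0 := congrFun hc 2
  have e3 : combProfile₁ μ a c r 0 = 0 := congrFun hc 3
  have e4 : combProfile₁ μ a c r 2 = 0 := congrFun hc 4
  have e5 : combProfile₁ μ a c r 5 = 0 := congrFun hc 5
  set L := logN μ a r with hL
  set δ := D μ a with hδ'
  -- The operator `1 + (r/2) d/dr` annihilates `1/r²`, so it removes the mass and spin shifts from
  -- every component.
  have F1 : -2 * c 0 + μ * c 4 - 3 * δ * c 5 + c 5 * L * (μ - 4 * a ^ 2) / 4
      + c 5 * δ / Del μ a r * (μ - 4 * a ^ 2) / 4 * (2 * r ^ 2 - μ)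
      = combProfile μ a c r 0 + r / 2 * combProfile₁ μ a c r 0 := by
    simp only [combProfile, combProfile₁, combCoef, logFun, logFun₁, laurent, laurent₁,
      Matrix.cons_val, ← hL, ← hδ']
    field_simp
    ring
  have F2 : 2 * r ^ 2 * c 1 - μ * a * c 4 + 3 * a * δ / 2 * c 5
      + c 5 * L * (-3 * μ * a / 4 + 3 * a / 2 * r ^ 2)
      + c 5 * δ / Del μ a r * (μ * a * (μ + 2 * a ^ 2) / 4 - 3 * μ * a / 2 * r ^ 2
        + 3 * a / 2 * r ^ 4)
      = combProfile μ a c r 2 + r / 2 * combProfile₁ μ a c r 2 := by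
    simp only [combProfile, combProfile₁, combCoef, logFun, logFun₁, laurent, laurent₁,
      Matrix.cons_val, ← hL, ← hδ']
    field_simp
    ring
  have F3 : (-3 * r ^ 4 + μ * r ^ 2 + μ * a ^ 2) * (c 4 + 3 / 4 * L * c 5)
      + c 5 * δ / Del μ a r * (-9 / 2 * r ^ 6 + 15 * μ / 4 * r ^ 4 - 3 * μ * a ^ 2 / 2 * r ^ 2
        - μ * a ^ 2 * (μ + 8 * a ^ 2) / 4)
      = combProfile μ a c r 5 + r / 2 * combProfile₁ μ a c r 5 := by
    simp only [combProfile, combProfile₁, combCoef, logFun, logFun₁, laurent, laurent₁,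
      Matrix.cons_val, ← hL, ← hδ']
    field_simp
    rw [hDu]
    ring
  -- The contraction `h_{33} + 2 a h_{t3} + a² h_{tt}` is blind to `hmd` and `hsd`; the subtracted
  -- multiples of the left sides of `F1` and `F2` cancel what `hg1` and `hg2` contribute.
  have F5 : (-r ^ 4 + μ / 2 * r ^ 2) * (c 4 + 3 / 4 * L * c 5)
      + c 5 * δ / Del μ a r * r ^ 2 * (-3 / 2 * r ^ 4 + 3 * μ / 2 * r ^ 2 - 2 * μ * a ^ 2
        + 2 * a ^ 4)
      = combProfile μ a c r 5 + 2 * a * combProfile μ a c r 2 + a ^ 2 * combProfile μ a c r 0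
        - a ^ 2 * (combProfile μ a c r 0 + r / 2 * combProfile₁ μ a c r 0)
        - a * (combProfile μ a c r 2 + r / 2 * combProfile₁ μ a c r 2) := by
    simp only [combProfile, combProfile₁, combCoef, logFun, logFun₁, laurent, laurent₁,
      Matrix.cons_val, ← hL, ← hδ']
    field_simp
    rw [hDu]
    ring
  rw [e0, e3] at F1
  rw [e1, e4] at F2
  rw [e2, e5] at F3
  rw [e0, e1, e2, e3, e4] at F5
  have hu2 : μ / 2 < r ^ 2 := by linarith
  have h3 : 0 < 3 * r ^ 4 - μ * a ^ 2 := by nlinarith [sq_nonneg a]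
  have h4 : -3 * r ^ 4 + μ * r ^ 2 + μ * a ^ 2 < 0 := by nlinarith [sq_nonneg a]
  -- Both `F3` and `F5` contain `c 4` only through `c 4 + (3/4) L c 5`; eliminating it leaves the
  -- determinant times `c 5`.
  have hdet : c 5 * (δ / Del μ a r * (r ^ 2 / 8 * (μ - 4 * a ^ 2) ^ 2
      * (3 * r ^ 4 - μ * a ^ 2))) = 0 := by
    linear_combination (-r ^ 4 + μ / 2 * r ^ 2) * F3
      - (-3 * r ^ 4 + μ * r ^ 2 + μ * a ^ 2) * F5
  have hm : 0 < μ - 4 * a ^ 2 := by linarith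
  have c5 : c 5 = 0 := (mul_eq_zero.1 hdet).resolve_right (by positivity)
  rw [c5] at F1 F2 F3
  have c4 : c 4 = 0 := by
    have : (-3 * r ^ 4 + μ * r ^ 2 + μ * a ^ 2) * c 4 = 0 := by linear_combination F3
    exact (mul_eq_zero.1 this).resolve_left h4.ne
  rw [c4] at F1 F2
  have c0 : c 0 = 0 := by linear_combination (-1 / 2) * F1
  have c1 : c 1 = 0 := by
    have : r ^ 2 * c 1 = 0 := by linear_combination (1 / 2) * F2
    exact (mul_eq_zero.1 this).resolve_left (by positivity)
  simp only [combProfile, combCoef, logFun, laurent, Matrix.cons_val, c0, c1, c4, c5] at e0 e1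
  have c2 : c 2 = 0 := by
    simpa [h0.ne'] using e0
  have c3 : c 3 = 0 := by
    simpa [h0.ne', c2] using e1
  ext i
  fin_cases i <;> assumption

/-- An injective endomorphism of a six-dimensional space is onto. -/
lemma exists_initialData {μ a r : ℝ} (hμ : 0 < μ) (ha : 4 * a ^ 2 < μ)
    (hr : rPlus μ a < r) (y : Fin 6 → ℝ) : ∃ c, initialData μ a r c = y :=
  LinearMap.injective_iff_surjective.1 (initialData_injective hμ ha hr) y

/-! ## Uniqueness -/

/-- A solution of a linear differential equation with vanishing initial value vanishes. -/
lemma eq_zero_of_linear_ode {n : ℕ} {c r₀ : ℝ} {V : ℝ → (Fin n → ℝ) → (Fin n → ℝ)}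
    (hadd : ∀ (r t : ℝ) (y z : Fin n → ℝ), V r (y + t • z) = V r y + t • V r z)
    (hcont : ∀ y, ContinuousOn (fun r => V r y) (Ioi c)) {y : ℝ → Fin n → ℝ}
    (hy : ∀ r, c < r → HasDerivAt y (V r (y r)) r) (hr₀ : c < r₀) (h0 : y r₀ = 0) {r : ℝ}
    (hr : c < r) : y r = 0 := by
  have hV0 (r : ℝ) : V r 0 = 0 := by
    have := hadd r (-1) 0 0
    simpa using this
  have hsum (r : ℝ) (s : Finset (Fin n)) (z : Fin n → ℝ) :
      V r (∑ i ∈ s, z i • Pi.single i (1 : ℝ)) = ∑ i ∈ s, z i • V r (Pi.single i 1) := by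
    induction s using Finset.induction_on with
    | empty => simpa using hV0 r
    | insert i s hi ih =>
      rw [Finset.sum_insert hi, Finset.sum_insert hi, add_comm, hadd, ih, add_comm]
  have hlin (r : ℝ) (z : Fin n → ℝ) : V r z = ∑ i, z i • V r (Pi.single i 1) := by
    rw [← hsum, ← pi_eq_sum_univ' z]
  -- A compact interval inside the half-line with both radii in its interior. On it the finitely
  -- many fields `V s (Pi.single i 1)` are bounded, which gives a uniform Lipschitz constant; the
  -- coefficients may blow up at `c`.
  set p := (c + min r r₀) / 2 with hp
  set q := max r r₀ + 1 with hq
  have hcp : c < p := by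
    have : c < min r r₀ := lt_min hr hr₀
    linarith
  have hsub : Icc p q ⊆ Ioi c := fun s hs => lt_of_lt_of_le hcp hs.1
  have hbound (i : Fin n) : ∃ C, ∀ s ∈ Icc p q, ‖V s (Pi.single i 1)‖ ≤ C :=
    isCompact_Icc.exists_bound_of_continuousOn ((hcont _).mono hsub)
  choose C hC using hbound
  have hlip (s : ℝ) (hs : s ∈ Icc p q) : LipschitzWith (∑ i, (C i).toNNReal) (V s) := by
    refine LipschitzWith.of_dist_le_mul fun z w => ?_
    have hd : V s z - V s w = ∑ i, (z i - w i) • V s (Pi.single i 1) := by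
      rw [hlin s z, hlin s w, ← Finset.sum_sub_distrib]
      simp only [sub_smul]
    rw [dist_eq_norm, hd, dist_eq_norm, NNReal.coe_sum, Finset.sum_mul]
    refine (norm_sum_le _ _).trans (Finset.sum_le_sum fun i _ => ?_)
    rw [norm_smul, mul_comm]
    exact mul_le_mul ((hC i s hs).trans (Real.le_coe_toNNReal _)) (norm_le_pi_norm (z - w) i)
      (norm_nonneg _) NNReal.zero_le_coe
  have hmem {s : ℝ} (h1 : min r r₀ ≤ s) (h2 : s ≤ max r r₀) : s ∈ Ioo p q := by
    have : c < min r r₀ := lt_min hr hr₀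
    constructor <;> linarith
  have := ODE_solution_unique_of_mem_Ioo (v := V) (s := fun _ => univ) (f := y) (g := fun _ => 0)
    (fun t ht => (hlip t (Ioo_subset_Icc_self ht)).lipschitzOnWith)
    (hmem (min_le_right _ _) (le_max_right _ _))
    (fun t ht => ⟨hy t (hsub (Ioo_subset_Icc_self ht)), mem_univ _⟩)
    (fun t _ => ⟨by simpa [hV0] using hasDerivAt_const t (0 : Fin n → ℝ), mem_univ _⟩) h0
  exact this (hmem (min_le_left _ _) (le_max_left _ _))

/-! ### The field equations as a linear first-order system -/

/-- The trace quantity `l` of the linearized Ricci tensor for the data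
`y = (h_{tt}, h_{t3}, h_{33}, h_{tt}', h_{t3}', h_{33}', h_{rr})`. -/
def odeTrace (μ a r : ℝ) (y : Fin 7 → ℝ) : ℝ :=
  ((-(r ^ 4 + μ * a ^ 2) * y 3 - 2 * μ * a * y 4 + (r ^ 2 - μ) * y 5
      - 4 * r ^ 3 * y 0 + 2 * r * y 2) / Del μ a r
    - (-(r ^ 4 + μ * a ^ 2) * y 0 - 2 * μ * a * y 1 + (r ^ 2 - μ) * y 2)
      * (4 * r ^ 3 - 2 * μ * r) / Del μ a r ^ 2) / 2

/-- The derivative of `G h_{rr}`. -/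
def odeRho (μ a r : ℝ) (y : Fin 7 → ℝ) : ℝ :=
  2 * odeTrace μ a r y + 2 * r ^ 3 / Del μ a r * (2 * y 2 / r ^ 2
    - Del μ a r / r ^ 4 * y 6 * (4 - 2 * (r ^ 2 + μ * a ^ 2 / r ^ 2) / r ^ 2))

/-- The linear differential equation of a solution in the gauge. -/
def odeField (μ a r : ℝ) (y : Fin 7 → ℝ) : Fin 7 → ℝ :=
  let d := Del μ a r
  let b := -(μ * a / r ^ 2)
  let k := r ^ 2 + μ * a ^ 2 / r ^ 2
  let m₁ := μ * r / d
  let m₂ := -(2 * μ * a * r / d)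
  let m₃ := μ * a / (r * d)
  let m₄ := (r ^ 4 - μ * r ^ 2 - μ * a ^ 2) / (r * d)
  let ν := 3 / (2 * r) + (μ * r ^ 2 - 2 * μ * a ^ 2) / (r * d)
  let ρ := d / r ^ 4 * y 6
  let ρ' := odeRho μ a r y
  let l := odeTrace μ a r y
  ![y 3, y 4, y 5,
    2 * (r ^ 4 / d * (4 * y 1 * b / r ^ 4 + 2 * ρ * b ^ 2 / r ^ 4) - ρ' * μ / (2 * r ^ 3)
      - ν * y 3 + 2 * (y 3 * m₁ + y 4 * m₃)
      - 2 * (m₁ ^ 2 * y 0 + 2 * m₁ * m₃ * y 1 + m₃ ^ 2 * y 2) + l * μ / r ^ 3),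
    2 * (r ^ 4 / d * (2 * (y 1 * k + b * y 2) / r ^ 4 + 2 * ρ * b * k / r ^ 4)
      + ρ' * μ * a / (2 * r ^ 3) - ν * y 4 + (y 3 * m₂ + y 4 * m₄ + y 4 * m₁ + y 5 * m₃)
      - 2 * (m₁ * m₂ * y 0 + (m₁ * m₄ + m₃ * m₂) * y 1 + m₃ * m₄ * y 2) - l * μ * a / r ^ 3),
    2 * (r ^ 4 / d * (4 * y 2 * k / r ^ 4 + 2 * ρ * k ^ 2 / r ^ 4)
      + ρ' * (r - μ * a ^ 2 / r ^ 3) / 2 - ν * y 5 + 2 * (y 4 * m₂ + y 5 * m₄)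
      - 2 * (m₂ ^ 2 * y 0 + 2 * m₂ * m₄ * y 1 + m₄ ^ 2 * y 2) - l * (r - μ * a ^ 2 / r ^ 3)),
    r ^ 4 / d * (ρ' - (2 * μ / r ^ 3 - 4 * μ * a ^ 2 / r ^ 5) * y 6)]

lemma odeTrace_add_smul (μ a r t : ℝ) (y z : Fin 7 → ℝ) :
    odeTrace μ a r (y + t • z) = odeTrace μ a r y + t * odeTrace μ a r z := by
  simp only [odeTrace, Pi.add_apply, Pi.smul_apply, smul_eq_mul]
  ring

lemma odeRho_add_smul (μ a r t : ℝ) (y z : Fin 7 → ℝ) :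
    odeRho μ a r (y + t • z) = odeRho μ a r y + t * odeRho μ a r z := by
  simp only [odeRho, odeTrace_add_smul, Pi.add_apply, Pi.smul_apply, smul_eq_mul]
  ring

lemma odeField_add_smul (μ a r t : ℝ) (y z : Fin 7 → ℝ) :
    odeField μ a r (y + t • z) = odeField μ a r y + t • odeField μ a r z := by
  simp only [odeField, odeTrace_add_smul, odeRho_add_smul, Pi.add_apply, Pi.smul_apply, smul_eq_mul,
    Matrix.smul_cons, Matrix.cons_add_cons, Matrix.smul_empty, Matrix.empty_add_empty]
  generalize odeRho μ a r z = R
  generalize odeRho μ a r y = S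
  generalize odeTrace μ a r z = T
  generalize odeTrace μ a r y = U
  generalize Del μ a r = d
  refine congrArg _ (congrArg _ (congrArg _ ?_))
  ext i
  fin_cases i <;> simp only [Fin.isValue, Fin.zero_eta, Fin.mk_one, Fin.reduceFinMk,
    Matrix.cons_val] <;> ring

lemma continuousOn_odeField {μ a : ℝ} (hμ : 0 < μ) (ha : 4 * a ^ 2 < μ) (y : Fin 7 → ℝ) :
    ContinuousOn (fun r => odeField μ a r y) (Ioi (rPlus μ a)) := by
  have hr : ∀ r ∈ Ioi (rPlus μ a), r ≠ 0 := fun r hr => (rad_pos hμ ha hr).ne'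
  have hD : ∀ r ∈ Ioi (rPlus μ a), Del μ a r ≠ 0 := fun r hr => (Del_pos hμ ha hr).ne'
  have cD : Continuous (Del μ a) := (contDiff_Del μ a).continuous
  have hT : ContinuousOn (fun r => odeTrace μ a r y) (Ioi (rPlus μ a)) := by
    unfold odeTrace
    fun_prop (disch := intro r hr'; simp [hr r hr', hD r hr'])
  have hR : ContinuousOn (fun r => odeRho μ a r y) (Ioi (rPlus μ a)) := by
    unfold odeRho
    fun_prop (disch := intro r hr'; simp [hr r hr', hD r hr'])
  refine continuousOn_pi.2 fun i => ?_
  fin_cases i <;> simp only [odeField, Fin.isValue, Fin.zero_eta, Fin.mk_one, Fin.reduceFinMk,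
    Matrix.cons_val] <;>
    fun_prop (disch := intro r hr'; simp [hr r hr', hD r hr'])

/-- The field equations in the gauge, solved for the highest derivatives. -/
lemma derivs_eq_odeField {μ a r : ℝ} (hr : 0 < r) (hD : 0 < Del μ a r) {p q s : Fin 7 → ℝ}
    (hp : p 6 = 0) (hq : q 6 = 0) (hs : s 6 = 0) (h : ricciMode μ a r p q s = 0) :
    ![q 0, q 2, q 5, s 0, s 2, s 5, q 3]
      = odeField μ a r ![p 0, p 2, p 5, q 0, q 2, q 5, p 3] := by
  have h0 : (0 : Matrix (Fin 5) (Fin 5) ℝ) = modeMatrix 0 0 0 0 0 0 0 := by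
    ext i j
    fin_cases i <;> fin_cases j <;> rfl
  rw [h0, ricciMode, modeMatrix_inj] at h
  obtain ⟨htt, -, ht3, -, -, h33, h11⟩ := h
  simp only [hp, hq, hs] at htt ht3 h33 h11
  simp only [odeField, odeRho, odeTrace, Matrix.cons_val]
  generalize Del μ a r = d at *
  ext i
  fin_cases i <;> simp only [Fin.isValue, Fin.zero_eta, Fin.mk_one, Fin.reduceFinMk,
    Matrix.cons_val]
  -- The `tt` equation gives the second derivative of `h_{tt}` in terms of `h_{rr}'`, and the
  -- multiple of the angular equation `h11` replaces `h_{rr}'` by lower-order data. The `t3` and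
  -- `33` entries follow the same pattern.
  · linear_combination (norm := skip) -(2 * r ^ 4 / d) * htt - μ / r ^ 3 * (2 * r ^ 3 / d) * h11
    field_simp
    ring
  · linear_combination (norm := skip) -(2 * r ^ 4 / d) * ht3
      + μ * a / r ^ 3 * (2 * r ^ 3 / d) * h11
    field_simp
    ring
  · linear_combination (norm := skip) -(2 * r ^ 4 / d) * h33
      + (r - μ * a ^ 2 / r ^ 3) * (2 * r ^ 3 / d) * h11
    field_simp
    ring
  · linear_combination (norm := skip) (r ^ 4 / d) * (2 * r ^ 3 / d) * h11
    field_simp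
    ring

/-- The constraint: `h_{rr}` vanishes with the initial data. -/
lemma constraint {μ a r : ℝ} (hμ : 0 < μ) (ha : 4 * a ^ 2 < μ) (hr : rPlus μ a < r)
    {p q s : Fin 7 → ℝ} (hp : p 6 = 0) (hq : q 6 = 0) (hs : s 6 = 0)
    (h0 : p 0 = 0 ∧ p 2 = 0 ∧ p 5 = 0 ∧ q 0 = 0 ∧ q 2 = 0 ∧ q 5 = 0)
    (h : ricciMode μ a r p q s = 0) : p 3 = 0 := by
  have h' : (0 : Matrix (Fin 5) (Fin 5) ℝ) = modeMatrix 0 0 0 0 0 0 0 := by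
    ext i j
    fin_cases i <;> fin_cases j <;> rfl
  rw [h', ricciMode, modeMatrix_inj] at h
  obtain ⟨htt, -, ht3, hrr, -, h33, h11⟩ := h
  obtain ⟨p0, p2, p5, q0, q2, q5⟩ := h0
  have hr0 := rad_pos hμ ha hr
  have hD := Del_pos hμ ha hr
  have hu := sq_gt hμ ha hr
  have hδ := D_pos hμ ha
  have hDu : Del μ a r = r ^ 4 - μ * r ^ 2 + μ * a ^ 2 := rfl
  simp only [hp, hq, hs, p0, p2, p5, q0, q2, q5, mul_zero, zero_mul, add_zero, zero_add, sub_zero,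
    zero_sub, neg_zero, zero_div] at htt ht3 hrr h33 h11
  have h3 : 0 < 6 * r ^ 4 - 2 * μ * a ^ 2 := by nlinarith [sq_nonneg a]
  -- The combination is the full trace of `δR` minus `2 G δR_{rr}`, a multiple of the `rr` component
  -- of the linearized Einstein tensor. Derivatives of `h_{rr}` cancel in it, and with vanishing
  -- data only a multiple of `h_{rr}` itself is left.
  have key : Del μ a r / r ^ 4 * p 3 * (6 * r ^ 4 - 2 * μ * a ^ 2) / r ^ 6 = 0 := by
    linear_combination (norm := skip) -(Del μ a r / r ^ 4) * hrr
      - (r ^ 4 + μ * a ^ 2) / Del μ a r * htt - 2 * (μ * a / Del μ a r) * ht3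
      + (r ^ 2 - μ) / Del μ a r * h33 + 2 / r ^ 2 * h11
    field_simp
    rw [hDu]
    ring
  have h4 : p 3 * (Del μ a r / r ^ 4 * (6 * r ^ 4 - 2 * μ * a ^ 2) / r ^ 6) = 0 := by
    linear_combination key
  exact (mul_eq_zero.1 h4).resolve_right (by positivity)

lemma HasProfile.eq_zero_of_isGaugeFixed {μ a : ℝ} {h : TensorField} {p q s : ℝ → Fin 7 → ℝ}
    (hh : HasProfile μ a h p q s) (hg : IsGaugeFixed μ a h) {r : ℝ} (hr : rPlus μ a < r) :
    p r 1 = 0 ∧ p r 4 = 0 ∧ p r 6 = 0 := by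
  have := hg _ (equator_mem (t := 0) hr)
  rw [hh.eqOn (equator_mem hr)] at this
  exact this

lemma HasProfile.deriv_eq_zero {μ a : ℝ} {h : TensorField} {p q s : ℝ → Fin 7 → ℝ}
    (hh : HasProfile μ a h p q s) {i : Fin 7} (h0 : ∀ r, rPlus μ a < r → p r i = 0) {r : ℝ}
    (hr : rPlus μ a < r) : q r i = 0 ∧ s r i = 0 := by
  have hq (r : ℝ) (hr : rPlus μ a < r) : q r i = 0 :=
    (hh.deriv₁ r hr i).unique ((hasDerivAt_const r (0 : ℝ)).congr_of_eventuallyEq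
      (Filter.mem_of_superset (Ioi_mem_nhds hr) fun s hs => h0 s hs))
  exact ⟨hq r hr, (hh.deriv₂ r hr i).unique ((hasDerivAt_const r (0 : ℝ)).congr_of_eventuallyEq
      (Filter.mem_of_superset (Ioi_mem_nhds hr) fun s hs => hq s hs))⟩

/-- The constraint supplies the seventh initial value, `h_{rr} = 0`; uniqueness for the linear
system does the rest. -/
lemma HasProfile.eq_zero_of_dataVec {μ a : ℝ} (hμ : 0 < μ) (ha : 4 * a ^ 2 < μ)
    {h : TensorField} {p q s : ℝ → Fin 7 → ℝ} (hh : HasProfile μ a h p q s)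
    (hg : IsGaugeFixed μ a h) (hs : IsSolution μ a h) {r₀ : ℝ} (hr₀ : rPlus μ a < r₀)
    (h0 : dataVec (p r₀) (q r₀) = 0) {r : ℝ} (hr : rPlus μ a < r) : p r = 0 := by
  rw [hh.isSolution_iff hμ ha] at hs
  have hp6 (r : ℝ) (hr : rPlus μ a < r) := (hh.eq_zero_of_isGaugeFixed hg hr).2.2
  have hq6 (r : ℝ) (hr : rPlus μ a < r) := hh.deriv_eq_zero hp6 hr
  have h3 : p r₀ 3 = 0 := constraint hμ ha hr₀ (hp6 _ hr₀) (hq6 _ hr₀).1 (hq6 _ hr₀).2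
    ⟨congrFun h0 0, congrFun h0 1, congrFun h0 2, congrFun h0 3, congrFun h0 4, congrFun h0 5⟩
    (hs _ hr₀)
  have key := eq_zero_of_linear_ode (V := odeField μ a) (odeField_add_smul μ a)
    (continuousOn_odeField hμ ha)
    (y := fun r => ![p r 0, p r 2, p r 5, q r 0, q r 2, q r 5, p r 3]) (fun r hr => by
      rw [← derivs_eq_odeField (rad_pos hμ ha hr) (Del_pos hμ ha hr) (hp6 _ hr) (hq6 _ hr).1
        (hq6 _ hr).2 (hs _ hr)]
      refine hasDerivAt_pi.2 fun i => ?_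
      fin_cases i
      exacts [hh.deriv₁ r hr 0, hh.deriv₁ r hr 2, hh.deriv₁ r hr 5, hh.deriv₂ r hr 0,
        hh.deriv₂ r hr 2, hh.deriv₂ r hr 5, hh.deriv₁ r hr 3]) hr₀ (by
      ext i
      fin_cases i
      exacts [congrFun h0 0, congrFun h0 1, congrFun h0 2, congrFun h0 3, congrFun h0 4,
        congrFun h0 5, h3]) hr
  obtain ⟨g1, g4, g6⟩ := hh.eq_zero_of_isGaugeFixed hg hr
  ext i
  fin_cases i
  exacts [congrFun key 0, g1, congrFun key 1, congrFun key 6, g4, congrFun key 2, g6]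

lemma isGaugeFixed_comb {μ a : ℝ} (hμ : 0 < μ) (ha : 4 * a ^ 2 < μ) (c : Fin 6 → ℝ) :
    IsGaugeFixed μ a (comb μ a c) := fun x hx => by
  rw [comb_eqOn hμ ha c hx]
  exact ⟨rfl, rfl, rfl⟩

lemma isSolution_comb {μ a : ℝ} (hμ : 0 < μ) (ha : 4 * a ^ 2 < μ) (c : Fin 6 → ℝ) :
    IsSolution μ a (comb μ a c) :=
  ((hasProfile_comb hμ ha c).isSolution_iff hμ ha).2 fun _ hr =>
    ricciMode_comb (rad_pos hμ ha hr) (Del_pos hμ ha hr) c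

lemma IsSolution.add_smul {μ a : ℝ} (hμ : 0 < μ) (ha : 4 * a ^ 2 < μ) {h h' : TensorField}
    (hm : IsStationaryMode μ a h) (hm' : IsStationaryMode μ a h') (hs : IsSolution μ a h)
    (hs' : IsSolution μ a h') (t : ℝ) :
    IsStationaryMode μ a (h + t • h') ∧ IsSolution μ a (h + t • h') := by
  obtain ⟨p, q, s, hp⟩ := hm.exists_profile
  obtain ⟨p', q', s', hp'⟩ := hm'.exists_profile
  have := hp.add_smul hp' t
  refine ⟨this.isStationaryMode, (this.isSolution_iff hμ ha).2 fun r hr => ?_⟩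
  refine (ricciMode_add_smul μ a r t _ _ _ _ _ _).trans ?_
  rw [(hp.isSolution_iff hμ ha).1 hs r hr, (hp'.isSolution_iff hμ ha).1 hs' r hr]
  simp

lemma comb_injective {μ a : ℝ} (hμ : 0 < μ) (ha : 4 * a ^ 2 < μ) {c c' : Fin 6 → ℝ}
    (h : EqOn (comb μ a c) (comb μ a c') (exterior μ a)) : c = c' := by
  have hP (r : ℝ) (hr : rPlus μ a < r) (i : Fin 7) :
      combProfile μ a c r i = combProfile μ a c' r i := by
    have := h (equator_mem (t := 0) hr)
    rw [comb_eqOn hμ ha c (equator_mem hr), comb_eqOn hμ ha c' (equator_mem hr)] at this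
    obtain ⟨h0, h1, h2, h3, h4, h5, h6⟩ := modeMatrix_inj.1 this
    fin_cases i <;> assumption
  have hr : rPlus μ a < rPlus μ a + 1 := by linarith
  have hQ (i : Fin 7) : combProfile₁ μ a c (rPlus μ a + 1) i
      = combProfile₁ μ a c' (rPlus μ a + 1) i :=
    ((hasProfile_comb hμ ha c).deriv₁ _ hr i).unique
      (((hasProfile_comb hμ ha c').deriv₁ _ hr i).congr_of_eventuallyEq
        (Filter.mem_of_superset (Ioi_mem_nhds hr) fun s hs => hP s hs i))
  refine initialData_injective hμ ha hr ?_
  change dataVec _ _ = dataVec _ _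
  simp only [dataVec, hP _ hr, hQ]

lemma existsUnique_comb {μ a : ℝ} (hμ : 0 < μ) (ha : 4 * a ^ 2 < μ) {h : TensorField}
    (hm : IsStationaryMode μ a h) (hg : IsGaugeFixed μ a h) (hs : IsSolution μ a h) :
    ∃! c : Fin 6 → ℝ, EqOn h (comb μ a c) (exterior μ a) := by
  obtain ⟨p, q, s, hp⟩ := hm.exists_profile
  have hr : rPlus μ a < rPlus μ a + 1 := by linarith
  -- The combination is matched to the data of `h` at an arbitrarily chosen exterior radius; the
  -- difference is a gauge-fixed solution with zero data and hence vanishes.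
  obtain ⟨c, hc⟩ := exists_initialData hμ ha hr
    (dataVec (p (rPlus μ a + 1)) (q (rPlus μ a + 1)))
  have hd := hp.add_smul (hasProfile_comb hμ ha c) (-1)
  have hs' := (IsSolution.add_smul hμ ha hm (hasProfile_comb hμ ha c).isStationaryMode hs
    (isSolution_comb hμ ha c) (-1)).2
  have hg' : IsGaugeFixed μ a (h + (-1 : ℝ) • comb μ a c) := fun x hx => by
    have h1 := hg x hx
    have h2 := isGaugeFixed_comb hμ ha c x hx
    simp [h1, h2]
  have key : EqOn h (comb μ a c) (exterior μ a) := fun x hx => by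
    have h0 : p (x 1) + (-1 : ℝ) • combProfile μ a c (x 1) = 0 :=
      hd.eq_zero_of_dataVec hμ ha hg' hs' hr (by
        change dataVec (p _ + (-1 : ℝ) • combProfile μ a c _)
          (q _ + (-1 : ℝ) • combProfile₁ μ a c _) = 0
        rw [dataVec_add_smul, ← hc]
        exact (by simp [initialData])) hx.1
    rw [neg_one_smul, add_neg_eq_zero] at h0
    rw [hp.eqOn hx, comb_eqOn hμ ha c hx]
    simp only [h0]
  exact ⟨c, key, fun c' hc' => comb_injective hμ ha fun x hx => (hc' hx).symm.trans (key hx)⟩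

/-! ## The general solution and families of metrics -/

lemma exists_gauge_eqOn_comb {μ a : ℝ} (hμ : 0 < μ) (ha : 4 * a ^ 2 < μ) {h : TensorField}
    (hm : IsStationaryMode μ a h) (hs : IsSolution μ a h) :
    ∃ (ξ : CovectorField) (w X Z : ℝ → ℝ) (c : Fin 6 → ℝ),
      ContDiffOn ℝ ∞ w (Ioi (rPlus μ a)) ∧ ContDiffOn ℝ ∞ X (Ioi (rPlus μ a)) ∧
      ContDiffOn ℝ ∞ Z (Ioi (rPlus μ a)) ∧ IsStationaryGaugeField μ a ξ ∧
      EqOn (gaugeVariation (metric μ a) ξ)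
        (fun x => radialGauge μ a (x 1) (w (x 1)) (deriv w (x 1)) (X (x 1)) (Z (x 1)))
        (exterior μ a) ∧
      EqOn (h + gaugeVariation (metric μ a) ξ) (comb μ a c) (exterior μ a) := by
  obtain ⟨ξ, w, X, Z, hw, hX, hZ, hξ, hv, hg⟩ := exists_isGaugeFixed hμ ha hm
  obtain ⟨p, q, s, hp, hs', -⟩ := profile_of_gauge hμ ha hw hX hZ hv
  obtain ⟨hm'', hs''⟩ := IsSolution.add_smul hμ ha hm hp.isStationaryMode hs hs' 1
  rw [one_smul] at hm'' hs''
  obtain ⟨c, hc, -⟩ := existsUnique_comb hμ ha hm'' hg hs''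
  exact ⟨ξ, w, X, Z, c, hw, hX, hZ, hξ, hv, hc⟩

lemma hasDerivAt_metric_mass {μ a : ℝ} (hμ : 0 < μ) (ha : 4 * a ^ 2 < μ) {x : Point}
    (hx : x ∈ exterior μ a) (i j : Fin 5) :
    HasDerivAt (fun m => metric m a x i j) (hmd μ a x i j) μ := by
  have hr := (rad_pos hμ ha hx.1).ne'
  have hG := (G_pos hμ ha hx.1).ne'
  have h1 := (hasDerivAt_id μ).div_const (x 1 ^ 2)
  have h2 := ((hasDerivAt_id μ).mul_const a).div_const (x 1 ^ 2)
  have h3 := ((hasDerivAt_id μ).mul_const (a ^ 2)).div_const (x 1 ^ 2)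
  have h4 := ((hasDerivAt_id μ).mul_const (a ^ 2)).div_const (x 1 ^ 4)
  have dG : HasDerivAt (fun m => G m a (x 1)) (-(1 / x 1 ^ 2) + 1 * a ^ 2 / x 1 ^ 4) μ := by
    exact (h1.const_sub 1).fun_add h4
  refine (hasDerivAt_modeMatrix (h1.const_add (-1)) (hasDerivAt_const μ (0 : ℝ)) h2.neg
    ((hasDerivAt_const μ (1 : ℝ)).div dG hG) (hasDerivAt_const μ (0 : ℝ))
    (h3.const_add (x 1 ^ 2)) (hasDerivAt_const μ (x 1 ^ 2)) i j).congr_deriv ?_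
  refine congrArg (fun M : Matrix (Fin 5) (Fin 5) ℝ => M i j) ?_
  rw [hmd, modeMatrix_inj]
  refine ⟨by ring, rfl, by ring, ?_, rfl, by ring, rfl⟩
  field_simp
  ring

lemma hasDerivAt_metric_spin {μ a : ℝ} (hμ : 0 < μ) (ha : 4 * a ^ 2 < μ) {x : Point}
    (hx : x ∈ exterior μ a) (i j : Fin 5) :
    HasDerivAt (fun s => metric μ (s / μ) x i j) (hsd μ a x i j) (μ * a) := by
  have hr := (rad_pos hμ ha hx.1).ne'
  have hG := (G_pos hμ ha hx.1).ne'
  have ha' : μ * a / μ = a := by field_simp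
  have h0 : HasDerivAt (fun s => s / μ) (1 / μ) (μ * a) := (hasDerivAt_id _).div_const μ
  have h1 := (h0.const_mul μ).div_const (x 1 ^ 2)
  have h2 := ((h0.pow 2).const_mul μ).div_const (x 1 ^ 2)
  have h3 := ((h0.pow 2).const_mul μ).div_const (x 1 ^ 4)
  have dG : HasDerivAt (fun s => G μ (s / μ) (x 1)) (2 * a / x 1 ^ 4) (μ * a) := by
    refine (h3.const_add (1 - μ / x 1 ^ 2)).congr_deriv ?_
    simp [ha']
    field_simp
  refine (hasDerivAt_modeMatrix (hasDerivAt_const _ (-1 + μ / x 1 ^ 2))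
    (hasDerivAt_const _ (0 : ℝ)) h1.neg
    ((hasDerivAt_const _ (1 : ℝ)).div dG (by rwa [ha'])) (hasDerivAt_const _ (0 : ℝ))
    (h2.const_add (x 1 ^ 2)) (hasDerivAt_const _ (x 1 ^ 2)) i j).congr_deriv ?_
  refine congrArg (fun M : Matrix (Fin 5) (Fin 5) ℝ => M i j) ?_
  rw [hsd, modeMatrix_inj, ha']
  refine ⟨rfl, rfl, by field_simp, ?_, rfl, ?_, rfl⟩
  · field_simp
    ring
  · simp
    field_simp

lemma squashing_tangent {μ a : ℝ} (hμ : 0 < μ) (ha : 4 * a ^ 2 < μ) :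
    ∃ (k : TensorField) (ξ : CovectorField), IsStationaryGaugeField μ a ξ ∧
      (∀ x ∈ exterior μ a, ∀ i j,
        HasDerivAt (fun ε => dobiaschMaison μ a ε x i j) (k x i j) 0) ∧
      EqOn (hsq μ a) ((1 / 2 : ℝ) • k + gaugeVariation (metric μ a) ξ) (exterior μ a) := by
  -- Half of the tangent has `+-` component `r² (2 r² - μ) / 2`; this `w` makes the gauge
  -- contribution `2 r w` cancel it.
  obtain ⟨ξ, hξ, hv⟩ := exists_gauge hμ ha (w := fun r => -(r ^ 3 / 2) + μ / 4 * r)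
    (X := fun _ => 0) (Z := fun _ => 0) (by fun_prop) contDiffOn_const contDiffOn_const
  refine ⟨fun x => modeMatrix 0 0 0 (2 * (2 * x 1 ^ 2 - μ) / G μ a (x 1)) 0 0
    (x 1 ^ 2 * (2 * x 1 ^ 2 - μ)), ξ, hξ, fun x hx i j => ?_, fun x hx => ?_⟩
  · have hl (c : ℝ) : HasDerivAt (fun ε : ℝ => 1 - ε * c) (-c) 0 := by
      simpa using ((hasDerivAt_id (0 : ℝ)).mul_const c).const_sub 1
    have hk := ((hl (rPlus μ a ^ 2 - a ^ 2)).mul (hl (μ / 2 - D μ a - a ^ 2))).div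
      ((hl (x 1 ^ 2 - a ^ 2)).pow 2) (by simp)
    -- The derivative of `k_ε` at zero is `2 (r² - a²) - (r_+² - a²) - (r_-² - a²)`, and `r_+² +
    -- r_-² = μ`.
    have hk' := hk.congr_deriv (g' := 2 * x 1 ^ 2 - μ) (by
      simp [rPlus_sq hμ ha]
      ring)
    refine (hasDerivAt_modeMatrix (hasDerivAt_const _ (-1 + μ / x 1 ^ 2))
      (hasDerivAt_const _ (0 : ℝ)) (hasDerivAt_const _ (-(μ * a / x 1 ^ 2)))
      ((hk'.pow 2).div_const (G μ a (x 1))) (hasDerivAt_const _ (0 : ℝ))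
      (hasDerivAt_const _ (x 1 ^ 2 + μ * a ^ 2 / x 1 ^ 2))
      (hk'.const_mul (x 1 ^ 2)) i j).congr_deriv ?_
    refine congrArg (fun M : Matrix (Fin 5) (Fin 5) ℝ => M i j) ?_
    rw [modeMatrix_inj]
    simp
  · have hr := rad_pos hμ ha hx.1
    have hD := Del_pos hμ ha hx.1
    have dw : deriv (fun r : ℝ => -(r ^ 3 / 2) + μ / 4 * r) (x 1) = -(3 * x 1 ^ 2 / 2) + μ / 4 := by
      refine ((((hasDerivAt_pow 3 (x 1)).div_const 2).neg).add
        ((hasDerivAt_id (x 1)).const_mul (μ / 4))).deriv.trans ?_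
      simp
    rw [Pi.add_apply, Pi.smul_apply, hv hx]
    simp only [dw, smul_modeMatrix, radialGauge, modeMatrix_add, hsq, modeMatrix_inj, G_eq hr]
    generalize x 1 = r at *
    have hDu : Del μ a r = r ^ 4 - μ * r ^ 2 + μ * a ^ 2 := rfl
    refine ⟨?_, by ring, ?_, ?_, by ring, ?_, ?_⟩
    · field_simp
      ring
    · field_simp
      ring
    · field_simp
      rw [hDu]
      ring
    · field_simp
      ring
    · ring

/-! ## The symmetry operator -/

/-- The antisymmetric matrix with the given components above the diagonal. -/
def altMatrix (k₀₁ k₀₂ k₀₃ k₀₄ k₁₂ k₁₃ k₁₄ k₂₃ k₂₄ k₃₄ : ℝ) : Matrix (Fin 5) (Fin 5) ℝ :=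
  !![0, k₀₁, k₀₂, k₀₃, k₀₄;
     -k₀₁, 0, k₁₂, k₁₃, k₁₄;
     -k₀₂, -k₁₂, 0, k₂₃, k₂₄;
     -k₀₃, -k₁₃, -k₂₃, 0, k₃₄;
     -k₀₄, -k₁₄, -k₂₄, -k₃₄, 0]

lemma modeMatrix_contract_altMatrix
    (α β γ δ ε k₀₁ k₀₂ k₀₃ k₀₄ k₁₂ k₁₃ k₁₄ k₂₃ k₂₄ k₃₄ : ℝ) (k t : Fin 5) :
    ∑ i, ∑ j, modeMatrix α 0 β γ 0 δ ε k i * modeMatrix α 0 β γ 0 δ ε t j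
        * altMatrix k₀₁ k₀₂ k₀₃ k₀₄ k₁₂ k₁₃ k₁₄ k₂₃ k₂₄ k₃₄ i j
      = altMatrix (γ * (α * k₀₁ - β * k₁₄)) (ε * (α * k₀₂ - β * k₂₄)) (ε * (α * k₀₃ - β * k₃₄))
          ((α * δ - β ^ 2) * k₀₄) (γ * ε * k₁₂) (γ * ε * k₁₃) (γ * (δ * k₁₄ - β * k₀₁))
          (ε ^ 2 * k₂₃) (ε * (δ * k₂₄ - β * k₀₂)) (ε * (δ * k₃₄ - β * k₀₃)) k t := by
  simp only [Fin.sum_univ_five]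
  fin_cases k <;> fin_cases t <;> simp only [Fin.isValue, Fin.zero_eta, Fin.mk_one,
    Fin.reduceFinMk, modeMatrix, altMatrix, Matrix.of_apply, Matrix.cons_val, Matrix.cons_val',
    mul_zero, zero_mul, add_zero, zero_add] <;> ring

/-- Contraction with the Killing-Yano form only sees the antisymmetrized covariant derivative, and
most of the ten coefficients vanish. -/
lemma sum_altMatrix_mul (k₀₁ k₀₂ k₀₃ k₀₄ k₁₂ k₁₃ k₁₄ k₂₃ k₂₄ k₃₄ : ℝ) (M : Fin 5 → Fin 5 → ℝ) :
    ∑ k, ∑ t, altMatrix k₀₁ k₀₂ k₀₃ k₀₄ k₁₂ k₁₃ k₁₄ k₂₃ k₂₄ k₃₄ k t * M k t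
      = k₀₁ * (M 0 1 - M 1 0) + k₀₂ * (M 0 2 - M 2 0) + k₀₃ * (M 0 3 - M 3 0)
        + k₀₄ * (M 0 4 - M 4 0) + k₁₂ * (M 1 2 - M 2 1) + k₁₃ * (M 1 3 - M 3 1)
        + k₁₄ * (M 1 4 - M 4 1) + k₂₃ * (M 2 3 - M 3 2) + k₂₄ * (M 2 4 - M 4 2)
        + k₃₄ * (M 3 4 - M 4 3) := by
  simp [Fin.sum_univ_five, altMatrix]
  ring

/-- The components of the Killing-Yano form. -/
def killingYanoMatrix (a r : ℝ) : Fin 5 → Matrix (Fin 5) (Fin 5) ℝ :=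
  ![altMatrix 0 0 0 0 0 0 (-(a * r)) (a * r ^ 2) 0 0,
    altMatrix 0 0 0 (a * r) 0 0 0 0 0 0,
    altMatrix 0 0 (-(a * r ^ 2)) 0 0 0 0 0 0 (-r ^ 4),
    altMatrix 0 (a * r ^ 2) 0 0 0 0 0 0 (r ^ 4) 0,
    altMatrix (-(a * r)) 0 0 0 0 0 0 (-r ^ 4) 0 0]

set_option maxHeartbeats 2000000 in
lemma killingYano_eq (a : ℝ) (x : Point) (i j k : Fin 5) :
    killingYano a i j k x = killingYanoMatrix a (x 1) i j k := by
  fin_cases i <;> fin_cases j <;> fin_cases k <;>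
    simp [killingYano, wedge3, Matrix.det_fin_three, killingYanoMatrix, altMatrix]
  all_goals ring

/-- The components of the Killing-Yano form with the last two indices raised. -/
def killingYanoUpMatrix (μ a r : ℝ) : Fin 5 → Matrix (Fin 5) (Fin 5) ℝ :=
  let f₁ := μ * a ^ 2 / r ^ 3
  let f₂ := a * (-1 + μ / r ^ 2) / r
  let f₃ := a * r ^ 3 / Del μ a r
  let f₄ := a * (r ^ 2 + μ * a ^ 2 / r ^ 2) / r
  ![altMatrix (-f₁) 0 0 0 0 0 f₂ (a / r ^ 2) 0 0,
    altMatrix 0 0 0 (-f₃) 0 0 0 0 0 0,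
    altMatrix 0 0 a 0 0 0 0 0 0 (-1),
    altMatrix 0 (-a) 0 0 0 0 0 0 1 0,
    altMatrix f₄ 0 0 0 0 0 (-f₁) (-1) 0 0]

lemma killingYanoUp_eq {μ a : ℝ} (hμ : 0 < μ) (ha : 4 * a ^ 2 < μ) {x : Point}
    (hx : x ∈ exterior μ a) (l k t : Fin 5) :
    killingYanoUp μ a l k t x = killingYanoUpMatrix μ a (x 1) l k t := by
  have hr := rad_pos hμ ha hx.1
  have hD := Del_pos hμ ha hx.1
  have hDu : Del μ a (x 1) = x 1 ^ 4 - μ * x 1 ^ 2 + μ * a ^ 2 := rfl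
  simp only [killingYanoUp, metric_inv hμ ha hx, killingYano_eq]
  generalize x 1 = r at *
  simp only [radialMetricInv, G_eq hr, killingYanoMatrix, killingYanoUpMatrix]
  fin_cases l <;> simp only [Fin.isValue, Fin.zero_eta, Fin.mk_one, Fin.reduceFinMk,
    Matrix.cons_val, modeMatrix_contract_altMatrix, mul_zero, sub_zero, zero_sub]
  · congr 1
    · field_simp
    · field_simp
      ring
    · field_simp
  · congr 1
    field_simp
    rw [hDu]
    ring
  · congr 1 <;>
    · field_simp
      rw [hDu]
      ring
  · congr 1 <;>
    · field_simp
      rw [hDu]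
      ring
  · congr 1 <;> field_simp

/-- The symmetry operator on a mode tensor with components `p` and radial derivatives `q`. -/
def symMode (μ a r : ℝ) (p q : Fin 7 → ℝ) : Matrix (Fin 5) (Fin 5) ℝ :=
  let c := coef μ a r
  let f₁ := μ * a ^ 2 / r ^ 3
  let f₂ := a * (-1 + μ / r ^ 2) / r
  let f₃ := a * r ^ 3 / Del μ a r
  let f₄ := a * (r ^ 2 + μ * a ^ 2 / r ^ 2) / r
  let A := q 0 - (c 3 * p 0 + c 5 * p 2) + c 0 * p 3
  let B := q 2 - c 3 * p 2 - c 5 * p 5 + c 1 * p 3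
  let B' := q 2 - c 4 * p 0 - c 6 * p 2 + c 1 * p 3
  let C := q 5 - (c 4 * p 2 + c 6 * p 5) + c 2 * p 3
  let X := q 1 - c 7 * p 1 + c 3 * p 1 + c 5 * p 4
  let Z := q 4 - c 7 * p 4 + c 4 * p 1 + c 6 * p 4
  modeMatrix
    (2 * (f₁ * A + f₂ * B + 2 * a / r ^ 2 * (c 10 * p 6 - p 2)))
    (f₁ * X + f₂ * Z - 2 * a / r ^ 2 * p 4 - f₃ * (c 1 * p 1 - c 0 * p 4))
    (f₁ * B' + f₂ * C + 2 * a / r ^ 2 * (c 11 * p 6 - p 5) - f₄ * A - f₁ * B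
      - 2 * (c 10 * p 6 - p 2))
    (-2 * f₃ * (c 4 * p 0 + c 6 * p 2 - c 3 * p 2 - c 5 * p 5))
    (-f₃ * (c 2 * p 1 - c 1 * p 4) - f₄ * X - f₁ * Z + 2 * p 4)
    (-2 * (f₄ * B' + f₁ * C + 2 * (c 11 * p 6 - p 5)))
    (2 * (p 6 - a * p 2 - p 5))

set_option maxHeartbeats 4000000 in
lemma symOp_mode {μ a : ℝ} (hμ : 0 < μ) (ha : 4 * a ^ 2 < μ) {x : Point}
    (hx : x ∈ exterior μ a) {h : TensorField} {p : ℝ → Fin 7 → ℝ} {q : Fin 7 → ℝ}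
    (hh : EqOn h (fun y => radialMode (p (y 1))) (exterior μ a))
    (hp : ∀ i, HasDerivAt (fun r => p r i) (q i) (x 1)) :
    symOp μ a h x = symMode μ a (x 1) (p (x 1)) q := by
  have hr := rad_pos hμ ha hx.1
  -- This is the only relation among the connection coefficients that `symMode` uses; it normalizes
  -- the factor of `h_{+-}` in the `+-` component.
  have h10 : a * coef μ a (x 1) 10 + coef μ a (x 1) 11 = 1 := by
    simp only [coef, Matrix.cons_val]
    ring
  have key (l m : Fin 5) : ∑ k, ∑ t, killingYanoUpMatrix μ a (x 1) l k t
      * modeNabla (coef μ a (x 1)) (p (x 1)) q k m t = ![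
      -(μ * a ^ 2 / x 1 ^ 3) * (modeNabla (coef μ a (x 1)) (p (x 1)) q 0 m 1
          - modeNabla (coef μ a (x 1)) (p (x 1)) q 1 m 0)
        + a * (-1 + μ / x 1 ^ 2) / x 1 * (modeNabla (coef μ a (x 1)) (p (x 1)) q 1 m 4
          - modeNabla (coef μ a (x 1)) (p (x 1)) q 4 m 1)
        + a / x 1 ^ 2 * (modeNabla (coef μ a (x 1)) (p (x 1)) q 2 m 3
          - modeNabla (coef μ a (x 1)) (p (x 1)) q 3 m 2),
      -(a * x 1 ^ 3 / Del μ a (x 1)) * (modeNabla (coef μ a (x 1)) (p (x 1)) q 0 m 4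
          - modeNabla (coef μ a (x 1)) (p (x 1)) q 4 m 0),
      a * (modeNabla (coef μ a (x 1)) (p (x 1)) q 0 m 3
          - modeNabla (coef μ a (x 1)) (p (x 1)) q 3 m 0)
        - (modeNabla (coef μ a (x 1)) (p (x 1)) q 3 m 4
          - modeNabla (coef μ a (x 1)) (p (x 1)) q 4 m 3),
      -a * (modeNabla (coef μ a (x 1)) (p (x 1)) q 0 m 2
          - modeNabla (coef μ a (x 1)) (p (x 1)) q 2 m 0)
        + (modeNabla (coef μ a (x 1)) (p (x 1)) q 2 m 4
          - modeNabla (coef μ a (x 1)) (p (x 1)) q 4 m 2),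
      a * (x 1 ^ 2 + μ * a ^ 2 / x 1 ^ 2) / x 1 * (modeNabla (coef μ a (x 1)) (p (x 1)) q 0 m 1
          - modeNabla (coef μ a (x 1)) (p (x 1)) q 1 m 0)
        - μ * a ^ 2 / x 1 ^ 3 * (modeNabla (coef μ a (x 1)) (p (x 1)) q 1 m 4
          - modeNabla (coef μ a (x 1)) (p (x 1)) q 4 m 1)
        - (modeNabla (coef μ a (x 1)) (p (x 1)) q 2 m 3
          - modeNabla (coef μ a (x 1)) (p (x 1)) q 3 m 2)] l := by
    fin_cases l <;> simp only [killingYanoUpMatrix, Fin.isValue, Fin.zero_eta, Fin.mk_one,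
      Fin.reduceFinMk, Matrix.cons_val, sum_altMatrix_mul] <;> ring
  ext i j
  simp only [symOp, Matrix.of_apply, killingYanoUp_eq hμ ha hx, nabla2_mode hμ ha hx hh hp,
    symMode, Finset.sum_add_distrib, key]
  clear key
  generalize p (x 1) = P
  generalize coef μ a (x 1) = c at *
  generalize Del μ a (x 1) = d
  generalize x 1 = r at *
  fin_cases i <;> fin_cases j <;>
    simp only [Fin.isValue, Fin.zero_eta, Fin.mk_one, Fin.reduceFinMk,
      modeNabla, modeMatrix, crossMatrix, Matrix.of_apply, Matrix.cons_val, Matrix.cons_val']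
  all_goals first | ring1 | linear_combination (2 * P 6) * h10

/-- The action of `symOpGauged` on the coefficients of the six tensors. -/
def symCoef (μ a : ℝ) (c : Fin 6 → ℝ) : Fin 6 → ℝ :=
  ![4 * a * c 1 + 2 * μ * c 4 - 9 * D μ a * c 5, 2 * c 1 + 4 * a * c 4,
    -(2 * μ * (μ - 4 * a ^ 2) * c 4) + 3 * D μ a * (7 * μ - 4 * a ^ 2) * c 5,
    -(a * c 2) + 2 * c 3 + a * μ * (μ - 4 * a ^ 2) * c 4
      - 3 / 2 * a * (μ - 4 * a ^ 2) * D μ a * c 5, 6 * c 4, 6 * c 5]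

/-- The radial component of the gauge field in `symOpGauged`. -/
def symGauge (μ a : ℝ) (c : Fin 6 → ℝ) (r : ℝ) : ℝ :=
  r ^ 3 * (a * logFun μ a (combCoef μ a c 1) r + logFun μ a (combCoef μ a c 3) r) / Del μ a r

lemma hasDerivAt_symGauge {μ a r : ℝ} (hμ : 0 < μ) (ha : 4 * a ^ 2 < μ) (c : Fin 6 → ℝ)
    (hr : rPlus μ a < r) : HasDerivAt (symGauge μ a c)
      ((3 * r ^ 2 * (a * logFun μ a (combCoef μ a c 1) r + logFun μ a (combCoef μ a c 3) r)
        + r ^ 3 * (a * logFun₁ μ a (combCoef μ a c 1) r + logFun₁ μ a (combCoef μ a c 3) r))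
          / Del μ a r
        - r ^ 3 * (a * logFun μ a (combCoef μ a c 1) r + logFun μ a (combCoef μ a c 3) r)
          * (4 * r ^ 3 - 2 * μ * r) / Del μ a r ^ 2) r := by
  have hD := (Del_pos hμ ha hr).ne'
  refine (((hasDerivAt_pow 3 r).mul (((hasDerivAt_logFun hμ ha (combCoef μ a c 1) hr).const_mul
    a).add (hasDerivAt_logFun hμ ha (combCoef μ a c 3) hr))).div
      (hasDerivAt_Del μ a r) hD).congr_deriv ?_
  simp only [Pi.mul_apply, Pi.add_apply, Nat.cast_ofNat]
  field_simp
  ring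

lemma symOp_comb {μ a : ℝ} (hμ : 0 < μ) (ha : 4 * a ^ 2 < μ) (c : Fin 6 → ℝ) {x : Point}
    (hx : x ∈ exterior μ a) : symOp μ a (comb μ a c) x
      = symMode μ a (x 1) (combProfile μ a c (x 1)) (combProfile₁ μ a c (x 1)) :=
  symOp_mode hμ ha hx (comb_eqOn hμ ha c) ((hasProfile_comb hμ ha c).deriv₁ _ hx.1)

set_option maxHeartbeats 4000000 in
-- As for the field equations, the logarithm and `D` are treated as free variables, which is
-- possible because `symCoef` is written without `D²`.
lemma symMode_comb {μ a r : ℝ} (hr : 0 < r) (hD : 0 < Del μ a r) (c : Fin 6 → ℝ) :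
    symMode μ a r (combProfile μ a c r) (combProfile₁ μ a c r)
      + gaugeMode (coef μ a r) ![0, symGauge μ a c r, 0] 0 ![0,
      (3 * r ^ 2 * (a * logFun μ a (combCoef μ a c 1) r + logFun μ a (combCoef μ a c 3) r)
        + r ^ 3 * (a * logFun₁ μ a (combCoef μ a c 1) r + logFun₁ μ a (combCoef μ a c 3) r))
          / Del μ a r
        - r ^ 3 * (a * logFun μ a (combCoef μ a c 1) r + logFun μ a (combCoef μ a c 3) r)
          * (4 * r ^ 3 - 2 * μ * r) / Del μ a r ^ 2, 0]
      = radialMode (combProfile μ a (symCoef μ a c) r) := by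
  rw [symMode, gaugeMode, modeMatrix_add, radialMode, modeMatrix_inj]
  simp only [combProfile, combProfile₁, logFun, logFun₁, laurent, laurent₁, symGauge,
    combCoef, Matrix.cons_val, symCoef, coef, Pi.zero_apply]
  generalize logN μ a r = L
  generalize D μ a = δ
  have hDu : Del μ a r = r ^ 4 - μ * r ^ 2 + μ * a ^ 2 := rfl
  generalize Del μ a r = d at *
  refine ⟨?_, by ring, ?_, ?_, by ring, ?_, ?_⟩
  · field_simp
    rw [hDu]
    ring
  · field_simp
    rw [hDu]
    ring
  · field_simp
    rw [hDu]
    ring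
  · field_simp
    rw [hDu]
    ring
  · field_simp
    ring

lemma symOpGauged_comb {μ a : ℝ} (hμ : 0 < μ) (ha : 4 * a ^ 2 < μ) (c : Fin 6 → ℝ) :
    EqOn (symOpGauged μ a (comb μ a c)) (comb μ a (symCoef μ a c)) (exterior μ a) := by
  intro x hx
  rw [symOpGauged, Pi.add_apply, symOp_comb hμ ha c hx, comb_eqOn hμ ha _ hx,
    gaugeVariation_stationary hμ ha hx (p₀ := fun _ => 0) (p₁ := symGauge μ a c) (p₂ := fun _ => 0)
      (fun y hy => ?_) (hasDerivAt_const _ _) (hasDerivAt_symGauge hμ ha c hx.1)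
      (hasDerivAt_const _ _), symMode_comb (rad_pos hμ ha hx.1) (Del_pos hμ ha hx.1)]
  have hr := rad_pos hμ ha hy.1
  have hD := Del_pos hμ ha hy.1
  have : -(symOp μ a (comb μ a c) y 2 2) / (2 * y 1 * G μ a (y 1)) = symGauge μ a c (y 1) := by
    rw [symOp_comb hμ ha c hy, G_eq hr]
    -- In the gauge `h_{+-} = 0` the `+-` component of the image is `-2 (a h_{t3} + h_{33})`.
    change -(2 * ((0 : ℝ) - a * logFun μ a (combCoef μ a c 1) (y 1)
      - logFun μ a (combCoef μ a c 3) (y 1))) / _ = _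
    rw [symGauge]
    field_simp
    ring
  rw [this]

/-! ### The action on the basis and its eigentensors -/

lemma comb_add (μ a : ℝ) (c c' : Fin 6 → ℝ) : comb μ a (c + c') = comb μ a c + comb μ a c' := by
  simp [comb, add_smul, Finset.sum_add_distrib]

lemma comb_smul (μ a t : ℝ) (c : Fin 6 → ℝ) : comb μ a (t • c) = t • comb μ a c := by
  simp [comb, mul_smul, Finset.smul_sum]

lemma comb_single (μ a : ℝ) (i : Fin 6) : comb μ a (Pi.single i 1) = basisTensor μ a i := by
  simp [comb, Pi.single_apply, ite_smul]

lemma comb_sum (μ a : ℝ) (c : Fin 6 → ℝ) (f : Fin 6 → Fin 6 → ℝ) :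
    comb μ a (∑ i, c i • f i) = ∑ i, c i • comb μ a (f i) := by
  simp only [Fin.sum_univ_six, comb_add, comb_smul]

lemma symOpGauged_basis {μ a : ℝ} (hμ : 0 < μ) (ha : 4 * a ^ 2 < μ) (i : Fin 6) :
    EqOn (symOpGauged μ a (basisTensor μ a i)) (comb μ a (symCoef μ a (Pi.single i 1)))
      (exterior μ a) := by
  rw [← comb_single]
  exact symOpGauged_comb hμ ha _

lemma symCoef_eq_sum (μ a : ℝ) (c : Fin 6 → ℝ) :
    symCoef μ a c = ∑ i, c i • symCoef μ a (Pi.single i 1) := by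
  ext k
  simp only [Fin.sum_univ_six, Pi.add_apply, Pi.smul_apply, smul_eq_mul]
  fin_cases k <;> simp [symCoef, Pi.single_apply] <;> ring

/-- The coefficients of six independent eigentensors of `symOpGauged`. -/
def eigenCoef (μ a : ℝ) : Matrix (Fin 6) (Fin 6) ℝ :=
  !![1, 0, 0, 0, 0, 0;
     2 * a, 1, 0, 0, 0, 0;
     0, 0, 1, a / 2, 0, 0;
     0, 0, 0, 1, 0, 0;
     (2 * a ^ 2 + μ) / 3, a, -(μ * (μ - 4 * a ^ 2) / 3), a * μ * (μ - 4 * a ^ 2) / 3, 1, 0;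
     -(3 * D μ a / 2), 0, D μ a * (7 * μ - 4 * a ^ 2) / 2, a * D μ a * (8 * a ^ 2 - 5 * μ) / 4,
      0, 1]

lemma isUnit_det_eigenCoef (μ a : ℝ) : IsUnit (eigenCoef μ a).det := by
  refine Matrix.isUnit_det_of_left_inverse (B :=
    !![1, 0, 0, 0, 0, 0;
     -(2 * a), 1, 0, 0, 0, 0;
     0, 0, 1, -(a / 2), 0, 0;
     0, 0, 0, 1, 0, 0;
     2 * a * a - (2 * a ^ 2 + μ) / 3, -a, μ * (μ - 4 * a ^ 2) / 3,
      -(a * μ * (μ - 4 * a ^ 2) / 3) - a / 2 * (μ * (μ - 4 * a ^ 2) / 3), 1, 0;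
     3 * D μ a / 2, 0, -(D μ a * (7 * μ - 4 * a ^ 2) / 2),
      -(a * D μ a * (8 * a ^ 2 - 5 * μ) / 4) + a / 2 * (D μ a * (7 * μ - 4 * a ^ 2) / 2), 0, 1]) ?_
  ext i j
  rw [Matrix.mul_apply, Fin.sum_univ_six]
  fin_cases i <;> fin_cases j <;> simp [eigenCoef] <;> ring

lemma symCoef_eigenCoef (μ a : ℝ) (i : Fin 6) : symCoef μ a (eigenCoef μ a i)
      = (![0, 2, 0, 2, 6, 6] i : ℝ) • eigenCoef μ a i := by
  ext k
  fin_cases i <;> fin_cases k <;> simp [symCoef, eigenCoef] <;> ring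

lemma symOpGauged_eigenCoef {μ a : ℝ} (hμ : 0 < μ) (ha : 4 * a ^ 2 < μ) (i : Fin 6) :
    EqOn (symOpGauged μ a (comb μ a (eigenCoef μ a i)))
      ((![0, 2, 0, 2, 6, 6] i : ℝ) • comb μ a (eigenCoef μ a i)) (exterior μ a) := by
  rw [← comb_smul, ← symCoef_eigenCoef]
  exact symOpGauged_comb hμ ha _

/-- Linearity is inherited from the linear coefficient map `symCoef`, so differentiability of the
sums need not be discussed again. -/
lemma symOpGauged_comb_eq_sum {μ a : ℝ} (hμ : 0 < μ) (ha : 4 * a ^ 2 < μ) (c : Fin 6 → ℝ) :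
    EqOn (symOpGauged μ a (comb μ a c))
      (∑ i, c i • symOpGauged μ a (basisTensor μ a i)) (exterior μ a) := by
  intro x hx
  rw [symOpGauged_comb hμ ha c hx, symCoef_eq_sum, comb_sum, Finset.sum_apply, Finset.sum_apply]
  simp only [Pi.smul_apply, symOpGauged_basis hμ ha _ hx]

lemma symOpGauged_hg1 {μ a : ℝ} (hμ : 0 < μ) (ha : 4 * a ^ 2 < μ) :
    EqOn (symOpGauged μ a (hg1 μ a)) 0 (exterior μ a) := fun x hx => by
  refine (symOpGauged_basis hμ ha 0 hx).trans ?_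
  simp [comb_apply, symCoef]

lemma symOpGauged_hg2 {μ a : ℝ} (hμ : 0 < μ) (ha : 4 * a ^ 2 < μ) :
    EqOn (symOpGauged μ a (hg2 μ a)) ((4 * a) • hg1 μ a + (2 : ℝ) • hg2 μ a)
      (exterior μ a) := fun x hx => by
  refine (symOpGauged_basis hμ ha 1 hx).trans ?_
  simp [comb_apply, symCoef]

lemma symOpGauged_hmd {μ a : ℝ} (hμ : 0 < μ) (ha : 4 * a ^ 2 < μ) :
    EqOn (symOpGauged μ a (hmd μ a)) ((-a) • hsd μ a) (exterior μ a) := fun x hx => by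
  refine (symOpGauged_basis hμ ha 2 hx).trans ?_
  simp [comb_apply, symCoef]

lemma symOpGauged_hsd {μ a : ℝ} (hμ : 0 < μ) (ha : 4 * a ^ 2 < μ) :
    EqOn (symOpGauged μ a (hsd μ a)) ((2 : ℝ) • hsd μ a) (exterior μ a) := fun x hx => by
  refine (symOpGauged_basis hμ ha 3 hx).trans ?_
  simp [comb_apply, symCoef]

lemma symOpGauged_hsq {μ a : ℝ} (hμ : 0 < μ) (ha : 4 * a ^ 2 < μ) :
    EqOn (symOpGauged μ a (hsq μ a))
      ((6 : ℝ) • (hsq μ a + (μ / 3) • hg1 μ a + (2 * a / 3) • hg2 μ a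
        + (-(4 * D μ a ^ 2 / 3)) • hmd μ a + (2 * a * D μ a ^ 2 / 3) • hsd μ a))
      (exterior μ a) := fun x hx => by
  refine (symOpGauged_basis hμ ha 4 hx).trans ?_
  simp only [comb_apply, symCoef, Matrix.cons_val, D_sq hμ ha, Pi.add_apply, Pi.smul_apply]
  simp
  module

lemma symOpGauged_hsi {μ a : ℝ} (hμ : 0 < μ) (ha : 4 * a ^ 2 < μ) :
    EqOn (symOpGauged μ a (hsi μ a))
      ((6 : ℝ) • (hsi μ a + (-(3 * D μ a / 2)) • hg1 μ a
        + (D μ a / 2 * (7 * μ - 4 * a ^ 2)) • hmd μ a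
        + (-(a * D μ a ^ 3 / μ)) • hsd μ a))
      (exterior μ a) := fun x hx => by
  refine (symOpGauged_basis hμ ha 5 hx).trans ?_
  -- Reduces the cubic in `D` to the linear form used in `symCoef`.
  have h3 : a * D μ a ^ 3 / μ = a * (μ - 4 * a ^ 2) * D μ a / 4 := by
    rw [pow_succ, D_sq hμ ha]
    field_simp
  rw [h3]
  simp only [comb_apply, symCoef, Matrix.cons_val, Pi.add_apply, Pi.smul_apply]
  simp
  module

/-! ## Regularity on the horizon -/

lemma ExtendsAcrossHorizon.congr {μ a : ℝ} {h h' : TensorField}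
    (hh : ExtendsAcrossHorizon μ a h) (he : EqOn h' h (exterior μ a)) :
    ExtendsAcrossHorizon μ a h' := fun i j => by
  obtain ⟨F, ε, hε, hF, hF'⟩ := hh i j
  exact ⟨F, ε, hε, hF, fun x hx => by rw [he hx]; exact hF' x hx⟩

lemma IsHorizonRegular.of_gauge {μ a : ℝ} (hμ : 0 < μ) (ha : 4 * a ^ 2 < μ)
    {h h' : TensorField} {ξ : CovectorField} (hξ : IsGaugeField μ a ξ)
    (he : EqOn (h + gaugeVariation (metric μ a) ξ) h' (exterior μ a))
    (hr : IsHorizonRegular μ a h') : IsHorizonRegular μ a h := by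
  obtain ⟨η, hη, hx⟩ := hr
  refine ⟨ξ + (1 : ℝ) • η, hξ.add_smul hη 1, hx.congr fun x hx => ?_⟩
  rw [Pi.add_apply, gaugeVariation_add_smul hμ ha hξ hη 1 hx, Pi.add_apply h', ← he hx, one_smul]
  simp only [Pi.add_apply]
  abel

/-- Together with `IsHorizonRegular.of_gauge` this makes regularity a property of gauge classes, so
it may be tested on the gauge-fixed representative. -/
lemma IsHorizonRegular.gauge {μ a : ℝ} (hμ : 0 < μ) (ha : 4 * a ^ 2 < μ)
    {h h' : TensorField} {ξ : CovectorField} (hξ : IsGaugeField μ a ξ)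
    (he : EqOn (h + gaugeVariation (metric μ a) ξ) h' (exterior μ a))
    (hr : IsHorizonRegular μ a h) : IsHorizonRegular μ a h' := by
  obtain ⟨η, hη, hx⟩ := hr
  refine ⟨η + (-1 : ℝ) • ξ, hη.add_smul hξ (-1), hx.congr fun x hx => ?_⟩
  rw [Pi.add_apply, gaugeVariation_add_smul hμ ha hη hξ (-1) hx, ← he hx]
  simp only [Pi.add_apply, Pi.smul_apply]
  module

lemma horizonFrame_mode (μ a : ℝ) (x : Point) (tt tr t3 rr r3 s pm : ℝ) :
    horizonFrame μ a x * modeMatrix tt tr t3 rr r3 s pm * (horizonFrame μ a x).transpose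
      = modeMatrix tt (tr - ingoingSlope μ a (x 1) * (tt + angularVelocity μ a (x 1) * t3)) t3
        (rr - 2 * ingoingSlope μ a (x 1) * (tr + angularVelocity μ a (x 1) * r3)
          + ingoingSlope μ a (x 1) ^ 2 * (tt + 2 * angularVelocity μ a (x 1) * t3
            + angularVelocity μ a (x 1) ^ 2 * s))
        (r3 - ingoingSlope μ a (x 1) * (t3 + angularVelocity μ a (x 1) * s)) s pm := by
  rw [horizonFrame]
  generalize ingoingSlope μ a (x 1) = α
  generalize angularVelocity μ a (x 1) = Ω
  ext i j
  simp only [Matrix.mul_apply, Fin.sum_univ_five, Matrix.transpose_apply]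
  fin_cases i <;> fin_cases j <;>
    simp only [Fin.isValue, Fin.zero_eta, Fin.mk_one, Fin.reduceFinMk,
      modeMatrix, Matrix.of_apply, Matrix.cons_val, Matrix.cons_val'] <;> ring

lemma extendsAcrossHorizon_of_eqOn {μ a : ℝ} (hμ : 0 < μ) (ha : 4 * a ^ 2 < μ)
    {h : TensorField} {f : Fin 7 → ℝ → ℝ} (hf : ∀ i, ContDiffOn ℝ ∞ (f i) (Ioi 0))
    (he : ∀ x ∈ exterior μ a, horizonFrame μ a x * h x * (horizonFrame μ a x).transpose
      = modeMatrix (f 0 (x 1)) (f 1 (x 1)) (f 2 (x 1)) (f 3 (x 1)) (f 4 (x 1)) (f 5 (x 1))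
        (f 6 (x 1))) : ExtendsAcrossHorizon μ a h := by
  have key (k : ℝ → ℝ) (hk : ContDiffOn ℝ ∞ k (Ioi 0)) (i j : Fin 5)
      (hij : ∀ r, modeMatrix (f 0 r) (f 1 r) (f 2 r) (f 3 r) (f 4 r) (f 5 r) (f 6 r) i j = k r) :
      ∃ (F : ℝ → ℝ) (ε : ℝ), 0 < ε ∧ ContDiffOn ℝ ∞ F (Ioi (rPlus μ a - ε)) ∧
        ∀ x ∈ exterior μ a,
          (horizonFrame μ a x * h x * (horizonFrame μ a x).transpose) i j = F (x 1) :=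
    -- With `ε = r_+` the extension lives on the whole half-line `r > 0`.
    ⟨k, rPlus μ a, rPlus_pos hμ ha, by rwa [sub_self], fun x hx => by rw [he x hx, hij]⟩
  have h0 : ContDiffOn ℝ ∞ (fun _ : ℝ => (0 : ℝ)) (Ioi 0) := contDiffOn_const
  intro i j
  fin_cases i <;> fin_cases j
  exacts [key _ (hf 0) _ _ fun _ => rfl, key _ (hf 1) _ _ fun _ => rfl, key _ h0 _ _ fun _ => rfl,
    key _ h0 _ _ fun _ => rfl, key _ (hf 2) _ _ fun _ => rfl,
    key _ (hf 1) _ _ fun _ => rfl, key _ (hf 3) _ _ fun _ => rfl, key _ h0 _ _ fun _ => rfl,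
    key _ h0 _ _ fun _ => rfl, key _ (hf 4) _ _ fun _ => rfl,
    key _ h0 _ _ fun _ => rfl, key _ h0 _ _ fun _ => rfl, key _ (hf 6) _ _ fun _ => rfl,
    key _ h0 _ _ fun _ => rfl, key _ h0 _ _ fun _ => rfl,
    key _ h0 _ _ fun _ => rfl, key _ h0 _ _ fun _ => rfl, key _ h0 _ _ fun _ => rfl,
    key _ (hf 6) _ _ fun _ => rfl, key _ h0 _ _ fun _ => rfl,
    key _ (hf 2) _ _ fun _ => rfl, key _ (hf 4) _ _ fun _ => rfl, key _ h0 _ _ fun _ => rfl,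
    key _ h0 _ _ fun _ => rfl, key _ (hf 5) _ _ fun _ => rfl]

/-! ### The logarithmic solution is singular -/

/-- The coefficient of the logarithm in the component `33` does not vanish on the horizon. -/
lemma laurent_log_rPlus {μ a : ℝ} (hμ : 0 < μ) (ha : 4 * a ^ 2 < μ) (c : Fin 6 → ℝ) :
    laurent (combCoef μ a c 3 1) (rPlus μ a) = -(c 5 * (D μ a ^ 2 * (μ + D μ a) / μ)) := by
  have h2 := rPlus_sq hμ ha
  have h4 : rPlus μ a ^ 4 = (μ / 2 + D μ a) ^ 2 := by rw [← h2]; ring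
  have hD := D_sq hμ ha
  have hp := D_pos hμ ha
  simp only [laurent, combCoef, Matrix.cons_val, h2, h4]
  have : 0 < μ / 2 + D μ a := by positivity
  -- Eliminating `a²` instead of `D²` turns the claim into a rational identity in the independent
  -- quantities `μ` and `D`.
  have e : a ^ 2 = μ / 4 - D μ a ^ 2 / μ := by
    rw [hD]
    field_simp
    ring
  rw [e]
  have : 0 < μ + 2 * D μ a := by positivity
  field_simp
  ring

lemma coeff_eq_zero_of_isHorizonRegular {μ a : ℝ} (hμ : 0 < μ) (ha : 4 * a ^ 2 < μ)
    {c : Fin 6 → ℝ} (h : IsHorizonRegular μ a (comb μ a c)) : c 5 = 0 := by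
  obtain ⟨ξ, ⟨u, hu, eu⟩, hx⟩ := h
  obtain ⟨F, ε, hε, hF, hF'⟩ := hx 4 4
  obtain ⟨K, ε', hε', hK, hK'⟩ := hx 2 2
  -- Gauge fields change `h_{33}` and `h_{+-}` only through `ξ_r`, in the ratio `(r⁴ - μ a²) / r⁴`,
  -- and the ingoing frame leaves both components alone. Hence this combination is unaffected by the
  -- gauge, while `h_{+-}` of the original tensor is zero.
  have hs (r : ℝ) (hr : rPlus μ a < r) : logFun μ a (combCoef μ a c 3) r
      = F r - (r ^ 4 - μ * a ^ 2) / r ^ 4 * K r := by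
    have hm := equator_mem (t := 0) hr
    have h0 := rad_pos hμ ha hr
    have hD := Del_pos hμ ha hr
    have e1 := hF' _ hm
    have e2 := hK' _ hm
    rw [Pi.add_apply, comb_eqOn hμ ha c hm, gaugeVariation_eq hμ ha hm eu
      fun i => differentiableAt_of_contDiffOn_prod (hu i) hr] at e1 e2
    simp only [radialMode, gaugeMode, modeMatrix_add, horizonFrame_mode] at e1 e2
    rw [show F r = F (equator 0 r 1) from rfl, show K r = K (equator 0 r 1) from rfl, ← e1, ← e2]
    simp only [tr_equator, show equator 0 r 1 = r from rfl]
    change logFun μ a (combCoef μ a c 3) r = logFun μ a (combCoef μ a c 3) r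
      + -(2 * (-(Del μ a r * (r ^ 4 - μ * a ^ 2) / r ^ 7)) * u 1 (0, r))
      - (r ^ 4 - μ * a ^ 2) / r ^ 4 * (0 + 2 * (Del μ a r / r ^ 3) * u 1 (0, r))
    field_simp
    ring
  by_contra hc
  have hp := rPlus_pos hμ ha
  have hDp := D_pos hμ ha
  have hl : laurent (combCoef μ a c 3 1) (rPlus μ a) ≠ 0 := by
    rw [laurent_log_rPlus hμ ha]
    exact neg_ne_zero.2 (mul_ne_zero hc (by positivity))
  have cl (k : Fin 4 → ℝ) : ContinuousAt (laurent k) (rPlus μ a) :=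
    (hasDerivAt_laurent k hp.ne').continuousAt
  have cF : ContinuousAt F (rPlus μ a) :=
    hF.continuousOn.continuousAt (Ioi_mem_nhds (by linarith))
  have cK : ContinuousAt K (rPlus μ a) :=
    hK.continuousOn.continuousAt (Ioi_mem_nhds (by linarith))
  -- Solved for `ln N` and exponentiated, the identity would express `N` near the horizon as the
  -- exponential of a continuous function. But `N` tends to zero at `r_+`, where an exponential is
  -- positive.
  have cg : ContinuousAt (fun r => Real.exp ((F r - (r ^ 4 - μ * a ^ 2) / r ^ 4 * K r
      - laurent (combCoef μ a c 3 0) r) / laurent (combCoef μ a c 3 1) r)) (rPlus μ a) := by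
    have hq : ContinuousAt (fun r : ℝ => (r ^ 4 - μ * a ^ 2) / r ^ 4) (rPlus μ a) :=
      ContinuousAt.div (by fun_prop) (by fun_prop) (pow_ne_zero 4 hp.ne')
    exact Real.continuous_exp.continuousAt.comp (((cF.sub (hq.mul cK)).sub (cl _)).div (cl _) hl)
  have cN : ContinuousAt (fun r => (r ^ 2 - μ / 2 - D μ a) / (r ^ 2 - μ / 2 + D μ a))
      (rPlus μ a) :=
    ContinuousAt.div (by fun_prop) (by fun_prop) (by rw [rPlus_sq hμ ha]; linarith)
  have hev : (fun r => Real.exp ((F r - (r ^ 4 - μ * a ^ 2) / r ^ 4 * K r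
      - laurent (combCoef μ a c 3 0) r) / laurent (combCoef μ a c 3 1) r))
      =ᶠ[nhdsWithin (rPlus μ a) (Ioi (rPlus μ a))]
      fun r => (r ^ 2 - μ / 2 - D μ a) / (r ^ 2 - μ / 2 + D μ a) := by
    have hne : ∀ᶠ r in nhdsWithin (rPlus μ a) (Ioi (rPlus μ a)),
        laurent (combCoef μ a c 3 1) r ≠ 0 :=
      ((cl _).eventually_ne hl).filter_mono nhdsWithin_le_nhds
    filter_upwards [self_mem_nhdsWithin, hne] with r hr hr'
    obtain ⟨h1, h2⟩ := logN_args_pos hμ ha hr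
    rw [← hs r hr, logFun, add_sub_cancel_left, mul_div_cancel_left₀ _ hr', logN,
      Real.exp_log (div_pos h1 h2)]
  have := tendsto_nhds_unique_of_eventuallyEq (cg.tendsto.mono_left nhdsWithin_le_nhds)
    (cN.tendsto.mono_left nhdsWithin_le_nhds) hev
  rw [rPlus_sq hμ ha, show μ / 2 + D μ a - μ / 2 - D μ a = 0 by ring, zero_div] at this
  exact (Real.exp_pos _).ne' this

lemma logFun_combCoef (μ a : ℝ) {c : Fin 6 → ℝ} (hc : c 5 = 0) (i : Fin 4) (r : ℝ) :
    logFun μ a (combCoef μ a c i) r = laurent (combCoef μ a c i 0) r := by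
  have : combCoef μ a c i 1 = 0 := by
    funext k
    fin_cases i <;> fin_cases k <;> simp [combCoef, hc]
  simp [logFun, this, laurent]

/-! ### Regularity of the remaining tensors -/

lemma angular_denom_pos {μ a r : ℝ} (hμ : 0 < μ) (hr : 0 < r) : 0 < r ^ 4 + μ * a ^ 2 := by
  positivity

/-- `G (h_{rr} - α² (h_{tt} + 2 Ω h_{t3} + Ω² h_{33}))` for a combination without the sixth
tensor. -/
def radialDefect (μ a : ℝ) (c : Fin 6 → ℝ) (r : ℝ) : ℝ :=
  -((a ^ 2 * c 2 + 2 * a * c 3) / (r ^ 4 + μ * a ^ 2))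
    + c 4 * (-(2 * r ^ 2) + (r ^ 2 - μ / 2) * (r ^ 4 - μ * a ^ 2) / (r ^ 4 + μ * a ^ 2))

/-- The double pole `1/G²` of `h_{rr}` at the horizon cancels against `α²` times the `tt`, `t3` and
`33` components. What is left is a simple pole whose numerator is smooth for all `r > 0`. -/
lemma radialDefect_eq {μ a r : ℝ} (hμ : 0 < μ) (hr : 0 < r) (hD : 0 < Del μ a r)
    {c : Fin 6 → ℝ} (h0 : c 0 = 0) (h1 : c 1 = 0) (h5 : c 5 = 0) :
    combProfile μ a c r 3 - radialDefect μ a c r / G μ a r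
      - (r ^ 2 + μ * a ^ 2 / r ^ 2) / (r ^ 2 * G μ a r ^ 2) * (combProfile μ a c r 0
        + 2 * angularVelocity μ a r * combProfile μ a c r 2
        + angularVelocity μ a r ^ 2 * combProfile μ a c r 5) = 0 := by
  have hE := angular_denom_pos (a := a) hμ hr
  have hDu : Del μ a r = r ^ 4 - μ * r ^ 2 + μ * a ^ 2 := rfl
  simp only [combProfile, Matrix.cons_val, logFun_combCoef μ a h5, radialDefect, G_eq hr,
    angularVelocity, laurent]
  simp only [combCoef, Matrix.cons_val, h0, h1, h5]
  field_simp
  rw [hDu]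
  ring

lemma ContDiffOn.sqrt_metric {μ a : ℝ} (hμ : 0 < μ) :
    ContDiffOn ℝ ∞ (fun r => √(r ^ 2 + μ * a ^ 2 / r ^ 2)) (Ioi 0) := by
  refine ContDiffOn.sqrt ?_ fun r hr => ?_
  · exact ContDiffOn.add (by fun_prop) (contDiffOn_const.div (by fun_prop)
      fun r hr => pow_ne_zero 2 (ne_of_gt hr))
  · have : (0 : ℝ) < r := hr
    positivity

lemma isHorizonRegular_of_coeff_eq_zero {μ a : ℝ} (hμ : 0 < μ) (ha : 4 * a ^ 2 < μ)
    {c : Fin 6 → ℝ} (h0 : c 0 = 0) (h1 : c 1 = 0) (h5 : c 5 = 0) :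
    IsHorizonRegular μ a (comb μ a c) := by
  have hsub : Ioi (rPlus μ a) ⊆ Ioi 0 := Ioi_subset_Ioi (rPlus_pos hμ ha).le
  have hne : ∀ r ∈ Ioi (0 : ℝ), r ≠ 0 := fun r hr => ne_of_gt hr
  have hE : ∀ r ∈ Ioi (0 : ℝ), r ^ 4 + μ * a ^ 2 ≠ 0 := fun r hr =>
    (angular_denom_pos hμ hr).ne'
  have hsq : ∀ r ∈ Ioi (0 : ℝ), 0 < √(r ^ 2 + μ * a ^ 2 / r ^ 2) := fun r hr => by
    have : (0 : ℝ) < r := hr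
    exact Real.sqrt_pos.2 (by positivity)
  have sl (k : Fin 4 → ℝ) : ContDiffOn ℝ ∞ (laurent k) (Ioi 0) :=
    (((contDiffOn_const.div (by fun_prop) fun r hr => pow_ne_zero 2 (hne r hr)).add
      contDiffOn_const).add (by fun_prop)).add (by fun_prop)
  have sM : ContDiffOn ℝ ∞ (radialDefect μ a c) (Ioi 0) :=
    (contDiffOn_const.div (by fun_prop) hE).neg.add (contDiffOn_const.mul
      (ContDiffOn.add (by fun_prop) (ContDiffOn.div (by fun_prop) (by fun_prop) hE)))
  -- Chosen so that `2 α xh = radialDefect / G`: since `α` itself has the pole `1/G`, a smooth `tr`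
  -- component in the ingoing frame suffices to absorb the remaining simple pole.
  set xh : ℝ → ℝ := fun r =>
    r * radialDefect μ a c r / (2 * √(r ^ 2 + μ * a ^ 2 / r ^ 2)) with hxh
  have sx : ContDiffOn ℝ ∞ xh (Ioi 0) :=
    (contDiffOn_id.mul sM).div (contDiffOn_const.mul (ContDiffOn.sqrt_metric hμ))
      fun r hr => mul_ne_zero two_ne_zero (hsq r hr).ne'
  have sΩ : ContDiffOn ℝ ∞ (angularVelocity μ a) (Ioi 0) :=
    contDiffOn_const.div (by fun_prop) hE
  have sG : ContDiffOn ℝ ∞ (G μ a) (Ioi (rPlus μ a)) :=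
    (contDiffOn_const.sub (contDiffOn_const_div_pow hμ ha _ 2)).add
      (contDiffOn_const_div_pow hμ ha _ 4)
  have sα : ContDiffOn ℝ ∞ (ingoingSlope μ a) (Ioi (rPlus μ a)) :=
    ((ContDiffOn.sqrt_metric hμ).mono hsub).div (contDiffOn_id.mul sG) fun r hr =>
      mul_ne_zero (hne r (hsub hr)) (G_pos hμ ha hr).ne'
  -- These prescribed `tr` and `r3` components make the `tr` component in the ingoing frame equal to
  -- `xh` and the `r3` and `rr` components zero; the others are Laurent polynomials already.
  have sX : ContDiffOn ℝ ∞ (fun r => ingoingSlope μ a r * (laurent (combCoef μ a c 0 0) r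
      + angularVelocity μ a r * laurent (combCoef μ a c 1 0) r) + xh r) (Ioi (rPlus μ a)) :=
    (sα.mul (((sl _).add (sΩ.mul (sl _))).mono hsub)).add (sx.mono hsub)
  have sZ : ContDiffOn ℝ ∞ (fun r => ingoingSlope μ a r * (laurent (combCoef μ a c 1 0) r
      + angularVelocity μ a r * laurent (combCoef μ a c 3 0) r)) (Ioi (rPlus μ a)) :=
    sα.mul (((sl _).add (sΩ.mul (sl _))).mono hsub)
  obtain ⟨ξ, hξ, hv⟩ := exists_gauge hμ ha (w := fun _ => 0) contDiffOn_const sX sZ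
  refine ⟨ξ, hξ.isGaugeField, extendsAcrossHorizon_of_eqOn hμ ha
    (f := ![laurent (combCoef μ a c 0 0), xh, laurent (combCoef μ a c 1 0), fun _ => 0,
      fun _ => 0, laurent (combCoef μ a c 3 0), fun _ => 0]) (fun i => ?_) fun x hx => ?_⟩
  · fin_cases i
    exacts [sl _, sx, sl _, contDiffOn_const, contDiffOn_const, sl _, contDiffOn_const]
  · have hr := rad_pos hμ ha hx.1
    have hD := Del_pos hμ ha hx.1
    have hG := G_pos hμ ha hx.1
    have hs := hsq _ (hsub hx.1)
    have key := radialDefect_eq hμ hr hD h0 h1 h5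
    rw [Pi.add_apply, comb_eqOn hμ ha c hx, hv hx]
    simp only [radialMode, radialGauge, modeMatrix_add, horizonFrame_mode, Matrix.cons_val,
      deriv_const', mul_zero, zero_mul, zero_div, sub_zero, neg_zero, add_zero, modeMatrix_inj]
    simp only [combProfile, Matrix.cons_val, logFun_combCoef μ a h5] at key ⊢
    have hα : ingoingSlope μ a (x 1) ^ 2
        = (x 1 ^ 2 + μ * a ^ 2 / x 1 ^ 2) / (x 1 ^ 2 * G μ a (x 1) ^ 2) := by
      rw [ingoingSlope, div_pow, Real.sq_sqrt (by positivity), mul_pow]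
    have hx' : 2 * ingoingSlope μ a (x 1) * xh (x 1) = radialDefect μ a c (x 1) / G μ a (x 1) := by
      rw [ingoingSlope, hxh]
      field_simp
    refine ⟨trivial, by ring, trivial, ?_, by ring, trivial, trivial⟩
    rw [← hα, ← hx'] at key
    linear_combination key

lemma isHorizonRegular_comb_iff {μ a : ℝ} (hμ : 0 < μ) (ha : 4 * a ^ 2 < μ) (c : Fin 6 → ℝ) :
    IsHorizonRegular μ a (comb μ a c) ↔ c 5 = 0 := by
  refine ⟨coeff_eq_zero_of_isHorizonRegular hμ ha, fun h5 => ?_⟩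
  -- The two residual gauge modes are removed by gauge fields linear in `t`, which horizon
  -- regularity allows.
  refine IsHorizonRegular.of_gauge hμ ha (isGaugeField_lower hμ ha (-c 0) (-c 1))
    (h' := comb μ a ![0, 0, c 2, c 3, c 4, 0]) (fun x hx => ?_)
    (isHorizonRegular_of_coeff_eq_zero hμ ha rfl rfl rfl)
  rw [Pi.add_apply, gaugeVariation_lower hμ ha _ _ hx, comb_apply, comb_apply]
  simp only [h5, Pi.add_apply, Pi.smul_apply, Matrix.cons_val]
  module

/-! ### The symmetry operator preserves regularity -/

lemma symMode_add_smul (μ a r t : ℝ) (p q p' q' : Fin 7 → ℝ) :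
    symMode μ a r (p + t • p') (q + t • q') = symMode μ a r p q + t • symMode μ a r p' q' := by
  simp only [symMode, smul_modeMatrix, modeMatrix_add, modeMatrix_inj, Pi.add_apply,
    Pi.smul_apply, smul_eq_mul]
  refine ⟨?_, ?_, ?_, ?_, ?_, ?_, ?_⟩ <;> ring

/-- The symmetry operator maps stationary gauge variations to gauge variations in the components
`tr` and `r3`. -/
lemma symMode_radialGauge {μ a r : ℝ} (hr : 0 < r) (hD : 0 < Del μ a r)
    (w w' X X' Z Z' y : ℝ) :
    symMode μ a r
      ![-(2 * μ / r ^ 3 * w), X, 2 * μ * a / r ^ 3 * w,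
        2 * w' * r ^ 4 / Del μ a r
          - w * (2 * μ / r ^ 3 - 4 * μ * a ^ 2 / r ^ 5) * r ^ 8 / Del μ a r ^ 2,
        Z, (2 * r - 2 * μ * a ^ 2 / r ^ 3) * w, 2 * r * w]
      ![6 * μ / r ^ 4 * w - 2 * μ / r ^ 3 * w', X', 2 * μ * a / r ^ 3 * w' - 6 * μ * a / r ^ 4 * w,
        y, Z', (2 * r - 2 * μ * a ^ 2 / r ^ 3) * w' + (2 + 6 * μ * a ^ 2 / r ^ 4) * w,
        2 * r * w' + 2 * w]
      = modeMatrix 0 (symMode μ a r ![0, X, 0, 0, Z, 0, 0] ![0, X', 0, 0, Z', 0, 0] 0 1) 0 0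
        (symMode μ a r ![0, X, 0, 0, Z, 0, 0] ![0, X', 0, 0, Z', 0, 0] 1 4) 0 0 := by
  have hDu : Del μ a r = r ^ 4 - μ * r ^ 2 + μ * a ^ 2 := rfl
  simp only [symMode]
  rw [modeMatrix_inj]
  simp only [coef, modeMatrix, Matrix.of_apply, Matrix.cons_val, Matrix.cons_val']
  refine ⟨?_, trivial, ?_, ?_, trivial, ?_, ?_⟩
  · field_simp
    rw [hDu]
    ring
  · field_simp
    rw [hDu]
    ring
  · field_simp
    ring
  · field_simp
    rw [hDu]
    ring
  · field_simp
    ring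

lemma contDiffOn_coef {μ a : ℝ} (hμ : 0 < μ) (ha : 4 * a ^ 2 < μ) (i : Fin 12) :
    ContDiffOn ℝ ∞ (fun r => coef μ a r i) (Ioi (rPlus μ a)) := by
  have hr : ∀ r ∈ Ioi (rPlus μ a), r ≠ 0 := fun r hr => (rad_pos hμ ha hr).ne'
  have hD : ∀ r ∈ Ioi (rPlus μ a), Del μ a r ≠ 0 := fun r hr => (Del_pos hμ ha hr).ne'
  have cD : ContDiff ℝ ∞ (Del μ a) := contDiff_Del μ a
  fin_cases i <;> simp only [coef, Fin.isValue, Fin.zero_eta, Fin.mk_one, Fin.reduceFinMk,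
    Matrix.cons_val] <;>
    fun_prop (disch := intro r hr'; simp [hr r hr', hD r hr'])

lemma symMode_tr (μ a r X X' Z Z' : ℝ) :
    symMode μ a r ![0, X, 0, 0, Z, 0, 0] ![0, X', 0, 0, Z', 0, 0] 0 1
      = μ * a ^ 2 / r ^ 3 * (X' - coef μ a r 7 * X + coef μ a r 3 * X + coef μ a r 5 * Z)
        + a * (-1 + μ / r ^ 2) / r
          * (Z' - coef μ a r 7 * Z + coef μ a r 4 * X + coef μ a r 6 * Z)
        - 2 * a / r ^ 2 * Z - a * r ^ 3 / Del μ a r * (coef μ a r 1 * X - coef μ a r 0 * Z) := rfl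

lemma symMode_r3 (μ a r X X' Z Z' : ℝ) :
    symMode μ a r ![0, X, 0, 0, Z, 0, 0] ![0, X', 0, 0, Z', 0, 0] 1 4
      = -(a * r ^ 3 / Del μ a r) * (coef μ a r 2 * X - coef μ a r 1 * Z)
        - a * (r ^ 2 + μ * a ^ 2 / r ^ 2) / r
          * (X' - coef μ a r 7 * X + coef μ a r 3 * X + coef μ a r 5 * Z)
        - μ * a ^ 2 / r ^ 3 * (Z' - coef μ a r 7 * Z + coef μ a r 4 * X + coef μ a r 6 * Z)
        + 2 * Z := rfl

lemma contDiffOn_symMode {μ a : ℝ} (hμ : 0 < μ) (ha : 4 * a ^ 2 < μ) {X Z : ℝ → ℝ}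
    (hX : ContDiffOn ℝ ∞ X (Ioi (rPlus μ a))) (hZ : ContDiffOn ℝ ∞ Z (Ioi (rPlus μ a))) :
    ContDiffOn ℝ ∞ (fun r => symMode μ a r ![0, X r, 0, 0, Z r, 0, 0]
      ![0, deriv X r, 0, 0, deriv Z r, 0, 0] 0 1) (Ioi (rPlus μ a)) ∧
    ContDiffOn ℝ ∞ (fun r => symMode μ a r ![0, X r, 0, 0, Z r, 0, 0]
      ![0, deriv X r, 0, 0, deriv Z r, 0, 0] 1 4) (Ioi (rPlus μ a)) := by
  have hX' := ((contDiffOn_infty_iff_deriv_of_isOpen isOpen_Ioi).1 hX).2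
  have hZ' := ((contDiffOn_infty_iff_deriv_of_isOpen isOpen_Ioi).1 hZ).2
  have hr : ∀ r ∈ Ioi (rPlus μ a), r ≠ 0 := fun r hr => (rad_pos hμ ha hr).ne'
  have hD : ∀ r ∈ Ioi (rPlus μ a), Del μ a r ≠ 0 := fun r hr => (Del_pos hμ ha hr).ne'
  have hc (i : Fin 12) := contDiffOn_coef hμ ha i
  have h₁ := contDiffOn_const_div_pow hμ ha (μ * a ^ 2) 3
  have h₂ : ContDiffOn ℝ ∞ (fun r => a * (-1 + μ / r ^ 2) / r) (Ioi (rPlus μ a)) :=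
    (contDiffOn_const.mul (contDiffOn_const.add (contDiffOn_const_div_pow hμ ha μ 2))).div
      contDiffOn_id hr
  have h₃ : ContDiffOn ℝ ∞ (fun r => a * r ^ 3 / Del μ a r) (Ioi (rPlus μ a)) :=
    ContDiffOn.div (by fun_prop) (contDiff_Del μ a).contDiffOn hD
  have h₄ : ContDiffOn ℝ ∞ (fun r => a * (r ^ 2 + μ * a ^ 2 / r ^ 2) / r) (Ioi (rPlus μ a)) :=
    (contDiffOn_const.mul (ContDiffOn.add (by fun_prop)
      (contDiffOn_const_div_pow hμ ha (μ * a ^ 2) 2))).div contDiffOn_id hr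
  have hA := ((hX'.sub ((hc 7).mul hX)).add ((hc 3).mul hX)).add ((hc 5).mul hZ)
  have hB := ((hZ'.sub ((hc 7).mul hZ)).add ((hc 4).mul hX)).add ((hc 6).mul hZ)
  simp only [symMode_tr, symMode_r3]
  exact ⟨(((h₁.mul hA).add (h₂.mul hB)).sub ((contDiffOn_const_div_pow hμ ha (2 * a) 2).mul
      hZ)).sub (h₃.mul (((hc 1).mul hX).sub ((hc 0).mul hZ))),
    (((h₃.neg.mul (((hc 2).mul hX).sub ((hc 1).mul hZ))).sub (h₄.mul hA)).sub
      (h₁.mul hB)).add (contDiffOn_const.mul hZ)⟩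

lemma contDiffOn_symGauge {μ a : ℝ} (hμ : 0 < μ) (ha : 4 * a ^ 2 < μ) (c : Fin 6 → ℝ) :
    ContDiffOn ℝ ∞ (symGauge μ a c) (Ioi (rPlus μ a)) :=
  ((contDiffOn_id.pow 3).mul ((contDiffOn_const.mul (contDiffOn_logFun hμ ha _)).add
    (contDiffOn_logFun hμ ha _))).div (contDiff_Del μ a).contDiffOn
      fun _ hr => (Del_pos hμ ha hr).ne'

/-- The solution is split as a combination of the six tensors minus a stationary gauge variation.
The image of the combination has last coefficient `6 c 5 = 0` up to gauge. The image of the gauge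
variation has only `tr` and `r3` components, which are again pure gauge. -/
lemma isHorizonRegular_symOp {μ a : ℝ} (hμ : 0 < μ) (ha : 4 * a ^ 2 < μ) {h : TensorField}
    (hm : IsStationaryMode μ a h) (hs : IsSolution μ a h) (hr : IsHorizonRegular μ a h) :
    IsHorizonRegular μ a (symOp μ a h) := by
  obtain ⟨ξ, w, X, Z, c, hw, hX, hZ, hξ, hv, hc⟩ := exists_gauge_eqOn_comb hμ ha hm hs
  have h5 : c 5 = 0 := (isHorizonRegular_comb_iff hμ ha c).1 (hr.gauge hμ ha hξ.isGaugeField hc)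
  obtain ⟨p, q, s, hp, -, hpq⟩ := profile_of_gauge hμ ha hw hX hZ hv
  have hh : HasProfile μ a (comb μ a c + (-1 : ℝ) • gaugeVariation (metric μ a) ξ) _ _ _ :=
    (hasProfile_comb hμ ha c).add_smul hp (-1)
  have he : EqOn h (comb μ a c + (-1 : ℝ) • gaugeVariation (metric μ a) ξ) (exterior μ a) := by
    intro x hx
    rw [Pi.add_apply, ← hc hx]
    simp
  obtain ⟨sX, sZ⟩ := contDiffOn_symMode hμ ha hX hZ
  -- The field `η` reproduces the image of the gauge part, and `ζ` below restores `h_{+-} = 0` for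
  -- the image of the combination.
  obtain ⟨η, hη, hv'⟩ := exists_gauge hμ ha (w := fun _ => 0) contDiffOn_const sX sZ
  have hζ : IsStationaryGaugeField μ a (fun x => ![0, symGauge μ a c (x 1), 0, 0, 0]) :=
    ⟨![fun _ => 0, symGauge μ a c, fun _ => 0], fun i => by
      fin_cases i
      exacts [contDiffOn_const, contDiffOn_symGauge hμ ha c, contDiffOn_const], fun x _ => rfl⟩
  refine IsHorizonRegular.of_gauge hμ ha (hζ.add_smul hη 1).isGaugeField
    (h' := comb μ a (symCoef μ a c)) (fun x hx => ?_)
    ((isHorizonRegular_comb_iff hμ ha _).2 (by simp [symCoef, h5]))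
  have h0 := rad_pos hμ ha hx.1
  have hD := Del_pos hμ ha hx.1
  obtain ⟨ep, y, eq⟩ := hpq _ hx.1
  have e1 := gaugeVariation_stationary hμ ha hx (p₀ := fun _ => 0) (p₁ := symGauge μ a c)
    (p₂ := fun _ => 0) (fun y hy => rfl) (hasDerivAt_const _ _) (hasDerivAt_symGauge hμ ha c hx.1)
      (hasDerivAt_const _ _)
  have e2 := symMode_comb h0 hD c
  rw [Pi.add_apply, symOp_mode hμ ha hx (he.trans hh.eqOn) (hh.deriv₁ _ hx.1), Pi.add_apply,
    Pi.add_apply, Pi.smul_apply, Pi.smul_apply, symMode_add_smul,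
    gaugeVariation_add_smul hμ ha hζ.isGaugeField hη.isGaugeField 1 hx, Pi.add_apply, e1,
    (comb_eqOn hμ ha (symCoef μ a c) hx).trans e2.symm, ep, eq, symMode_radialGauge h0 hD, Pi.smul_apply, hv' hx]
  simp only [radialGauge, deriv_const', mul_zero, zero_mul, zero_div, sub_zero, neg_zero]
  module

end

end MyersPerry

theorem mainTheorem6 (μ a : ℝ) (hμ : 0 < μ) (ha : 4 * a ^ 2 < μ) :
    -- the gauge can be reached from every stationary perturbation in the mode
    (∀ h : TensorField, IsStationaryMode μ a h →
      ∃ ξ : CovectorField, IsStationaryGaugeField μ a ξ ∧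
        IsGaugeFixed μ a (h + gaugeVariation (metric μ a) ξ)) ∧
    -- the residual gauge freedom consists of the first two pieces, which are generated by
    -- `t ∂_t` and by `t σ̄₃ = 2 t ∂_φ`
    (∀ ξ : CovectorField, IsGaugeField μ a ξ →
      IsStationaryMode μ a (gaugeVariation (metric μ a) ξ) →
      IsGaugeFixed μ a (gaugeVariation (metric μ a) ξ) →
      ∃ c₁ c₂ : ℝ, EqOn (gaugeVariation (metric μ a) ξ)
        (c₁ • hg1 μ a + c₂ • hg2 μ a) (exterior μ a)) ∧
    EqOn (gaugeVariation (metric μ a) (lower (metric μ a) fun x => ![x 0, 0, 0, 0, 0]))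
      (hg1 μ a) (exterior μ a) ∧
    EqOn (gaugeVariation (metric μ a) (lower (metric μ a) fun x => ![0, 0, 0, 0, x 0]))
      (hg2 μ a) (exterior μ a) ∧
    -- the mass shift, the spin shift and the squashing are tangent to families of metrics
    (∀ x ∈ exterior μ a, ∀ i j,
      HasDerivAt (fun m => metric m a x i j) (hmd μ a x i j) μ) ∧
    (∀ x ∈ exterior μ a, ∀ i j,
      HasDerivAt (fun s => metric μ (s / μ) x i j) (hsd μ a x i j) (μ * a)) ∧
    (∃ (k : TensorField) (ξ : CovectorField), IsStationaryGaugeField μ a ξ ∧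
      (∀ x ∈ exterior μ a, ∀ i j,
        HasDerivAt (fun ε => dobiaschMaison μ a ε x i j) (k x i j) 0) ∧
      EqOn (hsq μ a) ((1 / 2 : ℝ) • k + gaugeVariation (metric μ a) ξ) (exterior μ a)) ∧
    -- the six pieces are a basis of the space of solutions in the gauge, and every stationary
    -- solution in the mode is gauge equivalent to a combination of them
    (∀ c : Fin 6 → ℝ, IsStationaryMode μ a (comb μ a c) ∧ IsGaugeFixed μ a (comb μ a c) ∧
      IsSolution μ a (comb μ a c)) ∧
    (∀ h : TensorField, IsStationaryMode μ a h → IsGaugeFixed μ a h → IsSolution μ a h →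
      ∃! c : Fin 6 → ℝ, EqOn h (comb μ a c) (exterior μ a)) ∧
    (∀ h : TensorField, IsStationaryMode μ a h → IsSolution μ a h →
      ∃ (ξ : CovectorField) (c : Fin 6 → ℝ), IsStationaryGaugeField μ a ξ ∧
        EqOn (h + gaugeVariation (metric μ a) ξ) (comb μ a c) (exterior μ a)) ∧
    -- the action of the symmetry operator
    (∀ c : Fin 6 → ℝ, EqOn (symOpGauged μ a (comb μ a c))
      (∑ i, c i • symOpGauged μ a (basisTensor μ a i)) (exterior μ a)) ∧
    EqOn (symOpGauged μ a (hg1 μ a)) 0 (exterior μ a) ∧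
    EqOn (symOpGauged μ a (hg2 μ a)) ((4 * a) • hg1 μ a + (2 : ℝ) • hg2 μ a)
      (exterior μ a) ∧
    EqOn (symOpGauged μ a (hmd μ a)) ((-a) • hsd μ a) (exterior μ a) ∧
    EqOn (symOpGauged μ a (hsd μ a)) ((2 : ℝ) • hsd μ a) (exterior μ a) ∧
    EqOn (symOpGauged μ a (hsq μ a))
      ((6 : ℝ) • (hsq μ a + (μ / 3) • hg1 μ a + (2 * a / 3) • hg2 μ a
        + (-(4 * D μ a ^ 2 / 3)) • hmd μ a + (2 * a * D μ a ^ 2 / 3) • hsd μ a))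
      (exterior μ a) ∧
    EqOn (symOpGauged μ a (hsi μ a))
      ((6 : ℝ) • (hsi μ a + (-(3 * D μ a / 2)) • hg1 μ a
        + (D μ a / 2 * (7 * μ - 4 * a ^ 2)) • hmd μ a
        + (-(a * D μ a ^ 3 / μ)) • hsd μ a))
      (exterior μ a) ∧
    -- six linearly independent eigentensors
    (∃ P : Matrix (Fin 6) (Fin 6) ℝ, IsUnit P.det ∧
      ∀ i, EqOn (symOpGauged μ a (comb μ a (P i)))
        ((![0, 2, 0, 2, 6, 6] i : ℝ) • comb μ a (P i)) (exterior μ a)) ∧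
    -- regularity on the horizon: only the last piece is singular, and regularity is preserved
    (∀ c : Fin 6 → ℝ, IsHorizonRegular μ a (comb μ a c) ↔ c 5 = 0) ∧
    (∀ h : TensorField, IsStationaryMode μ a h → IsSolution μ a h → IsHorizonRegular μ a h →
      IsHorizonRegular μ a (symOp μ a h)) := by
  refine ⟨fun h hh => ?_, fun ξ => residual_gauge hμ ha, ?_, ?_,
    fun x hx => hasDerivAt_metric_mass hμ ha hx, fun x hx => hasDerivAt_metric_spin hμ ha hx,
    squashing_tangent hμ ha,
    fun c => ⟨(hasProfile_comb hμ ha c).isStationaryMode, isGaugeFixed_comb hμ ha c,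
      isSolution_comb hμ ha c⟩,
    fun h => existsUnique_comb hμ ha, fun h hm hs => ?_, symOpGauged_comb_eq_sum hμ ha,
    symOpGauged_hg1 hμ ha, symOpGauged_hg2 hμ ha, symOpGauged_hmd hμ ha, symOpGauged_hsd hμ ha,
    symOpGauged_hsq hμ ha, symOpGauged_hsi hμ ha,
    ⟨eigenCoef μ a, isUnit_det_eigenCoef μ a, symOpGauged_eigenCoef hμ ha⟩,
    isHorizonRegular_comb_iff hμ ha, fun h => isHorizonRegular_symOp hμ ha⟩
  · obtain ⟨ξ, _, _, _, _, _, _, hξ, _, hg⟩ := exists_isGaugeFixed hμ ha hh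
    exact ⟨ξ, hξ, hg⟩
  · simpa using gaugeVariation_lower hμ ha 1 0
  · simpa using gaugeVariation_lower hμ ha 0 1
  · obtain ⟨ξ, _, _, _, c, _, _, _, hξ, _, hc⟩ := exists_gauge_eqOn_comb hμ ha hm hs
    exact ⟨ξ, c, hξ, hc⟩
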